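/- Let $p\ge 3$ be odd, let $0\le L<p$ be even, and let $t_0>0$. **Equation.** For some $\eta_0>0$ let $S$ be $C^\infty$ on $[-t_0,t_0]\times\mathbb R$ and $P$ be $C^\infty$ on $[-t_0,t_0]\times\mathbb R\times\mathbb R\times[0,\eta_0)$. Suppose that $S(t,0)=0$, that $\partial_t^i\partial_\alpha^jS(0,0)=0$ whenever $i+(p-L+1)j\le p+1$, and that $P(t,u,\alpha,\eta)$ is affine in $u$ (the linear case). Consider, on $[-t_0,t_0]$ and for small $\eta>0$, the equation $$\eta^{p+2}\dot u=(p+1)\eta t^pu+\eta^{p-L+1}\alpha t^L+S(t,\eta^{p-L+1}\alpha)+\eta^{p+1}P(t,\eta u,\eta^{p-L+1}\alpha,\eta).\tag{2}$$ For a family $(\beta_\eta,v_\eta)_\eta$ let $\Xi_\eta(\beta_\eta,v_\eta)=(\alpha_\eta,u_\eta)$ be the solution, bounded uniformly in small $\eta$, of the boundary value problem $$\eta^{p+2}\dot u=(p+1)\eta t^pu+\eta^{p-L+1}\alpha t^L+S(t,\eta^{p-L+1}\alpha)+\eta^{p+1}P(t,\eta v_\eta,\eta^{p-L+1}\beta_\eta,\eta),\qquad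 u(\pm t_0)=0.$$ A canard solution $(\alpha^*_\eta,u^*_\eta)$ is a fixed point of $\Xi_\eta$: a uniformly bounded family of solutions of (2) with $u^*_\eta(\pm t_0)=0$. **Intermediary functions.** For $k\in\{0,\dots,p-1\}\setminus\{L\}$ put $$\psi_k(T)=e^{T^{p+1}}\int_{+\infty}^T\bigl(y^k-m_ky^L\bigr)e^{-y^{p+1}}\,dy,\qquad m_k=\frac{\int_{\mathbb R}y^ke^{-y^{p+1}}dy}{\int_{\mathbb R}y^Le^{-y^{p+1}}dy}.$$ If $\rho(T)\sim q(T)+\sum_{m\ge1}r_mT^{-m}$, with $q$ a polynomial and with the same $q$ and $r_m$ at $+\infty$ and at $-\infty$, write $[\rho]=\rho-q$. Put $\bar\psi_{i,k}(T)=[T^i\psi_k(T)]$ for $i\ge0$. **Formal spaces.** For $r>0$ let $\mathcal A_K(r)$ be the space of formal sums $$\Bigl(\sum_{n=0}^Ka_n\eta^n,\ \sum_{n=0}^K\Bigl(u_n(t)+\sum_{i=0}^n\ \sum_{0\le k<p,\ k\ne L}u_{n,i,k}\,\bar\psi_{i,k}(t/\eta)\Bigr)\eta^n\Bigr),\qquad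 a_n,u_{n,i,k}\in\mathbb R,\ u_n\in C^\infty([-r,r]),$$ identified with their coefficients. Let $\pi_K:\mathcal A_{K+1}(r)\to\mathcal A_K(r)$ be truncation and $\hat{\mathcal A}(r)$ the projective limit. Write $\tilde c$ for the couple of functions of $\eta$ and $(t,\eta)$ represented by a formal sum $c$. **Theorem.** The functions $T^i\psi_k(T)$ have such expansions at $\pm\infty$, so that the $\bar\psi_{i,k}$ are well defined. There is a formal process, which assigns to each linear equation (2) maps $\Xi_K:\mathcal A_K(t_0)\to\mathcal A_K(t_0)$, $K\ge 0$, such that $\Xi_K$ depends on $S$ and $P$ only through finitely many of the Taylor coefficients, taken for each $t\in[-t_0,t_0]$, of $S$ in $\alpha$ at $0$ and of $P$ in $(\alpha,\eta)$ at $(0,0)$ (for each $K$, their orders are bounded by a number that does not depend on the equation). For each linear equation (2) the following holds. 1. The sequence is compatible: $\pi_K\circ\Xi_{K+1}=\Xi_K\circ\pi_K$. 2. There is a canard solution $(\alpha^*,u^*)$, and any two canard solutions coincide for all small $\eta>0$. 3. For every $t_1\in(0,t_0)$ the sequence is formally equivalent to $\Xi_\eta$: for all $K$ and all $c\in\mathcal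 A_K(t_0)$, $\Xi_\eta(\tilde c)$ is well defined for small $\eta$ (it exists, and any two bounded families of solutions coincide for small $\eta$) and $\Xi_\eta(\tilde c)-\widetilde{\Xi_K(c)}=o(\eta^K)$ as $\eta\to0^+$, uniformly for $t\in[-t_1,t_1]$. 4. For every $t_1\in(0,t_0)$ the canard solution has an asymptotic expansion in powers of $\eta$, uniformly valid on $[-t_1,t_1]$: there is exactly one $$\Bigl(\sum_na_n\eta^n,\ \sum_n\Bigl(u_n(t)+\sum_{i=0}^n\ \sum_{0\le k<p,\ k\neq L}u_{n,i,k}\,\bar\psi_{i,k}(t/\eta)\Bigr)\eta^n\Bigr)\in\hat{\mathcal A}(t_1)$$ such that, for every $K\ge 0$, as $\eta\to0^+$, $$\Bigl|\alpha^*_\eta-\sum_{n\le K}a_n\eta^n\Bigr|=O(\eta^{K+1}),\qquad \sup_{|t|\le t_1}\Bigl|u^*_\eta(t)-\sum_{n\le K}\Bigl(u_n(t)+\sum_{i\le n}\sum_{k<p,\ k\ne L}u_{n,i,k}\bar\psi_{i,k}(t/\eta)\Bigr)\eta^n\Bigr|=O(\eta^{K+1}).$$ 5. This expansion is computed by the formal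 process: its truncation at order $K$ is the restriction to $[-t_1,t_1]$ of the $(K+1)$-st iterate $\Xi_K^{K+1}(x)$, for an arbitrary starting point $x\in\mathcal A_K(t_0)$. -/

import Mathlib

open Set Filter Topology Asymptotics MeasureTheory
open scoped ContDiff

noncomputable section

namespace Canard

/-! ### The intermediary functions -/

/-- The quotient of the moments `∫ y^k e^{-y^{p+1}} dy` and `∫ y^L e^{-y^{p+1}} dy` over `ℝ`. -/
def momentRatio (p L k : ℕ) : ℝ :=
  (∫ y : ℝ, y ^ k * Real.exp (-y ^ (p + 1))) / (∫ y : ℝ, y ^ L * Real.exp (-y ^ (p + 1)))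

/-- The function `ψ_k(T) = e^{T^{p+1}} ∫_{+∞}^T (y^k - m_k y^L) e^{-y^{p+1}} dy`, where `m_k` is the
moment ratio: the solution, bounded at both ends, of `ψ' = (p+1) T^p ψ + T^k - m_k T^L`. -/
def psi (p L k : ℕ) (T : ℝ) : ℝ :=
  Real.exp (T ^ (p + 1)) *
    (-∫ y in Ioi T, (y ^ k - momentRatio p L k * y ^ L) * Real.exp (-y ^ (p + 1)))

/-- `ρ(T) ∼ q(T) + ∑_{m ≥ 1} r_m T^{-m}`, with the same polynomial `q` and the same coefficients `r`
at `+∞` and at `-∞`. The coefficient of `T^{-(m+1)}` is `r m`. -/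
def HasExpansionAtInfinity (ρ : ℝ → ℝ) (q : Polynomial ℝ) (r : ℕ → ℝ) : Prop :=
  ∀ M : ℕ,
    (fun T : ℝ => ρ T - q.eval T - ∑ m ∈ Finset.range M, r m * (T ^ (m + 1))⁻¹)
      =O[atBot ⊔ atTop] fun T : ℝ => (T ^ (M + 1))⁻¹

open Classical in
/-- The polynomial part of the expansion of `ρ` at `±∞` (zero if there is no expansion). -/
def polynomialPart (ρ : ℝ → ℝ) : Polynomial ℝ :=
  if h : ∃ q : Polynomial ℝ, ∃ r : ℕ → ℝ, HasExpansionAtInfinity ρ q r then h.choose else 0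

/-- The bracket `[ρ]`: the function `ρ` minus the polynomial part of its expansion at `±∞`. -/
def bracket (ρ : ℝ → ℝ) (T : ℝ) : ℝ := ρ T - (polynomialPart ρ).eval T

/-- `ψ̄_{i,k} = [T^i ψ_k(T)]`. -/
def psiBar (p L i k : ℕ) : ℝ → ℝ := bracket fun T => T ^ i * psi p L k T

theorem HasExpansionAtInfinity.tendsto {ρ : ℝ → ℝ} {q : Polynomial ℝ} {r : ℕ → ℝ}
    (h : HasExpansionAtInfinity ρ q r) :
    Tendsto (fun T => ρ T - q.eval T) atTop (𝓝 0) := by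
  have h0 := (h 0).mono (le_sup_right : (atTop : Filter ℝ) ≤ atBot ⊔ atTop)
  simp only [Finset.range_zero, Finset.sum_empty, sub_zero, zero_add, pow_one] at h0
  exact h0.trans_tendsto tendsto_inv_atTop_zero

/-- The polynomial part is well defined. -/
theorem HasExpansionAtInfinity.polynomialPart_eq {ρ : ℝ → ℝ} {q : Polynomial ℝ} {r : ℕ → ℝ}
    (h : HasExpansionAtInfinity ρ q r) : polynomialPart ρ = q := by
  have hex : ∃ q : Polynomial ℝ, ∃ r : ℕ → ℝ, HasExpansionAtInfinity ρ q r := ⟨q, r, h⟩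
  have hdef : polynomialPart ρ = hex.choose := by
    unfold polynomialPart
    exact dif_pos hex
  obtain ⟨r', h'⟩ := hex.choose_spec
  rw [← hdef] at h'
  have ht : Tendsto (fun T => (polynomialPart ρ - q).eval T) atTop (𝓝 0) := by
    have := h.tendsto.sub h'.tendsto
    simp only [sub_zero] at this
    refine this.congr fun T => ?_
    rw [Polynomial.eval_sub]
    ring
  have := (Polynomial.tendsto_nhds_iff _).1 ht
  exact sub_eq_zero.1 (Polynomial.leadingCoeff_eq_zero.1 this.1)

/-! ### The formal spaces -/

/-- `C^∞([-r, r])`; each function is represented by its extension by zero to `ℝ`. -/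
@[ext]
structure SmoothFun (r : ℝ) where
  toFun : ℝ → ℝ
  smooth : ContDiffOn ℝ ∞ toFun (Icc (-r) r)
  zero_outside : ∀ t, t ∉ Icc (-r) r → toFun t = 0

/-- Restriction from `[-r, r]` to `[-r', r']`. -/
def SmoothFun.restrict {r r' : ℝ} (h : r' ≤ r) (f : SmoothFun r) : SmoothFun r' where
  toFun := (Icc (-r') r').indicator f.toFun
  smooth := (f.smooth.mono (Icc_subset_Icc (neg_le_neg h) h)).congr
    fun _ ht => indicator_of_mem ht _
  zero_outside := fun _ ht => indicator_of_notMem ht _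

/-- The coefficients of a formal term of order `n`, that is, of the couple
`(a η^n, (u(t) + ∑_{i ≤ n} ∑_{k < p, k ≠ L} b_{i,k} ψ̄_{i,k}) η^n)` with `u ∈ C^∞([-r, r])`. -/
@[ext]
structure FormalTerm (p L : ℕ) (r : ℝ) (n : ℕ) where
  a : ℝ
  u : SmoothFun r
  b : Fin (n + 1) → {k : Fin p // (k : ℕ) ≠ L} → ℝ

/-- The function `u(t) + ∑_{i ≤ n} ∑_{k < p, k ≠ L} b_{i,k} ψ̄_{i,k}(t/η)`. -/
def FormalTerm.fn {p L : ℕ} {r : ℝ} {n : ℕ} (c : FormalTerm p L r n) (η t : ℝ) : ℝ :=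
  c.u.toFun t + ∑ i, ∑ k, c.b i k * psiBar p L (i : ℕ) (k.1 : ℕ) (t / η)

def FormalTerm.restrict {p L : ℕ} {r r' : ℝ} {n : ℕ} (h : r' ≤ r) (c : FormalTerm p L r n) :
    FormalTerm p L r' n :=
  ⟨c.a, c.u.restrict h, c.b⟩

/-- The formal space of the sums of terms of the orders `0, …, K`. -/
def FormalSum (p L : ℕ) (r : ℝ) (K : ℕ) : Type := (n : Fin (K + 1)) → FormalTerm p L r (n : ℕ)

/-- The projective limit of the formal spaces. -/
def FormalSeries (p L : ℕ) (r : ℝ) : Type := (n : ℕ) → FormalTerm p L r n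

/-- The natural projection, which forgets the term of order `K + 1`. -/
def FormalSum.proj {p L : ℕ} {r : ℝ} {K : ℕ} (c : FormalSum p L r (K + 1)) : FormalSum p L r K :=
  fun n => c n.castSucc

def FormalSum.restrict {p L : ℕ} {r r' : ℝ} {K : ℕ} (h : r' ≤ r) (c : FormalSum p L r K) :
    FormalSum p L r' K :=
  fun n => (c n).restrict h

def FormalSeries.trunc {p L : ℕ} {r : ℝ} (c : FormalSeries p L r) (K : ℕ) : FormalSum p L r K :=
  fun n => c n

/-- The number `∑_{n ≤ K} a_n η^n`. -/
def FormalSum.param {p L : ℕ} {r : ℝ} {K : ℕ} (c : FormalSum p L r K) (η : ℝ) : ℝ :=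
  ∑ n, (c n).a * η ^ (n : ℕ)

/-- The function `∑_{n ≤ K} (u_n(t) + ∑_{i ≤ n} ∑_{k < p, k ≠ L} b_{n,i,k} ψ̄_{i,k}(t/η)) η^n`. -/
def FormalSum.fn {p L : ℕ} {r : ℝ} {K : ℕ} (c : FormalSum p L r K) (η t : ℝ) : ℝ :=
  ∑ n, (c n).fn η t * η ^ (n : ℕ)

/-- A formal series is a semi-asymptotic expansion, uniformly on `[-r, r]`, of a family
`(α_η, u_η)` as `η → 0⁺`. -/
def IsSemiAsymptoticExpansion {p L : ℕ} {r : ℝ} (α : ℝ → ℝ) (u : ℝ → ℝ → ℝ)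
    (c : FormalSeries p L r) : Prop :=
  ∀ K : ℕ,
    ((fun η => α η - (c.trunc K).param η) =O[𝓝[>] 0] fun η => η ^ (K + 1)) ∧
    ∃ C : ℝ, ∀ᶠ η in 𝓝[>] 0, ∀ t ∈ Icc (-r) r,
      |u η t - (c.trunc K).fn η t| ≤ C * η ^ (K + 1)

/-- An asymptotic expansion is a semi-asymptotic expansion that is the only one. -/
def IsAsymptoticExpansion {p L : ℕ} {r : ℝ} (α : ℝ → ℝ) (u : ℝ → ℝ → ℝ)
    (c : FormalSeries p L r) : Prop :=
  IsSemiAsymptoticExpansion α u c ∧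
    ∀ c' : FormalSeries p L r, IsSemiAsymptoticExpansion α u c' → c' = c

/-! ### The differential equation -/

/-- The data of the equation
`η^{p+2} u' = (p+1) η t^p u + η^{p-L+1} α t^L + S(t, η^{p-L+1} α)
  + η^{p+1} P(t, η u, η^{p-L+1} α, η)` on `[-t₀, t₀]`.
Only the values of `S` and `P` for `t ∈ [-t₀, t₀]` and `0 ≤ η < η₀` matter. -/
structure Equation (p L : ℕ) (t₀ : ℝ) where
  S : ℝ → ℝ → ℝ
  P : ℝ → ℝ → ℝ → ℝ → ℝ
  η₀ : ℝ
  η₀_pos : 0 < η₀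
  S_smooth : ContDiffOn ℝ ∞ (fun x : ℝ × ℝ => S x.1 x.2) (Icc (-t₀) t₀ ×ˢ univ)
  P_smooth : ContDiffOn ℝ ∞ (fun x : ℝ × ℝ × ℝ × ℝ => P x.1 x.2.1 x.2.2.1 x.2.2.2)
    (Icc (-t₀) t₀ ×ˢ univ ×ˢ univ ×ˢ Ico 0 η₀)
  S_zero : ∀ t ∈ Icc (-t₀) t₀, S t 0 = 0
  /-- Every monomial `t^i α^j` of weight `i + (p-L+1) j ≤ p + 1` is absent from `S`. -/
  S_valuation : ∀ i j : ℕ, i + (p - L + 1) * j ≤ p + 1 →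
    iteratedDeriv i (fun t => iteratedDeriv j (fun a => S t a) 0) 0 = 0

/-- The equation is linear: `P` is an affine function of `u`. -/
def Equation.IsLinear {p L : ℕ} {t₀ : ℝ} (E : Equation p L t₀) : Prop :=
  ∀ t ∈ Icc (-t₀) t₀, ∀ a : ℝ, ∀ η ∈ Ico 0 E.η₀, ∃ A B : ℝ, ∀ x : ℝ, E.P t x a η = A + B * x

/-- `(α, w)` solves, for one value of `η`, the boundary value problem
`η^{p+2} w' = (p+1) η t^p w + η^{p-L+1} α t^L + S(t, η^{p-L+1} α)
  + η^{p+1} P(t, η v, η^{p-L+1} β, η)`, `w(-t₀) = 0 = w(t₀)`. -/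
def Equation.SolvesAux {p L : ℕ} {t₀ : ℝ} (E : Equation p L t₀) (η β : ℝ) (v : ℝ → ℝ)
    (α : ℝ) (w : ℝ → ℝ) : Prop :=
  (∀ t ∈ Icc (-t₀) t₀,
    HasDerivWithinAt (fun s => η ^ (p + 2) * w s)
      ((p + 1) * η * t ^ p * w t + η ^ (p - L + 1) * α * t ^ L + E.S t (η ^ (p - L + 1) * α)
        + η ^ (p + 1) * E.P t (η * v t) (η ^ (p - L + 1) * β) η)
      (Icc (-t₀) t₀) t) ∧
  w (-t₀) = 0 ∧ w t₀ = 0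

/-- The graph of the operator `Ξ_η : (β_η, v_η) ↦ (α_η, w_η)`, on families indexed by small `η > 0`:
`(α_η, w_η)` is bounded, and it solves the boundary value problem of `(β_η, v_η)`. -/
def Equation.IsXiImage {p L : ℕ} {t₀ : ℝ} (E : Equation p L t₀) (β : ℝ → ℝ) (v : ℝ → ℝ → ℝ)
    (α : ℝ → ℝ) (w : ℝ → ℝ → ℝ) : Prop :=
  (∃ M : ℝ, ∀ᶠ η in 𝓝[>] 0, |α η| ≤ M ∧ ∀ t ∈ Icc (-t₀) t₀, |w η t| ≤ M) ∧
  ∀ᶠ η in 𝓝[>] 0, E.SolvesAux η (β η) (v η) (α η) (w η)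

/-- A canard solution is a fixed point of the operator `Ξ_η`: a bounded family of solutions of the
equation that vanish at `-t₀` and at `t₀`. -/
def Equation.IsCanardSolution {p L : ℕ} {t₀ : ℝ} (E : Equation p L t₀) (α : ℝ → ℝ)
    (u : ℝ → ℝ → ℝ) : Prop :=
  E.IsXiImage α u α u

/-- Two families coincide for all small `η > 0`. -/
def SameFamily (t₀ : ℝ) (α : ℝ → ℝ) (u : ℝ → ℝ → ℝ) (α' : ℝ → ℝ) (u' : ℝ → ℝ → ℝ) : Prop :=
  ∀ᶠ η in 𝓝[>] 0, α η = α' η ∧ ∀ t ∈ Icc (-t₀) t₀, u η t = u' η t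

/-- The operator `Ξ_η` is well defined at the family `(β_η, v_η)`. -/
def Equation.XiDefinedAt {p L : ℕ} {t₀ : ℝ} (E : Equation p L t₀) (β : ℝ → ℝ)
    (v : ℝ → ℝ → ℝ) : Prop :=
  (∃ (α : ℝ → ℝ) (w : ℝ → ℝ → ℝ), E.IsXiImage β v α w) ∧
  ∀ (α : ℝ → ℝ) (w : ℝ → ℝ → ℝ) (α' : ℝ → ℝ) (w' : ℝ → ℝ → ℝ),
    E.IsXiImage β v α w → E.IsXiImage β v α' w' → SameFamily t₀ α w α' w'

/-! ### Formal operators -/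

/-- A sequence of maps of the formal spaces to themselves is compatible with the projections. -/
def Compatible {p L : ℕ} {r : ℝ} (Ξ : (K : ℕ) → FormalSum p L r K → FormalSum p L r K) : Prop :=
  ∀ (K : ℕ) (c : FormalSum p L r (K + 1)), (Ξ (K + 1) c).proj = Ξ K c.proj

/-- The sequence `(Ξ_K)` is formally equivalent to `Ξ_η`: for each formal sum `c` of order `K`, the
operator `Ξ_η` is well defined at the function represented by `c`, and its value there is the
function represented by `Ξ_K c`, up to `o(η^K)`, uniformly on `[-t₁, t₁]`. -/
def Equation.FormallyEquivalent {p L : ℕ} {t₀ : ℝ} (E : Equation p L t₀) (t₁ : ℝ)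
    (Ξ : (K : ℕ) → FormalSum p L t₀ K → FormalSum p L t₀ K) : Prop :=
  ∀ (K : ℕ) (c : FormalSum p L t₀ K),
    E.XiDefinedAt c.param c.fn ∧
    ∀ (α : ℝ → ℝ) (w : ℝ → ℝ → ℝ), E.IsXiImage c.param c.fn α w →
      ((fun η => α η - (Ξ K c).param η) =o[𝓝[>] 0] fun η => η ^ K) ∧
      ∀ ε > 0, ∀ᶠ η in 𝓝[>] 0, ∀ t ∈ Icc (-t₁) t₁, |w η t - (Ξ K c).fn η t| ≤ ε * η ^ K

/-- `S` and `P` have in both equations, for every `t ∈ [-t₀, t₀]`, the same Taylor coefficients at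
`α = 0` and at `(α, η) = (0, 0⁺)` respectively, up to the degree `N` in each variable. -/
def Equation.SameTaylor {p L : ℕ} {t₀ : ℝ} (N : ℕ) (E E' : Equation p L t₀) : Prop :=
  ∀ t ∈ Icc (-t₀) t₀,
    (∀ j ≤ N, iteratedDeriv j (fun a => E.S t a) 0 = iteratedDeriv j (fun a => E'.S t a) 0) ∧
    ∀ x : ℝ, ∀ i ≤ N, ∀ j ≤ N,
      iteratedDerivWithin j (fun η => iteratedDeriv i (fun a => E.P t x a η) 0) (Ici 0) 0 =
      iteratedDerivWithin j (fun η => iteratedDeriv i (fun a => E'.P t x a η) 0) (Ici 0) 0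

end Canard

end

noncomputable section

namespace Canard

/-! ### A comparison principle for `d' = (p+1) T^p d + g` -/

/-! Put `T = t/η` and divide (2) by `η^{p+1}`. The equation becomes `η w' = (p+1) T^p w + α T^L +
f`, where `f = η^{-(p+1)} S + P` is a perturbation. Multiplication by `e^{-T^{p+1}}` makes the
linear part exact. As `p+1` is even, the equation is repelling away from `T = 0` on both sides:
prescribing `w` at both ends overdetermines it, and the free parameter `α` restores solvability,
because `∫ T^L e^{-T^{p+1}} > 0` for even `L`. Hence the a priori bound `apriori_estimate`: a
residual of size `H (1 + |T|^p)` forces `α` and `w` to be `O(H)`, and the boundary values contribute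
only a factor `exp(T^{p+1} - (t₀/η)^{p+1})`, which is below every power of `η` on compact subsets of
`(-t₀, t₀)`.

The perturbation has Lipschitz constant `O(η)` in `α`, `β` and `v`, relative to the weight `1 +
|T|^p` (`Equation.rhs_bounds`). For `P` this is so because its arguments carry factors of `η`; for
`S` it is the valuation hypothesis, every surviving monomial having weight at least `p+2`. A
contraction argument gives existence and uniqueness, both for the images under `Ξ_η` and for the
canard solution. The same estimate shows that `Ξ_η` gains a power of `η`: data that agree to
`O(η^m)` have images that agree to `O(η^{m+1})` in the interior (`xiImage_close_succ`).

On the formal side one must solve `η w' = (p+1) T^p w + a T^L + f` up to `O(η^{K+1})` when `f` comes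
from a formal sum. Monomials `T^k` with `k < p` are handled by `ψ_k`, the monomial `T^L` by `a`, a
term `T^p g(t)` by the slow function `-g/(p+1)`, and a term `ψ̄_{i,k}` by `ψ̄_{i+1,k}`. Every other
product is reduced to these by `g(t) = g(0) + η T g₁(t)`, which gains a power of `η`. Linearity of
`P` in `u` is used so that no products of the `ψ̄` arise (`FormallySolvable.rhs`).

A formal sum is determined by the function that it represents up to `O(η^{K+1})`: at fixed `t ≠ 0`
the limit isolates `u_n`, at fixed `T` it isolates the combination of the `ψ̄_{i,k}`, and these are
linearly independent (`psiBar_linearIndependent`). So `Ξ_K` can be defined as the unique formal sum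
that approximates the image under `Ξ_η`. Compatibility, dependence on finitely many Taylor
coefficients, and the computation by iteration all follow from this uniqueness combined with the
gain of a power. -/

theorem le_of_lyapunov {p : ℕ} {A B : ℝ} (hAB : A ≤ B) {d g V V' : ℝ → ℝ}
    (hd : ∀ t ∈ Icc A B, HasDerivWithinAt d ((p + 1) * t ^ p * d t + g t) (Icc A B) t)
    (hV : ∀ t ∈ Icc A B, HasDerivWithinAt V (V' t) (Icc A B) t)
    (hg : ∀ t ∈ Icc A B, -g t ≤ (p + 1) * t ^ p * V t - V' t) (hVB : 0 ≤ V B) :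
    d A ≤ V A + Real.exp (A ^ (p + 1) - B ^ (p + 1)) * |d B| := by
  -- The integrating factor turns the inequality on `V` into monotonicity of `e^{-t^{p+1}} (d - V)`.
  -- The value at the right end therefore controls the value at the left end.
  have hF : ∀ t ∈ Icc A B, HasDerivWithinAt (fun t => Real.exp (-t ^ (p + 1)) * (d t - V t))
      (Real.exp (-t ^ (p + 1)) * (g t + (p + 1) * t ^ p * V t - V' t)) (Icc A B) t := by
    intro t ht
    have h1 : HasDerivWithinAt (fun t : ℝ => Real.exp (-t ^ (p + 1)))
        (Real.exp (-t ^ (p + 1)) * (-((p + 1 : ℕ) * t ^ p))) (Icc A B) t :=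
      ((hasDerivAt_pow (p + 1) t).neg.exp).hasDerivWithinAt
    refine (h1.mul ((hd t ht).sub (hV t ht))).congr_deriv ?_
    simp only [Pi.sub_apply]
    push_cast
    ring
  have hm : MonotoneOn (fun t => Real.exp (-t ^ (p + 1)) * (d t - V t)) (Icc A B) := by
    refine monotoneOn_of_hasDerivWithinAt_nonneg (convex_Icc A B)
      (fun t ht => (hF t ht).continuousWithinAt)
      (fun t ht => (hF t (interior_subset ht)).mono interior_subset) fun t ht => ?_
    have := hg t (interior_subset ht)
    exact mul_nonneg (Real.exp_pos _).le (by linarith)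
  have h := hm (left_mem_Icc.2 hAB) (right_mem_Icc.2 hAB) hAB
  simp only at h
  have h2 : d A - V A ≤ Real.exp (A ^ (p + 1) - B ^ (p + 1)) * (d B - V B) := by
    have := mul_le_mul_of_nonneg_left h (Real.exp_pos (A ^ (p + 1))).le
    rw [← mul_assoc, ← mul_assoc, ← Real.exp_add, ← Real.exp_add] at this
    simpa [sub_eq_add_neg] using this
  have h3 : Real.exp (A ^ (p + 1) - B ^ (p + 1)) * (d B - V B)
      ≤ Real.exp (A ^ (p + 1) - B ^ (p + 1)) * |d B| :=
    mul_le_mul_of_nonneg_left (by linarith [le_abs_self (d B)]) (Real.exp_pos _).le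
  linarith

theorem abs_le_of_lyapunov {p : ℕ} {A B : ℝ} (hAB : A ≤ B) {d g V V' : ℝ → ℝ}
    (hd : ∀ t ∈ Icc A B, HasDerivWithinAt d ((p + 1) * t ^ p * d t + g t) (Icc A B) t)
    (hV : ∀ t ∈ Icc A B, HasDerivWithinAt V (V' t) (Icc A B) t)
    (hg : ∀ t ∈ Icc A B, |g t| ≤ (p + 1) * t ^ p * V t - V' t) (hVB : 0 ≤ V B) :
    |d A| ≤ V A + Real.exp (A ^ (p + 1) - B ^ (p + 1)) * |d B| := by
  refine abs_le'.2 ⟨le_of_lyapunov hAB hd hV (fun t ht => (neg_le_abs _).trans (hg t ht)) hVB, ?_⟩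
  rw [← abs_neg (d B)]
  refine le_of_lyapunov (d := fun t => -d t) (g := fun t => -g t) hAB (fun t ht => ?_) hV
    (fun t ht => ?_) hVB
  · refine (hd t ht).fun_neg.congr_deriv ?_
    ring
  · rw [neg_neg]
    exact (le_abs_self _).trans (hg t ht)

/-- Let the right end tend to `+∞`: the growth condition `hlim` kills the boundary term. Among the
solutions only the one without exponential growth is selected, so no value at a finite point is
needed. -/
theorem abs_le_of_lyapunov_atTop {p : ℕ} {A : ℝ} {d g V V' : ℝ → ℝ}
    (hd : ∀ t ∈ Ici A, HasDerivAt d ((p + 1) * t ^ p * d t + g t) t)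
    (hV : ∀ t ∈ Ici A, HasDerivAt V (V' t) t)
    (hg : ∀ t ∈ Ici A, |g t| ≤ (p + 1) * t ^ p * V t - V' t) (hV0 : ∀ t ∈ Ici A, 0 ≤ V t)
    (hlim : Tendsto (fun t => Real.exp (-t ^ (p + 1)) * d t) atTop (𝓝 0)) :
    ∀ t ∈ Ici A, |d t| ≤ V t := by
  intro t ht
  have h1 : Tendsto (fun B => V t + Real.exp (t ^ (p + 1)) * |Real.exp (-B ^ (p + 1)) * d B|)
      atTop (𝓝 (V t + Real.exp (t ^ (p + 1)) * |0|)) :=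
    (hlim.abs.const_mul _).const_add _
  rw [abs_zero, mul_zero, add_zero] at h1
  refine ge_of_tendsto h1 ?_
  filter_upwards [eventually_ge_atTop t] with B hB
  have hsub : ∀ s ∈ Icc t B, s ∈ Ici A := fun s hs => le_trans ht hs.1
  have := abs_le_of_lyapunov hB (fun s hs => (hd s (hsub s hs)).hasDerivWithinAt)
    (fun s hs => (hV s (hsub s hs)).hasDerivWithinAt) (fun s hs => hg s (hsub s hs))
    (hV0 B (hsub B ⟨hB, le_rfl⟩))
  rwa [sub_eq_add_neg, Real.exp_add, mul_assoc, ← abs_of_pos (Real.exp_pos (-B ^ (p + 1))),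
    ← abs_mul] at this

/-! ### The weight `exp (-y^(p+1))` -/

theorem integrable_pow_mul_exp {p : ℕ} (hp : Odd p) (k : ℕ) :
    Integrable fun y : ℝ => y ^ k * Real.exp (-y ^ (p + 1)) := by
  have hcont : Continuous fun y : ℝ => y ^ k * Real.exp (-y ^ (p + 1)) := by fun_prop
  have hIoi : IntegrableOn (fun y : ℝ => y ^ k * Real.exp (-y ^ (p + 1))) (Ioi 0) := by
    have := integrableOn_rpow_mul_exp_neg_rpow (p := (p + 1 : ℕ)) (s := k)
      (by have : (0 : ℝ) ≤ k := k.cast_nonneg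
          linarith) (by positivity)
    simpa only [Real.rpow_natCast] using this
  have hev : Even (p + 1) := hp.add_one
  rw [← integrableOn_univ, ← Iic_union_Ioi (a := (0 : ℝ)), integrableOn_union]
  refine ⟨?_, hIoi⟩
  rw [integrableOn_Iic_iff_integrableOn_Iio]
  have h3 : IntegrableOn (fun y : ℝ => (-1) ^ k * ((-y) ^ k * Real.exp (-(-y) ^ (p + 1)))) (Iio 0) := by
    have h2 := IntegrableOn.comp_neg_Iio (c := 0) (f := fun y : ℝ => y ^ k * Real.exp (-y ^ (p + 1)))
      (by simpa using hIoi)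
    exact h2.const_mul _
  refine h3.congr_fun (fun y _ => ?_) measurableSet_Iio
  simp only
  rw [hev.neg_pow, ← mul_assoc, ← mul_pow]
  simp

theorem integral_pow_mul_exp_pos {p L : ℕ} (hp : Odd p) (hL : Even L) :
    0 < ∫ y : ℝ, y ^ L * Real.exp (-y ^ (p + 1)) := by
  refine integral_pos_of_integrable_nonneg_nonzero (x := 1) (by fun_prop)
    (integrable_pow_mul_exp hp L) (fun y => mul_nonneg (hL.pow_nonneg y) (Real.exp_pos _).le) ?_
  simp [Real.exp_ne_zero]

/-! ### The functions `ψ_k` and their expansions -/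

/-- The integrand of `ψ_k`. -/
def psiIntegrand (p L k : ℕ) (y : ℝ) : ℝ :=
  (y ^ k - momentRatio p L k * y ^ L) * Real.exp (-y ^ (p + 1))

theorem continuous_psiIntegrand (p L k : ℕ) : Continuous (psiIntegrand p L k) := by
  unfold psiIntegrand
  fun_prop

theorem integrable_psiIntegrand {p : ℕ} (hp : Odd p) (L k : ℕ) :
    Integrable (psiIntegrand p L k) := by
  have := (integrable_pow_mul_exp hp k).sub
    ((integrable_pow_mul_exp hp L).const_mul (momentRatio p L k))
  refine this.congr (Eventually.of_forall fun y => ?_)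
  simp only [psiIntegrand, Pi.sub_apply]
  ring

theorem integral_psiIntegrand {p L : ℕ} (hp : Odd p) (hL : Even L) (k : ℕ) :
    ∫ y, psiIntegrand p L k y = 0 := by
  have h := integral_sub (integrable_pow_mul_exp hp k)
    ((integrable_pow_mul_exp hp L).const_mul (momentRatio p L k))
  rw [integral_const_mul, momentRatio,
    div_mul_cancel₀ _ (integral_pow_mul_exp_pos hp hL).ne', sub_self] at h
  rw [← h]
  refine integral_congr_ae (Eventually.of_forall fun y => ?_)
  simp only [psiIntegrand, momentRatio]
  ring

theorem integral_Ioi_psiIntegrand {p : ℕ} (hp : Odd p) (L k : ℕ) (T : ℝ) :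
    ∫ y in Ioi T, psiIntegrand p L k y
      = (∫ y in Ioi 0, psiIntegrand p L k y) - ∫ y in (0 : ℝ)..T, psiIntegrand p L k y := by
  have hi := integrable_psiIntegrand hp L k
  have := intervalIntegral.integral_interval_add_Ioi (hi.integrableOn (s := Ioi 0))
    (hi.integrableOn (s := Ioi T))
  linarith

theorem psi_eq {p : ℕ} (hp : Odd p) (L k : ℕ) (T : ℝ) :
    psi p L k T = Real.exp (T ^ (p + 1)) *
      ((∫ y in (0 : ℝ)..T, psiIntegrand p L k y) - ∫ y in Ioi 0, psiIntegrand p L k y) := by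
  have := integral_Ioi_psiIntegrand hp L k T
  simp only [psiIntegrand] at this ⊢
  rw [psi, this]
  ring

theorem hasDerivAt_psi {p : ℕ} (hp : Odd p) (L k : ℕ) (T : ℝ) :
    HasDerivAt (psi p L k)
      ((p + 1) * T ^ p * psi p L k T + (T ^ k - momentRatio p L k * T ^ L)) T := by
  have hc := continuous_psiIntegrand p L k
  have h1 : HasDerivAt (fun T => (∫ y in (0 : ℝ)..T, psiIntegrand p L k y)
      - ∫ y in Ioi 0, psiIntegrand p L k y) (psiIntegrand p L k T) T :=
    (intervalIntegral.integral_hasDerivAt_right (hc.intervalIntegrable _ _)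
      hc.aestronglyMeasurable.stronglyMeasurableAtFilter hc.continuousAt).sub_const _
  have h2 := ((hasDerivAt_pow (p + 1) T).exp).mul h1
  rw [show psi p L k = _ from funext (psi_eq hp L k)]
  refine h2.congr_deriv ?_
  have : Real.exp (T ^ (p + 1)) * psiIntegrand p L k T = T ^ k - momentRatio p L k * T ^ L := by
    rw [psiIntegrand, mul_left_comm, ← Real.exp_add, add_neg_cancel, Real.exp_zero, mul_one]
  simp only [Nat.add_sub_cancel, this]
  push_cast
  ring

theorem continuous_psi {p : ℕ} (hp : Odd p) (L k : ℕ) : Continuous (psi p L k) :=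
  continuous_iff_continuousAt.2 fun T => (hasDerivAt_psi hp L k T).continuousAt

/-- The sign `σ` treats both ends at once. At `+∞` the tail of a convergent integral tends to zero.
At `-∞` the limit is minus the integral over `ℝ`, which vanishes by the choice of the moment ratio;
this is the role of `m_k`. -/
theorem tendsto_exp_mul_psi {p L : ℕ} (hp : Odd p) (hL : Even L) (k : ℕ) {σ : ℝ}
    (hσ : σ = 1 ∨ σ = -1) :
    Tendsto (fun T => Real.exp (-T ^ (p + 1)) * psi p L k (σ * T)) atTop (𝓝 0) := by
  have hi := integrable_psiIntegrand hp L k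
  have hev : Even (p + 1) := hp.add_one
  have key : ∀ T, Real.exp (-T ^ (p + 1)) * psi p L k (σ * T)
      = (∫ y in (0 : ℝ)..(σ * T), psiIntegrand p L k y) - ∫ y in Ioi 0, psiIntegrand p L k y := by
    intro T
    have : (σ * T) ^ (p + 1) = T ^ (p + 1) := by
      rcases hσ with rfl | rfl
      · simp
      · rw [neg_one_mul, hev.neg_pow]
    rw [psi_eq hp, this, ← mul_assoc, ← Real.exp_add, neg_add_cancel, Real.exp_zero, one_mul]
  simp only [key]
  rcases hσ with rfl | rfl
  · simp only [one_mul]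
    have := (intervalIntegral_tendsto_integral_Ioi 0 (hi.integrableOn (s := Ioi 0))
      tendsto_id).sub_const (∫ y in Ioi 0, psiIntegrand p L k y)
    simpa using this
  · have h0 : (∫ y in Iic 0, psiIntegrand p L k y) + ∫ y in Ioi 0, psiIntegrand p L k y = 0 := by
      rw [intervalIntegral.integral_Iic_add_Ioi hi.integrableOn hi.integrableOn,
        integral_psiIntegrand hp hL]
    have := ((intervalIntegral_tendsto_integral_Iic 0 (hi.integrableOn (s := Iic 0))
      tendsto_neg_atTop_atBot).neg).sub_const (∫ y in Ioi 0, psiIntegrand p L k y)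
    rw [show -(∫ y in Iic 0, psiIntegrand p L k y) - ∫ y in Ioi 0, psiIntegrand p L k y = 0 by
      linarith] at this
    refine this.congr fun T => ?_
    rw [neg_one_mul, intervalIntegral.integral_symm]
    simp

/-- The coefficients of the expansion `ψ_k(T) ∼ ∑ r_m T^{-m}`. -/
def psiCoeff (p L k m : ℕ) : ℝ :=
  ((if m + L = p then momentRatio p L k else 0) - (if m + k = p then 1 else 0)
    - (if _h : p + 1 ≤ m then ((m - (p + 1) : ℕ) : ℝ) * psiCoeff p L k (m - (p + 1)) else 0))
    / (p + 1)
termination_by m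
decreasing_by omega

/-- The recursion is the comparison of the coefficients of `T^{p-m}` when `∑ r_m T^{-m}` is inserted
into `ψ' = (p+1) T^p ψ + T^k - m_k T^L`. Differentiation shifts the index by `p+1` relative to
multiplication by `T^p`. -/
theorem psiCoeff_spec (p L k m : ℕ) : (p + 1) * psiCoeff p L k m
    = (if m + L = p then momentRatio p L k else 0) - (if m + k = p then 1 else 0)
      - (if p + 1 ≤ m then ((m - (p + 1) : ℕ) : ℝ) * psiCoeff p L k (m - (p + 1)) else 0) := by
  have : (p + 1 : ℝ) ≠ 0 := by positivity
  rw [psiCoeff, mul_div_cancel₀ _ this]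
  simp only [dite_eq_ite]

theorem psiCoeff_add (p L k i : ℕ) :
    (p + 1) * psiCoeff p L k (i + (p + 1)) = -(i * psiCoeff p L k i) := by
  rw [psiCoeff_spec, if_neg (by omega), if_neg (by omega), if_pos (by omega)]
  simp

theorem psiCoeff_zero {p L k : ℕ} (hL : L < p) (hk : k < p) : psiCoeff p L k 0 = 0 := by
  have h := psiCoeff_spec p L k 0
  rw [if_neg (by omega), if_neg (by omega), if_neg (by omega)] at h
  have : (p + 1 : ℝ) ≠ 0 := by positivity
  simpa [this] using h

/-- The partial sums of the expansion, as polynomials in `X = T⁻¹`, solve the equation formally. -/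
theorem psiCoeff_sum {p L k : ℕ} (hL : L < p) (hk : k < p) (N : ℕ) (X : ℝ) :
    (p + 1) * ∑ m ∈ Finset.range (N + (p + 1)), psiCoeff p L k m * X ^ m
      + ∑ m ∈ Finset.range N, m * psiCoeff p L k m * X ^ (m + (p + 1))
      = momentRatio p L k * X ^ (p - L) - X ^ (p - k) := by
  rw [add_comm N, Finset.sum_range_add, mul_add, add_assoc, Finset.mul_sum _ _ ((p : ℝ) + 1),
    Finset.mul_sum _ _ ((p : ℝ) + 1), ← Finset.sum_add_distrib, Finset.sum_eq_zero (s := Finset.range N), add_zero]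
  · have : ∀ m ∈ Finset.range (p + 1), (p + 1) * (psiCoeff p L k m * X ^ m)
        = (if m = p - L then momentRatio p L k * X ^ (p - L) else 0)
          - (if m = p - k then X ^ (p - k) else 0) := by
      intro m hm
      rw [Finset.mem_range] at hm
      rw [← mul_assoc, psiCoeff_spec, if_neg (by omega : ¬ p + 1 ≤ m), sub_zero, sub_mul]
      congr 1
      · by_cases h : m = p - L
        · rw [if_pos h, if_pos (by omega), h]
        · rw [if_neg h, if_neg (by omega), zero_mul]
      · by_cases h : m = p - k
        · rw [if_pos h, if_pos (by omega), h, one_mul]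
        · rw [if_neg h, if_neg (by omega), zero_mul]
    rw [Finset.sum_congr rfl this, Finset.sum_sub_distrib, Finset.sum_ite_eq', Finset.sum_ite_eq',
      if_pos (by simp), if_pos (by simp)]
  · intro m _
    rw [← mul_assoc, add_comm (p + 1), psiCoeff_add]
    ring

theorem hasDerivAt_inv_pow (m : ℕ) {T : ℝ} (hT : T ≠ 0) :
    HasDerivAt (fun T : ℝ => (T ^ m)⁻¹) (-(m * (T ^ (m + 1))⁻¹)) T := by
  refine ((hasDerivAt_pow m T).fun_inv (pow_ne_zero m hT)).congr_deriv ?_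
  rcases m with _ | m
  · simp
  · simp only [Nat.add_sub_cancel]
    field_simp
    ring

/-- A truncation of the formal solution satisfies the equation of `ψ_k` up to the derivatives of its
last `p+1` terms. The difference then solves `d' = (p+1) T^p d + h` with `h = O(T^{p-N'})`, and it
has no exponential growth, so the comparison principle at infinity gives `O(T^{-N'})`. -/
theorem psi_expansion_of_le {p L k : ℕ} (hp : Odd p) (hLe : Even L) (hL : L < p) (hk : k < p)
    (N : ℕ) : ∃ C : ℝ, ∀ T : ℝ, 1 ≤ |T| →
      |psi p L k T - ∑ m ∈ Finset.range (N + (p + 1)), psiCoeff p L k m * (T ^ m)⁻¹|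
        ≤ C * (|T| ^ (N + (p + 1)))⁻¹ := by
  set N' := N + (p + 1) with hN'
  set r := psiCoeff p L k
  set C := ∑ m ∈ Finset.Ico N N', (m : ℝ) * |r m| with hC
  have hC0 : 0 ≤ C := Finset.sum_nonneg fun m _ => by positivity
  refine ⟨C, fun T hT => ?_⟩
  -- The substitution `T = σ t` carries either end to `+∞`; the linear part of the equation is
  -- unchanged because `σ^{p+1} = 1`.
  obtain ⟨σ, hσ, hσT⟩ : ∃ σ : ℝ, (σ = 1 ∨ σ = -1) ∧ σ * |T| = T := by
    rcases abs_choice T with h | h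
    · exact ⟨1, .inl rfl, by rw [one_mul, h]⟩
    · exact ⟨-1, .inr rfl, by rw [neg_one_mul, h, neg_neg]⟩
  have hσ2 : σ ^ (p + 1) = 1 := by
    rcases hσ with rfl | rfl
    · simp
    · exact hp.add_one.neg_one_pow
  have hσabs : |σ| = 1 := by rcases hσ with rfl | rfl <;> simp
  have hσ0 : σ ≠ 0 := by rintro rfl; simp at hσabs
  set ρ : ℝ → ℝ := fun T => ∑ m ∈ Finset.range N', r m * (T ^ m)⁻¹ with hρ
  set h : ℝ → ℝ := fun T => T ^ p * ∑ m ∈ Finset.Ico N N', m * r m * (T⁻¹) ^ (m + (p + 1)) with hh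
  have hderiv : ∀ T : ℝ, T ≠ 0 → HasDerivAt (fun T => psi p L k T - ρ T)
      ((p + 1) * T ^ p * (psi p L k T - ρ T) + h T) T := by
    intro T hT
    have h1 : HasDerivAt ρ (∑ m ∈ Finset.range N', r m * (-(m * (T ^ (m + 1))⁻¹))) T :=
      HasDerivAt.fun_sum fun m _ => (hasDerivAt_inv_pow m hT).const_mul _
    refine ((hasDerivAt_psi hp L k T).sub h1).congr_deriv ?_
    have h2 := psiCoeff_sum hL hk N T⁻¹
    have h3 : ∑ m ∈ Finset.range N', r m * (-(m * (T ^ (m + 1))⁻¹))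
        = -(T ^ p * ∑ m ∈ Finset.range N', m * r m * (T⁻¹) ^ (m + (p + 1))) := by
      rw [Finset.mul_sum, ← Finset.sum_neg_distrib]
      refine Finset.sum_congr rfl fun m _ => ?_
      rw [show m + (p + 1) = p + (m + 1) by ring, inv_pow, pow_add T p (m + 1)]
      field_simp
    have h4 : ρ T = ∑ m ∈ Finset.range N', r m * (T⁻¹) ^ m := by simp [hρ, inv_pow]
    have h5 : T ^ p * (T⁻¹) ^ (p - L) = T ^ L := by
      rw [inv_pow, show T ^ p = T ^ (p - L) * T ^ L by rw [← pow_add]; congr 1; omega]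
      field_simp
    have h6 : T ^ p * (T⁻¹) ^ (p - k) = T ^ k := by
      rw [inv_pow, show T ^ p = T ^ (p - k) * T ^ k by rw [← pow_add]; congr 1; omega]
      field_simp
    simp only [hh]
    rw [h3, h4, Finset.sum_Ico_eq_sub _ (by omega : N ≤ N')]
    rw [← h5, ← h6]
    linear_combination (T ^ p) * h2
  have hd : ∀ t ∈ Ici (1 : ℝ), HasDerivAt (fun t => psi p L k (σ * t) - ρ (σ * t))
      ((p + 1) * t ^ p * (psi p L k (σ * t) - ρ (σ * t)) + σ * h (σ * t)) t := by
    intro t ht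
    have ht0 : t ≠ 0 := (lt_of_lt_of_le one_pos ht).ne'
    have h1 : HasDerivAt (fun t => σ * t) σ t := by simpa using (hasDerivAt_id t).const_mul σ
    refine ((hderiv (σ * t) (mul_ne_zero hσ0 ht0)).comp t h1).congr_deriv ?_
    rw [mul_pow]
    linear_combination ((p + 1) * t ^ p * (psi p L k (σ * t) - ρ (σ * t))) * hσ2
  have hρlim : Tendsto (fun t => Real.exp (-t ^ (p + 1)) * ρ (σ * t)) atTop (𝓝 0) := by
    have hexp : Tendsto (fun t : ℝ => Real.exp (-t ^ (p + 1))) atTop (𝓝 0) :=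
      Real.tendsto_exp_neg_atTop_nhds_zero.comp (tendsto_pow_atTop (by omega))
    refine squeeze_zero_norm' (a := fun t => Real.exp (-t ^ (p + 1)) * ∑ m ∈ Finset.range N', |r m|)
      ?_ (by simpa using hexp.mul_const _)
    filter_upwards [eventually_ge_atTop 1] with t ht
    rw [norm_mul, Real.norm_of_nonneg (Real.exp_pos _).le]
    refine mul_le_mul_of_nonneg_left ?_ (Real.exp_pos _).le
    refine (norm_sum_le _ _).trans (Finset.sum_le_sum fun m _ => ?_)
    rw [norm_mul, Real.norm_eq_abs, norm_inv, norm_pow, norm_mul, Real.norm_eq_abs σ, hσabs,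
      one_mul, Real.norm_of_nonneg (by linarith : (0 : ℝ) ≤ t)]
    exact mul_le_of_le_one_right (abs_nonneg _) (inv_le_one_of_one_le₀ (one_le_pow₀ ht))
  -- The comparison function is `V = C t^{-N'}`. Since `V' ≤ 0`, already `t^p V`, a part of `(p+1)
  -- t^p V`, dominates the forcing.
  have hV : ∀ t ∈ Ici (1 : ℝ), HasDerivAt (fun t : ℝ => C * (t ^ N')⁻¹)
      (C * -(N' * (t ^ (N' + 1))⁻¹)) t := fun t ht =>
    (hasDerivAt_inv_pow N' (lt_of_lt_of_le one_pos ht).ne').const_mul C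
  have hfinal := abs_le_of_lyapunov_atTop (p := p) hd hV (fun t ht => ?_)
    (fun t ht => mul_nonneg hC0 (inv_nonneg.2 (pow_nonneg (zero_le_one.trans ht) _))) ?_ |T| hT
  · simpa only [hσT] using hfinal
  · have ht1 : (1 : ℝ) ≤ t := ht
    have ht0 : 0 < t := lt_of_lt_of_le one_pos ht1
    have h1 : |σ * h (σ * t)| ≤ t ^ p * (C * (t ^ N')⁻¹) := by
      rw [abs_mul, hσabs, one_mul, hh]
      simp only
      rw [abs_mul, abs_pow, abs_mul, hσabs, one_mul, abs_of_pos ht0]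
      refine mul_le_mul_of_nonneg_left ?_ (by positivity)
      rw [hC, Finset.sum_mul]
      refine (Finset.abs_sum_le_sum_abs _ _).trans (Finset.sum_le_sum fun m hm => ?_)
      rw [Finset.mem_Ico] at hm
      rw [abs_mul, abs_mul, Nat.abs_cast, abs_pow, abs_inv, abs_mul, hσabs, one_mul, abs_of_pos ht0,
        inv_pow]
      refine mul_le_mul_of_nonneg_left ?_ (by positivity)
      exact inv_anti₀ (by positivity) (pow_le_pow_right₀ ht1 (by omega))
    have h2 : 0 ≤ (p : ℝ) * (t ^ p * (C * (t ^ N')⁻¹)) := by positivity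
    have h3 : 0 ≤ C * (N' * (t ^ (N' + 1))⁻¹) := by positivity
    linarith
  · have := (tendsto_exp_mul_psi hp hLe k hσ).sub hρlim
    simpa [mul_sub] using this

/-- The `p+1` superfluous terms of the previous expansion are themselves `O(T^{-N})`. -/
theorem psi_expansion {p L k : ℕ} (hp : Odd p) (hLe : Even L) (hL : L < p) (hk : k < p)
    (N : ℕ) : ∃ C : ℝ, ∀ T : ℝ, 1 ≤ |T| →
      |psi p L k T - ∑ m ∈ Finset.range N, psiCoeff p L k m * (T ^ m)⁻¹| ≤ C * (|T| ^ N)⁻¹ := by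
  obtain ⟨C, hC⟩ := psi_expansion_of_le hp hLe hL hk N
  refine ⟨|C| + ∑ m ∈ Finset.range (p + 1), |psiCoeff p L k (N + m)|, fun T hT => ?_⟩
  have hT0 : 0 < |T| := lt_of_lt_of_le one_pos hT
  have h := hC T hT
  rw [Finset.sum_range_add, ← sub_sub] at h
  set s := ∑ m ∈ Finset.range (p + 1), psiCoeff p L k (N + m) * (T ^ (N + m))⁻¹ with hs
  have h1 : |s| ≤ (∑ m ∈ Finset.range (p + 1), |psiCoeff p L k (N + m)|) * (|T| ^ N)⁻¹ := by
    rw [hs, Finset.sum_mul]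
    refine (Finset.abs_sum_le_sum_abs _ _).trans (Finset.sum_le_sum fun m hm => ?_)
    rw [abs_mul, abs_inv, abs_pow]
    refine mul_le_mul_of_nonneg_left ?_ (abs_nonneg _)
    exact inv_anti₀ (by positivity) (pow_le_pow_right₀ hT (by omega))
  have h2 : C * (|T| ^ (N + (p + 1)))⁻¹ ≤ |C| * (|T| ^ N)⁻¹ :=
    mul_le_mul (le_abs_self C) (inv_anti₀ (by positivity) (pow_le_pow_right₀ hT (by omega)))
      (by positivity) (abs_nonneg C)
  rw [add_mul]
  have h3 := abs_add_le (psi p L k T - ∑ m ∈ Finset.range N, psiCoeff p L k m * (T ^ m)⁻¹ - s) s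
  rw [sub_add_cancel] at h3
  linarith

theorem hasExpansionAtInfinity_pow_mul_psi {p L k : ℕ} (hp : Odd p) (hLe : Even L) (hL : L < p)
    (hk : k < p) (i : ℕ) :
    HasExpansionAtInfinity (fun T => T ^ i * psi p L k T)
      (∑ m ∈ Finset.range (i + 1), Polynomial.C (psiCoeff p L k m) * Polynomial.X ^ (i - m))
      fun m => psiCoeff p L k (i + 1 + m) := by
  intro M
  obtain ⟨C, hC⟩ := psi_expansion hp hLe hL hk (i + 1 + M)
  refine IsBigO.of_bound C ?_
  have hev : ∀ᶠ T : ℝ in atBot ⊔ atTop, 1 ≤ |T| := by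
    refine eventually_sup.2 ⟨?_, ?_⟩
    · filter_upwards [eventually_le_atBot (-1)] with T hT
      rw [abs_of_neg (by linarith)]
      linarith
    · filter_upwards [eventually_ge_atTop 1] with T hT
      exact hT.trans (le_abs_self T)
  filter_upwards [hev] with T hT
  have hT0 : 0 < |T| := lt_of_lt_of_le one_pos hT
  have hT1 : T ≠ 0 := abs_pos.1 hT0
  have h := hC T hT
  rw [Finset.sum_range_add] at h
  have h1 : T ^ i * psi p L k T
      - (∑ m ∈ Finset.range (i + 1), Polynomial.C (psiCoeff p L k m) * Polynomial.X ^ (i - m)).eval T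
      - ∑ m ∈ Finset.range M, psiCoeff p L k (i + 1 + m) * (T ^ (m + 1))⁻¹
      = T ^ i * (psi p L k T - (∑ m ∈ Finset.range (i + 1), psiCoeff p L k m * (T ^ m)⁻¹
        + ∑ m ∈ Finset.range M, psiCoeff p L k (i + 1 + m) * (T ^ (i + 1 + m))⁻¹)) := by
    rw [← sub_sub, mul_sub, mul_sub, Polynomial.eval_finsetSum, Finset.mul_sum, Finset.mul_sum]
    congr 1
    · congr 1
      refine Finset.sum_congr rfl fun m hm => ?_
      rw [Finset.mem_range] at hm
      simp only [Polynomial.eval_mul, Polynomial.eval_C, Polynomial.eval_pow, Polynomial.eval_X]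
      rw [pow_sub₀ T hT1 (by omega)]
      ring
    · refine Finset.sum_congr rfl fun m _ => ?_
      rw [show i + 1 + m = i + (m + 1) by ring, pow_add T i]
      field_simp
  rw [h1, norm_mul, norm_pow, norm_inv, norm_pow, Real.norm_eq_abs, Real.norm_eq_abs]
  calc |T| ^ i * _ ≤ |T| ^ i * (C * (|T| ^ (i + 1 + M))⁻¹) :=
        mul_le_mul_of_nonneg_left h (by positivity)
    _ = C * (|T| ^ (M + 1))⁻¹ := by
        rw [show i + 1 + M = i + (M + 1) by ring, pow_add |T| i]
        field_simp

section PsiBar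

variable {p L k : ℕ} (hp : Odd p) (hLe : Even L) (hL : L < p) (hk : k < p)
include hp hLe hL hk

theorem psiBar_eq (i : ℕ) (T : ℝ) : psiBar p L i k T
    = T ^ i * psi p L k T - ∑ m ∈ Finset.range (i + 1), psiCoeff p L k m * T ^ (i - m) := by
  rw [psiBar, bracket, (hasExpansionAtInfinity_pow_mul_psi hp hLe hL hk i).polynomialPart_eq,
    Polynomial.eval_finsetSum]
  simp

theorem psiBar_zero (T : ℝ) : psiBar p L 0 k T = psi p L k T := by
  rw [psiBar_eq hp hLe hL hk]
  simp [psiCoeff_zero hL hk]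

/-- Multiplication by `T` shifts the expansion by one place; its leading term becomes the constant
`r_{i+1}` and joins the polynomial part. -/
theorem psiBar_succ (i : ℕ) (T : ℝ) :
    psiBar p L (i + 1) k T = T * psiBar p L i k T - psiCoeff p L k (i + 1) := by
  rw [psiBar_eq hp hLe hL hk, psiBar_eq hp hLe hL hk, Finset.sum_range_succ _ (i + 1), mul_sub,
    Finset.mul_sum, Nat.sub_self, pow_zero, mul_one, ← sub_sub, pow_succ']
  congr 2
  · ring
  · refine Finset.sum_congr rfl fun m hm => ?_
    rw [Finset.mem_range] at hm
    rw [show i + 1 - m = (i - m) + 1 by omega, pow_succ]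
    ring

theorem continuous_psiBar (i : ℕ) : Continuous (psiBar p L i k) := by
  rw [show psiBar p L i k = _ from funext (psiBar_eq hp hLe hL hk i)]
  have := continuous_psi hp L k
  fun_prop

theorem psiBar_bound (i : ℕ) : ∃ C : ℝ, ∀ T, |psiBar p L i k T| ≤ C ∧ |T| * |psiBar p L i k T| ≤ C := by
  obtain ⟨C, hC⟩ := psi_expansion hp hLe hL hk (i + 1)
  obtain ⟨D, hD⟩ := (isCompact_Icc (a := (-1 : ℝ)) (b := 1)).exists_bound_of_continuousOn
    (continuous_psiBar hp hLe hL hk i).continuousOn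
  refine ⟨max C D, fun T => ?_⟩
  rcases le_total 1 |T| with hT | hT
  · have hT0 : 0 < |T| := lt_of_lt_of_le one_pos hT
    have hT1 : T ≠ 0 := abs_pos.1 hT0
    have h1 : |T| * |psiBar p L i k T| ≤ C := by
      have h2 : psiBar p L i k T
          = T ^ i * (psi p L k T - ∑ m ∈ Finset.range (i + 1), psiCoeff p L k m * (T ^ m)⁻¹) := by
        rw [psiBar_eq hp hLe hL hk, mul_sub, Finset.mul_sum]
        congr 1
        refine Finset.sum_congr rfl fun m hm => ?_
        rw [Finset.mem_range] at hm
        rw [pow_sub₀ T hT1 (by omega)]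
        ring
      rw [h2, abs_mul, abs_pow, ← mul_assoc, ← pow_succ']
      refine (mul_le_mul_of_nonneg_left (hC T hT) (by positivity)).trans_eq ?_
      field_simp
    have h3 : |psiBar p L i k T| ≤ |T| * |psiBar p L i k T| :=
      le_mul_of_one_le_left (abs_nonneg _) hT
    exact ⟨(h3.trans h1).trans (le_max_left _ _), h1.trans (le_max_left _ _)⟩
  · have h1 : |psiBar p L i k T| ≤ D := hD T (abs_le.1 hT)
    exact ⟨h1.trans (le_max_right _ _),
      ((mul_le_of_le_one_left (abs_nonneg _) hT).trans h1).trans (le_max_right _ _)⟩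

theorem tendsto_psiBar (i : ℕ) {t : ℝ} (ht : t ≠ 0) :
    Tendsto (fun η => psiBar p L i k (t / η)) (𝓝[>] 0) (𝓝 0) := by
  obtain ⟨C, hC⟩ := psiBar_bound hp hLe hL hk i
  refine squeeze_zero_norm' (a := fun η => C / |t| * η) ?_ ?_
  · filter_upwards [self_mem_nhdsWithin] with η hη
    have hη0 : 0 < η := hη
    have ht0 : 0 < |t| := abs_pos.2 ht
    have := (hC (t / η)).2
    rw [abs_div, abs_of_pos hη0] at this
    rw [Real.norm_eq_abs, div_mul_eq_mul_div, le_div_iff₀ ht0]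
    rw [div_mul_eq_mul_div, div_le_iff₀ hη0] at this
    linarith
  · have : Tendsto (fun η : ℝ => C / |t| * η) (𝓝[>] 0) (𝓝 (C / |t| * 0)) :=
      (tendsto_id.const_mul _).mono_left nhdsWithin_le_nhds
    simpa using this

/-- The subtracted polynomial is the polynomial part of `(p+1) T^p ψ̄_{i,k}`, as it must be since
the other terms decay. Two features matter later: its degree is below `p`, and the only other
function that occurs is `ψ̄_{i-1,k}`, with the nonzero factor `i` when `i > 0`. For `i = 0` this
factor makes the truncated index harmless. -/
theorem hasDerivAt_psiBar (i : ℕ) (T : ℝ) :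
    HasDerivAt (psiBar p L i k) ((p + 1) * T ^ p * psiBar p L i k T + i * psiBar p L (i - 1) k T
      - (p + 1) * ∑ l ∈ Finset.range p, psiCoeff p L k (i + (p - l)) * T ^ l) T := by
  induction i with
  | zero =>
    rw [show psiBar p L 0 k = psi p L k from funext (psiBar_zero hp hLe hL hk)]
    refine (hasDerivAt_psi hp L k T).congr_deriv ?_
    rw [Nat.cast_zero, zero_mul, add_zero, sub_eq_add_neg _ ((p + 1 : ℝ) * _)]
    congr 1
    rw [Finset.mul_sum]
    have : ∀ l ∈ Finset.range p, (p + 1) * (psiCoeff p L k (0 + (p - l)) * T ^ l)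
        = (if l = L then momentRatio p L k * T ^ L else 0) - (if l = k then T ^ k else 0) := by
      intro l hl
      rw [Finset.mem_range] at hl
      rw [← mul_assoc, psiCoeff_spec, if_neg (by omega : ¬ p + 1 ≤ 0 + (p - l)), sub_zero, sub_mul]
      congr 1
      · by_cases h : l = L
        · rw [if_pos h, if_pos (by omega), h]
        · rw [if_neg h, if_neg (by omega), zero_mul]
      · by_cases h : l = k
        · rw [if_pos h, if_pos (by omega), h, one_mul]
        · rw [if_neg h, if_neg (by omega), zero_mul]
    rw [Finset.sum_congr rfl this, Finset.sum_sub_distrib, Finset.sum_ite_eq', Finset.sum_ite_eq',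
      if_pos (by simpa), if_pos (by simpa)]
    ring
  | succ i ih =>
    rw [show psiBar p L (i + 1) k = _ from funext (psiBar_succ hp hLe hL hk i)]
    refine (((hasDerivAt_id T).mul ih).sub_const _).congr_deriv ?_
    have h1 : (i : ℝ) * (T * psiBar p L (i - 1) k T - psiCoeff p L k i) = i * psiBar p L i k T := by
      rcases i with _ | i
      · simp
      · rw [psiBar_succ hp hLe hL hk]
        simp
    have h2 := psiCoeff_add p L k i
    have h3 : ∑ l ∈ Finset.range p, psiCoeff p L k (i + 1 + (p - l)) * T ^ l
        + psiCoeff p L k (i + 1) * T ^ p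
        = T * (∑ l ∈ Finset.range p, psiCoeff p L k (i + (p - l)) * T ^ l)
          + psiCoeff p L k (i + (p + 1)) := by
      have h4 := Finset.sum_range_succ (fun l => psiCoeff p L k (i + 1 + (p - l)) * T ^ l) p
      rw [Finset.sum_range_succ', Nat.sub_self, add_zero, Nat.sub_zero, pow_zero, mul_one,
        show i + 1 + p = i + (p + 1) by ring] at h4
      rw [← h4, Finset.mul_sum]
      congr 1
      refine Finset.sum_congr rfl fun l hl => ?_
      rw [Finset.mem_range] at hl
      rw [show i + 1 + (p - (l + 1)) = i + (p - l) by omega, pow_succ]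
      ring
    simp only [id, Nat.add_sub_cancel]
    push_cast
    linear_combination h1 + (p + 1) * h3 + h2

end PsiBar

/-! ### Linear independence of the functions `ψ̄_{i,k}` -/

open Polynomial in
-- On differentiation the terms `(p+1) T^p ψ_k` recombine, through the relation itself, into `(p+1)
-- T^p Q`. The derived relation is thus of the same kind, with the coefficients `B_k` replaced by
-- `B_k'`.
theorem psi_relation_deriv {p L : ℕ} (hp : Odd p) {κ : Type*} [Fintype κ] (f : κ → ℕ)
    {B : κ → ℝ[X]} {Q : ℝ[X]}
    (h : ∀ T : ℝ, ∑ k, (B k).eval T * psi p L (f k) T = Q.eval T) (T : ℝ) :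
    ∑ k, (derivative (B k)).eval T * psi p L (f k) T
      = (derivative Q - C (p + 1 : ℝ) * X ^ p * Q
        - ∑ k, B k * (X ^ f k - C (momentRatio p L (f k)) * X ^ L)).eval T := by
  have h1 : HasDerivAt (fun T => ∑ k, (B k).eval T * psi p L (f k) T)
      (∑ k, ((derivative (B k)).eval T * psi p L (f k) T + (B k).eval T *
        ((p + 1) * T ^ p * psi p L (f k) T + (T ^ f k - momentRatio p L (f k) * T ^ L)))) T :=
    HasDerivAt.fun_sum fun k _ => ((B k).hasDerivAt T).mul (hasDerivAt_psi hp L (f k) T)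
  rw [funext h] at h1
  have h2 := h1.unique (Q.hasDerivAt T)
  simp only [mul_add, Finset.sum_add_distrib] at h2
  have h3 : ∑ k, (B k).eval T * ((p + 1) * T ^ p * psi p L (f k) T)
      = (p + 1) * T ^ p * Q.eval T := by
    rw [← h T, Finset.mul_sum]
    exact Finset.sum_congr rfl fun k _ => by ring
  rw [h3] at h2
  simp only [eval_sub, eval_mul, eval_C, eval_pow, eval_X, eval_finsetSum]
  linarith

open Polynomial in
-- Induction on the degree of the coefficients. For constants `b_k` the derived relation reads `Q' -
-- (p+1) X^p Q = ∑ b_k (X^k - m_k X^L)`. The right side has degree below `p`, so `Q = 0`; then the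
-- coefficient of `X^k`, `k ≠ L`, gives `b_k = 0`. In the inductive step the derivatives `B_k'`
-- vanish, so the `B_k` are constants and the hypothesis applies a second time.
theorem psi_relation_eq_zero {p L : ℕ} (hp : Odd p) (hL : L < p) {κ : Type*} [Fintype κ]
    {f : κ → ℕ} (hf : Function.Injective f) (hfp : ∀ k, f k < p) (hfL : ∀ k, f k ≠ L) (d : ℕ) :
    ∀ (B : κ → ℝ[X]) (Q : ℝ[X]), (∀ k, (B k).natDegree ≤ d) →
      (∀ T : ℝ, ∑ k, (B k).eval T * psi p L (f k) T = Q.eval T) → ∀ k, B k = 0 := by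
  induction d with
  | zero =>
    intro B Q hB h
    have hB' : ∀ k, derivative (B k) = 0 := fun k => by
      rw [eq_C_of_natDegree_le_zero (hB k), derivative_C]
    have h1 : derivative Q - C (p + 1 : ℝ) * X ^ p * Q
        - ∑ k, B k * (X ^ f k - C (momentRatio p L (f k)) * X ^ L) = 0 := by
      refine Polynomial.funext fun T => ?_
      rw [← psi_relation_deriv hp f h T]
      simp [hB']
    have hQ : Q = 0 := by
      by_contra hQ
      have h2 := congrArg (fun P : ℝ[X] => P.coeff (p + Q.natDegree)) h1
      simp only [coeff_sub, coeff_zero, finsetSum_coeff] at h2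
      have h3 : (derivative Q).coeff (p + Q.natDegree) = 0 := by
        refine coeff_eq_zero_of_natDegree_lt ?_
        have := natDegree_derivative_le Q
        omega
      have h4 : (C (p + 1 : ℝ) * X ^ p * Q).coeff (p + Q.natDegree) = (p + 1) * Q.leadingCoeff := by
        rw [mul_assoc, coeff_C_mul, add_comm p, coeff_X_pow_mul, leadingCoeff]
      have h5 : ∀ k, (B k * (X ^ f k - C (momentRatio p L (f k)) * X ^ L)).coeff
          (p + Q.natDegree) = 0 := by
        intro k
        rw [eq_C_of_natDegree_le_zero (hB k), coeff_C_mul, coeff_sub, coeff_X_pow, coeff_C_mul,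
          coeff_X_pow, if_neg, if_neg]
        · simp
        · omega
        · have := hfp k
          omega
      rw [h3, h4, Finset.sum_eq_zero fun k _ => h5 k] at h2
      have h6 : (p + 1 : ℝ) ≠ 0 := by positivity
      have h7 : (p + 1 : ℝ) * Q.leadingCoeff = 0 := by linarith
      exact hQ (leadingCoeff_eq_zero.1 ((mul_eq_zero.1 h7).resolve_left h6))
    intro k
    classical
    rw [hQ] at h1
    have h2 := congrArg (fun P : ℝ[X] => P.coeff (f k)) h1
    simp only [coeff_zero, finsetSum_coeff, derivative_zero, mul_zero, sub_zero,
      zero_sub, coeff_neg, neg_eq_zero] at h2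
    have h3 : ∀ j, (B j * (X ^ f j - C (momentRatio p L (f j)) * X ^ L)).coeff (f k)
        = if j = k then (B k).coeff 0 else 0 := by
      intro j
      rw [eq_C_of_natDegree_le_zero (hB j), coeff_C_mul, coeff_sub, coeff_X_pow, coeff_C_mul,
        coeff_X_pow, if_neg (hfL k)]
      by_cases hj : j = k
      · subst hj; simp
      · rw [if_neg hj, if_neg fun h => hj (hf h.symm)]; simp
    simp only [h3, Finset.sum_ite_eq', Finset.mem_univ, if_true] at h2
    rw [eq_C_of_natDegree_le_zero (hB k), h2, C_0]
  | succ d ih =>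
    intro B Q hB h
    have h1 := ih (fun k => derivative (B k)) _ (fun k => by
      have := natDegree_derivative_le (B k)
      have := hB k
      omega) (psi_relation_deriv hp f h)
    exact ih B Q (fun k => by
      rw [derivative_eq_zero.1 (h1 k)]
      exact Nat.zero_le d) h

open Polynomial in
theorem psiBar_linearIndependent {p L : ℕ} (hp : Odd p) (hLe : Even L) (hL : L < p) {n : ℕ}
    (b : Fin (n + 1) → {k : Fin p // (k : ℕ) ≠ L} → ℝ)
    (h : ∀ T : ℝ, ∑ i, ∑ k, b i k * psiBar p L (i : ℕ) (k.1 : ℕ) T = 0) : b = 0 := by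
  set B : {k : Fin p // (k : ℕ) ≠ L} → ℝ[X] := fun k => ∑ i : Fin (n + 1), C (b i k) * X ^ (i : ℕ)
  set Q : ℝ[X] := ∑ i : Fin (n + 1), ∑ k : {k : Fin p // (k : ℕ) ≠ L}, C (b i k) *
    ∑ m ∈ Finset.range (i + 1), C (psiCoeff p L k.1 m) * X ^ ((i : ℕ) - m) with hQ
  -- Each `ψ̄_{i,k}` is `T^i ψ_k` minus a polynomial, so a linear relation among the brackets is a
  -- relation among the `ψ_k` with polynomial coefficients.
  have hB : ∀ T : ℝ, ∑ k, (B k).eval T * psi p L (k.1 : ℕ) T = Q.eval T := by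
    intro T
    rw [← sub_eq_zero, ← h T, hQ]
    simp only [B, eval_finsetSum, eval_mul, eval_C, eval_pow, eval_X, Finset.sum_mul]
    rw [Finset.sum_comm, ← Finset.sum_sub_distrib]
    refine Finset.sum_congr rfl fun i _ => ?_
    rw [← Finset.sum_sub_distrib]
    refine Finset.sum_congr rfl fun k _ => ?_
    rw [psiBar_eq hp hLe hL k.1.2]
    ring
  have h0 := psi_relation_eq_zero hp hL
    (f := fun k : {k : Fin p // (k : ℕ) ≠ L} => ((k.1 : Fin p) : ℕ))
    (fun j k h => Subtype.ext (Fin.ext h)) (fun k => k.1.2) (fun k => k.2) n B Q (fun k => by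
      refine natDegree_sum_le_of_forall_le _ _ fun i _ => ?_
      exact (natDegree_C_mul_X_pow_le _ _).trans (Nat.lt_succ_iff.1 i.2)) hB
  funext i k
  have h1 := congrArg (fun P : ℝ[X] => P.coeff (i : ℕ)) (h0 k)
  simp only [B, finsetSum_coeff, coeff_C_mul, coeff_X_pow, coeff_zero] at h1
  rw [Finset.sum_eq_single i] at h1
  · simpa using h1
  · intro j _ hj
    rw [if_neg fun h => hj (Fin.ext h.symm), mul_zero]
  · simp

/-! ### Estimates for the linear boundary value problem -/

theorem abs_pow_le_one_add {p L : ℕ} (hL : L ≤ p) (T : ℝ) : |T| ^ L ≤ 1 + |T| ^ p := by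
  rcases le_total |T| 1 with h | h
  · have := pow_le_one₀ (n := L) (abs_nonneg T) h
    have := pow_nonneg (abs_nonneg T) p
    linarith
  · have := pow_le_pow_right₀ h hL
    linarith

/-- The comparison function is `H (1 + 4/(1+t))`. For `t ≥ 1` the term `(p+1) t^p` alone dominates
`1 + t^p`; on `[0,1]`, where `t^p` may vanish, the derivative `4/(1+t)²` supplies the missing `1`.
The constant `5` is the value of this function at `0`, divided by `H`. -/
theorem abs_le_of_nonneg_half {p : ℕ} (hp : 0 < p) {T R H : ℝ} (hT : 0 ≤ T) (hTR : T ≤ R) {W D : ℝ → ℝ}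
    (hW : ∀ t ∈ Icc T R, HasDerivWithinAt W (D t) (Icc T R) t)
    (hD : ∀ t ∈ Icc T R, |D t - (p + 1) * t ^ p * W t| ≤ H * (1 + |t| ^ p)) :
    |W T| ≤ 5 * H + Real.exp (T ^ (p + 1) - R ^ (p + 1)) * |W R| := by
  have hH : 0 ≤ H := by
    have h1 := (abs_nonneg _).trans (hD T ⟨le_rfl, hTR⟩)
    exact nonneg_of_mul_nonneg_left h1 (by positivity)
  have h := abs_le_of_lyapunov (p := p) hTR (d := W) (g := fun t => D t - (p + 1) * t ^ p * W t)
    (V := fun t => H * (1 + 4 * (1 + t)⁻¹)) (V' := fun t => H * (4 * (-1 / (1 + t) ^ 2)))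
    (fun t ht => (hW t ht).congr_deriv (by ring)) (fun t ht => ?_) (fun t ht => ?_) ?_
  · refine h.trans (add_le_add_left ?_ _)
    have : (1 + T)⁻¹ ≤ 1 := inv_le_one_of_one_le₀ (by linarith)
    nlinarith
  · have ht0 : (1 + t) ≠ 0 := by linarith [ht.1]
    exact (((((hasDerivAt_id t).const_add 1).fun_inv ht0).const_mul 4).const_add 1).const_mul H
      |>.hasDerivWithinAt
  · have ht0 : 0 ≤ t := hT.trans ht.1
    refine (hD t ht).trans ?_
    rw [abs_of_nonneg ht0]
    have h1 : 0 ≤ t ^ p := pow_nonneg ht0 p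
    have h2 : 1 + t ^ p ≤ (p + 1) * t ^ p * (1 + 4 * (1 + t)⁻¹) + 4 * (1 / (1 + t) ^ 2) := by
      have hp1 : t ^ p ≤ (p + 1) * t ^ p := by
        have : 0 ≤ (p : ℝ) * t ^ p := by positivity
        linarith
      have h4 : (p + 1) * t ^ p ≤ (p + 1) * t ^ p * (1 + 4 * (1 + t)⁻¹) :=
        le_mul_of_one_le_right (by positivity) (by
          have : 0 ≤ (1 + t)⁻¹ := by positivity
          linarith)
      rcases le_total t 1 with h | h
      · have : 1 ≤ 4 * (1 / (1 + t) ^ 2) := by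
          rw [mul_one_div, le_div_iff₀ (by positivity)]
          nlinarith
        linarith
      · have h5 : 1 ≤ t ^ p := one_le_pow₀ h
        have : (1 : ℝ) ≤ p := by exact_mod_cast hp
        have h6 : 0 ≤ 4 * (1 / (1 + t) ^ 2) := by positivity
        nlinarith
    have := mul_le_mul_of_nonneg_left h2 hH
    refine this.trans_eq ?_
    ring
  · have : 0 ≤ (1 + R)⁻¹ := inv_nonneg.2 (by linarith)
    positivity

theorem abs_le_of_symm {p : ℕ} (hp : Odd p) {R H δ : ℝ} {W D : ℝ → ℝ}
    (hW : ∀ t ∈ Icc (-R) R, HasDerivWithinAt W (D t) (Icc (-R) R) t)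
    (hD : ∀ t ∈ Icc (-R) R, |D t - (p + 1) * t ^ p * W t| ≤ H * (1 + |t| ^ p))
    (hR : |W R| ≤ δ) (hR' : |W (-R)| ≤ δ) :
    ∀ T ∈ Icc (-R) R, |W T| ≤ 5 * H + Real.exp (T ^ (p + 1) - R ^ (p + 1)) * δ := by
  intro T hT
  rcases le_total 0 T with h | h
  · have hsub : Icc T R ⊆ Icc (-R) R := Icc_subset_Icc_left hT.1
    refine (abs_le_of_nonneg_half hp.pos h hT.2 (fun t ht => (hW t (hsub ht)).mono hsub)
      fun t ht => hD t (hsub ht)).trans ?_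
    gcongr
  · have hneg : ∀ t ∈ Icc (-T) R, -t ∈ Icc (-R) R := fun t ht =>
      ⟨neg_le_neg ht.2, by linarith [ht.1, hT.1]⟩
    have := abs_le_of_nonneg_half hp.pos (T := -T) (R := R) (H := H) (W := fun t => W (-t))
      (D := fun t => -D (-t)) (by linarith) (by linarith [hT.1]) (fun t ht => ?_) fun t ht => ?_
    · simp only [neg_neg] at this
      rw [hp.add_one.neg_pow] at this
      refine this.trans ?_
      gcongr
    · have h1 := (hW (-t) (hneg t ht)).scomp t (hasDerivWithinAt_neg t (Icc (-T) R)) hneg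
      exact h1.congr_deriv (by simp)
    · have h1 := hD (-t) (hneg t ht)
      rw [abs_neg, hp.neg_pow] at h1
      rw [← abs_neg]
      refine (le_of_eq ?_).trans h1
      congr 1
      ring

/-- The coefficient `a` is controlled by the solvability condition. -/
theorem abs_coeff_le {p L : ℕ} (hp : Odd p) (hLe : Even L) :
    ∃ C : ℝ, 0 ≤ C ∧ ∀ (R a H δ : ℝ) (W D : ℝ → ℝ), 1 ≤ R →
      (∀ t ∈ Icc (-R) R, HasDerivWithinAt W (D t) (Icc (-R) R) t) →
      (∀ t ∈ Icc (-R) R, |D t - ((p + 1) * t ^ p * W t + a * t ^ L)| ≤ H * (1 + |t| ^ p)) →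
      |W R| ≤ δ → |W (-R)| ≤ δ → |a| ≤ C * (H + δ * Real.exp (-R ^ (p + 1))) := by
  have hev : Even (p + 1) := hp.add_one
  set e : ℝ → ℝ := fun t => Real.exp (-t ^ (p + 1)) with he
  have hec : Continuous e := by fun_prop
  set κ : ℝ := ∫ y, (1 + |y| ^ p) * e y with hκ
  have hκi : Integrable fun y => (1 + |y| ^ p) * e y := by
    have h1 := (integrable_pow_mul_exp hp 0).add (integrable_pow_mul_exp hp p).norm
    refine h1.congr (Eventually.of_forall fun y => ?_)
    simp only [Pi.add_apply, norm_mul, norm_pow, Real.norm_eq_abs, Real.abs_exp, he]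
    ring
  -- Integrating over `[-1,1]` only gives a lower bound for the moment that is uniform in `R ≥ 1`.
  set ζ : ℝ := ∫ y in (-1 : ℝ)..1, y ^ L * e y with hζ
  have hζc : Continuous fun y => y ^ L * e y := by fun_prop
  have hζ0 : 0 < ζ := by
    have h1 : 0 < ∫ y in (0 : ℝ)..1, y ^ L * e y :=
      intervalIntegral.intervalIntegral_pos_of_pos_on (hζc.intervalIntegrable _ _)
        (fun y hy => mul_pos (pow_pos hy.1 L) (Real.exp_pos _)) one_pos
    exact h1.trans_le (intervalIntegral.integral_mono_interval (by norm_num) zero_le_one le_rfl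
      (Eventually.of_forall fun y => mul_nonneg (hLe.pow_nonneg y) (Real.exp_pos _).le)
      (hζc.intervalIntegrable _ _))
  have hκ0 : 0 ≤ κ := integral_nonneg fun y => by positivity
  refine ⟨(κ + 2) / ζ, by positivity, fun R a H δ W D hR hW hD h1 h2 => ?_⟩
  have hRR : -R ≤ R := by linarith
  have hH : 0 ≤ H :=
    nonneg_of_mul_nonneg_left ((abs_nonneg _).trans (hD R ⟨hRR, le_rfl⟩)) (by positivity)
  have hδ : 0 ≤ δ := (abs_nonneg _).trans h1
  set Z : ℝ → ℝ := fun t => ∫ y in (0 : ℝ)..t, y ^ L * e y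
  set K : ℝ → ℝ := fun t => ∫ y in (0 : ℝ)..t, (1 + |y| ^ p) * e y
  have hZ : ∀ t, HasDerivAt Z (t ^ L * e t) t := fun t =>
    intervalIntegral.integral_hasDerivAt_right (hζc.intervalIntegrable _ _)
      hζc.aestronglyMeasurable.stronglyMeasurableAtFilter hζc.continuousAt
  have hκc : Continuous fun y => (1 + |y| ^ p) * e y := by fun_prop
  have hK : ∀ t, HasDerivAt K ((1 + |t| ^ p) * e t) t := fun t =>
    intervalIntegral.integral_hasDerivAt_right (hκc.intervalIntegrable _ _)
      hκc.aestronglyMeasurable.stronglyMeasurableAtFilter hκc.continuousAt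
  have hF : ∀ t ∈ Icc (-R) R, HasDerivWithinAt (fun t => e t * W t - a * Z t)
      (e t * (D t - ((p + 1) * t ^ p * W t + a * t ^ L))) (Icc (-R) R) t := by
    intro t ht
    have h3 : HasDerivWithinAt e (e t * (-((p + 1 : ℕ) * t ^ p))) (Icc (-R) R) t :=
      ((hasDerivAt_pow (p + 1) t).neg.exp).hasDerivWithinAt
    refine ((h3.mul (hW t ht)).sub ((hZ t).hasDerivWithinAt.const_mul a)).congr_deriv ?_
    push_cast
    ring
  -- The derivative `D` is not assumed integrable, so the identity `(e W - a Z)' = e · residual` is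
  -- not integrated. Instead the bound on the residual is expressed by two monotone functions, one
  -- for each sign.
  have hmono : ∀ s : ℝ, (s = 1 ∨ s = -1) → MonotoneOn
      (fun t => H * K t + s * (e t * W t - a * Z t)) (Icc (-R) R) := by
    intro s hs
    have hF2 : ∀ t ∈ Icc (-R) R, HasDerivWithinAt (fun t => H * K t + s * (e t * W t - a * Z t))
        (H * ((1 + |t| ^ p) * e t) + s * (e t * (D t - ((p + 1) * t ^ p * W t + a * t ^ L))))
        (Icc (-R) R) t := fun t ht =>
      ((hK t).hasDerivWithinAt.const_mul H).add ((hF t ht).const_mul s)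
    refine monotoneOn_of_hasDerivWithinAt_nonneg (convex_Icc _ _)
      (fun t ht => (hF2 t ht).continuousWithinAt)
      (fun t ht => (hF2 t (interior_subset ht)).mono interior_subset) fun t ht => ?_
    have h3 := hD t (interior_subset ht)
    have h4 := Real.exp_pos (-t ^ (p + 1))
    set x := D t - ((p + 1) * t ^ p * W t + a * t ^ L)
    have h5 : -(s * x) ≤ H * (1 + |t| ^ p) := by
      rcases hs with rfl | rfl
      · have := neg_abs_le x; linarith
      · have := le_abs_self x; linarith
    have h6 : 0 ≤ e t * (H * (1 + |t| ^ p) + s * x) := mul_nonneg h4.le (by linarith)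
    linarith
  have hKR : K R - K (-R) ≤ κ := by
    have h3 : K R - K (-R) = ∫ y in (-R)..R, (1 + |y| ^ p) * e y := by
      simp only [K]
      rw [intervalIntegral.integral_interval_sub_left (hκc.intervalIntegrable _ _)
        (hκc.intervalIntegrable _ _)]
    rw [h3, intervalIntegral.integral_of_le hRR]
    exact setIntegral_le_integral hκi (Eventually.of_forall fun y => by positivity)
  have hZR : ζ ≤ Z R - Z (-R) := by
    have h3 : Z R - Z (-R) = ∫ y in (-R)..R, y ^ L * e y := by
      simp only [Z]
      rw [intervalIntegral.integral_interval_sub_left (hζc.intervalIntegrable _ _)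
        (hζc.intervalIntegrable _ _)]
    rw [h3]
    exact intervalIntegral.integral_mono_interval (by linarith) (by norm_num) hR
      (Eventually.of_forall fun y => mul_nonneg (hLe.pow_nonneg y) (Real.exp_pos _).le)
      (hζc.intervalIntegrable _ _)
  have hm1 := hmono 1 (.inl rfl) (left_mem_Icc.2 hRR) (right_mem_Icc.2 hRR) hRR
  have hm2 := hmono (-1) (.inr rfl) (left_mem_Icc.2 hRR) (right_mem_Icc.2 hRR) hRR
  simp only at hm1 hm2
  have heR : e (-R) = e R := by simp only [he]; rw [hev.neg_pow]
  have heR0 : 0 < e R := Real.exp_pos _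
  rw [heR] at hm1 hm2
  have hb1 : |e R * W R - e R * W (-R)| ≤ 2 * (δ * e R) := by
    rw [← mul_sub, abs_mul, abs_of_pos heR0]
    have := (abs_sub (W R) (W (-R)))
    nlinarith
  have hb2 : H * (K R - K (-R)) ≤ H * κ := mul_le_mul_of_nonneg_left hKR hH
  have hb3 : |a * (Z R - Z (-R))| ≤ H * κ + 2 * (δ * e R) := by
    have h3 := abs_le.1 hb1
    rw [abs_le]
    constructor <;> linarith
  rw [abs_mul, abs_of_nonneg (hζ0.le.trans hZR)] at hb3
  have hb4 : |a| * ζ ≤ (κ + 2) * (H + δ * e R) := by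
    have h3 := mul_le_mul_of_nonneg_left hZR (abs_nonneg a)
    have h4 : 0 ≤ δ * e R := by positivity
    nlinarith
  rw [div_mul_eq_mul_div, le_div_iff₀ hζ0]
  exact hb4

/-- Once `a` is bounded, `a T^L` is absorbed into the residual by `|T|^L ≤ 1 + |T|^p`, and the
estimate for the equation without parameter applies. -/
theorem linear_estimate {p L : ℕ} (hp : Odd p) (hLe : Even L) (hL : L < p) :
    ∃ C : ℝ, 1 ≤ C ∧ ∀ (R a H δ : ℝ) (W D : ℝ → ℝ), 1 ≤ R →
      (∀ t ∈ Icc (-R) R, HasDerivWithinAt W (D t) (Icc (-R) R) t) →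
      (∀ t ∈ Icc (-R) R, |D t - ((p + 1) * t ^ p * W t + a * t ^ L)| ≤ H * (1 + |t| ^ p)) →
      |W R| ≤ δ → |W (-R)| ≤ δ → |a| ≤ C * (H + δ * Real.exp (-R ^ (p + 1))) ∧
      ∀ T ∈ Icc (-R) R, |W T| ≤ C * (H + δ * Real.exp (T ^ (p + 1) - R ^ (p + 1))) := by
  obtain ⟨C, hC0, hC⟩ := abs_coeff_le hp hLe
  refine ⟨6 * (C + 1), by linarith, fun R a H δ W D hR hW hD h1 h2 => ?_⟩
  have ha := hC R a H δ W D hR hW hD h1 h2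
  have hRR : -R ≤ R := by linarith
  have hH : 0 ≤ H :=
    nonneg_of_mul_nonneg_left ((abs_nonneg _).trans (hD R ⟨hRR, le_rfl⟩)) (by positivity)
  have hδ : 0 ≤ δ := (abs_nonneg _).trans h1
  refine ⟨ha.trans (mul_le_mul_of_nonneg_right (by linarith) (by positivity)), fun T hT => ?_⟩
  have h3 := abs_le_of_symm hp (H := H + |a|) hW (fun t ht => ?_) h1 h2 T hT
  · have h4 : Real.exp (-R ^ (p + 1)) ≤ Real.exp (T ^ (p + 1) - R ^ (p + 1)) :=
      Real.exp_le_exp.2 (by have := hp.add_one.pow_nonneg T; linarith)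
    have h5 : δ * Real.exp (-R ^ (p + 1)) ≤ δ * Real.exp (T ^ (p + 1) - R ^ (p + 1)) :=
      mul_le_mul_of_nonneg_left h4 hδ
    have h6 : 0 ≤ δ * Real.exp (T ^ (p + 1) - R ^ (p + 1)) := by positivity
    have h7 : |a| ≤ C * (H + δ * Real.exp (T ^ (p + 1) - R ^ (p + 1))) :=
      ha.trans (mul_le_mul_of_nonneg_left (by linarith) hC0)
    nlinarith
  · have h4 := abs_add_le (D t - ((p + 1) * t ^ p * W t + a * t ^ L)) (a * t ^ L)
    rw [show D t - ((p + 1) * t ^ p * W t + a * t ^ L) + a * t ^ L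
      = D t - (p + 1) * t ^ p * W t by ring, abs_mul, abs_pow] at h4
    have h5 := mul_le_mul_of_nonneg_left (abs_pow_le_one_add hL.le t) (abs_nonneg a)
    have := hD t ht
    linarith

/-- The a priori estimate for `η w' = (p+1) (t/η)^p w + a (t/η)^L + h` on `[-r, r]`. -/
theorem apriori_estimate {p L : ℕ} (hp : Odd p) (hLe : Even L) (hL : L < p) :
    ∃ C : ℝ, 1 ≤ C ∧ ∀ (r η a H δ : ℝ) (w D : ℝ → ℝ), 0 < η → η ≤ r →
      (∀ t ∈ Icc (-r) r, HasDerivWithinAt w (D t) (Icc (-r) r) t) →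
      (∀ t ∈ Icc (-r) r, |η * D t - ((p + 1) * (t / η) ^ p * w t + a * (t / η) ^ L)|
        ≤ H * (1 + |t / η| ^ p)) →
      |w r| ≤ δ → |w (-r)| ≤ δ → |a| ≤ C * (H + δ * Real.exp (-(r / η) ^ (p + 1))) ∧
      ∀ t ∈ Icc (-r) r, |w t| ≤ C * (H + δ * Real.exp ((t / η) ^ (p + 1) - (r / η) ^ (p + 1))) := by
  obtain ⟨C, hC0, hC⟩ := linear_estimate hp hLe hL
  refine ⟨C, hC0, fun r η a H δ w D hη hηr hw hD h1 h2 => ?_⟩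
  have hmem : ∀ T ∈ Icc (-(r / η)) (r / η), η * T ∈ Icc (-r) r := by
    intro T hT
    rw [← neg_div] at hT
    exact ⟨by have := (div_le_iff₀' hη).1 hT.1; linarith,
      by have := (le_div_iff₀' hη).1 hT.2; linarith⟩
  have hmul : η * (r / η) = r := mul_div_cancel₀ r hη.ne'
  have key := hC (r / η) a H δ (fun T => w (η * T)) (fun T => η * D (η * T))
    ((one_le_div hη).2 hηr) (fun T hT => ?_) (fun T hT => ?_) (by rwa [hmul])
    (by rwa [mul_neg, hmul])
  · obtain ⟨h3, h4⟩ := key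
    refine ⟨h3, fun t ht => ?_⟩
    have := h4 (t / η) ⟨by rw [← neg_div]; exact div_le_div_of_nonneg_right ht.1 hη.le,
      div_le_div_of_nonneg_right ht.2 hη.le⟩
    rwa [mul_div_cancel₀ t hη.ne'] at this
  · have h3 : HasDerivWithinAt (fun T => η * T) η (Icc (-(r / η)) (r / η)) T := by
      simpa using ((hasDerivAt_id T).const_mul η).hasDerivWithinAt
    exact ((hw _ (hmem T hT)).scomp T h3 hmem)
  · have := hD _ (hmem T hT)
    rwa [mul_div_cancel_left₀ T hη.ne'] at this

theorem exp_neg_div_pow_le {p : ℕ} {c : ℝ} (hc : 0 < c) (m : ℕ) :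
    ∃ C : ℝ, 0 ≤ C ∧ ∀ η : ℝ, 0 < η → η ≤ 1 → Real.exp (-(c / η ^ (p + 1))) ≤ C * η ^ m := by
  refine ⟨m.factorial / c ^ m, by positivity, fun η hη hη1 => ?_⟩
  have h1 := Real.pow_div_factorial_le_exp (c / η ^ (p + 1)) (by positivity) m
  rw [Real.exp_neg, inv_le_comm₀ (Real.exp_pos _) (by positivity)]
  refine le_trans ?_ h1
  rw [div_pow, div_mul_eq_mul_div, inv_div, div_div, mul_comm (m.factorial : ℝ)]
  gcongr
  exact pow_le_of_le_one hη.le hη1 (Nat.succ_ne_zero p)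

/-- A family whose residual is `O(η^m)` up to a small multiple of its parameter is `O(η^m)` in the
interior. -/
theorem family_estimate {p L : ℕ} (hp : Odd p) (hLe : Even L) (hL : L < p) {r r' : ℝ} (hr : 0 < r)
    (hrr' : r < r') (m : ℕ) {M C : ℝ} {δ : ℝ → ℝ} {d : ℝ → ℝ → ℝ}
    (h : ∀ᶠ η in 𝓝[>] (0 : ℝ), ∀ t ∈ Icc (-r') r', |d η t| ≤ M ∧
      ∃ D, HasDerivWithinAt (d η) D (Icc (-r') r') t ∧
        |η * D - ((p + 1) * (t / η) ^ p * d η t + δ η * (t / η) ^ L)|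
          ≤ C * (η * |δ η| + η ^ m) * (1 + |t / η| ^ p)) :
    ∃ C', ∀ᶠ η in 𝓝[>] (0 : ℝ), |δ η| ≤ C' * η ^ m ∧ ∀ t ∈ Icc (-r) r, |d η t| ≤ C' * η ^ m := by
  obtain ⟨A, hA1, hA⟩ := apriori_estimate hp hLe hL
  have hev : Even (p + 1) := hp.add_one
  have hc : 0 < r' ^ (p + 1) - r ^ (p + 1) :=
    sub_pos.2 (pow_lt_pow_left₀ hrr' hr.le (Nat.succ_ne_zero p))
  obtain ⟨E, hE0, hE⟩ := exp_neg_div_pow_le (p := p) hc m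
  set G := |C| + |M| * E with hG
  have hG0 : 0 ≤ G := by positivity
  refine ⟨A * (|C| * (2 * A * G) + G), ?_⟩
  have hr'0 : 0 < r' := hr.trans hrr'
  -- The last smallness condition lets the term `η |δ η|` of the residual be absorbed into the left
  -- side of the bound for `δ η`.
  have hsmall : ∀ᶠ η in 𝓝[>] (0 : ℝ), 0 < η ∧ η ≤ r' ∧ η ≤ 1 ∧ A * |C| * η ≤ 1 / 2 := by
    have h1 : ∀ᶠ η in 𝓝[>] (0 : ℝ), A * |C| * η ≤ 1 / 2 := by
      have : Tendsto (fun η : ℝ => A * |C| * η) (𝓝[>] 0) (𝓝 (A * |C| * 0)) :=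
        (tendsto_id.const_mul _).mono_left nhdsWithin_le_nhds
      rw [mul_zero] at this
      exact this.eventually_le_const (by norm_num)
    have h2 : ∀ᶠ η in 𝓝[>] (0 : ℝ), η ≤ r' :=
      mem_of_superset (Ioc_mem_nhdsGT hr'0) fun x hx => hx.2
    have h3 : ∀ᶠ η in 𝓝[>] (0 : ℝ), η ≤ 1 :=
      mem_of_superset (Ioc_mem_nhdsGT one_pos) fun x hx => hx.2
    filter_upwards [h1, h2, h3, self_mem_nhdsWithin] with η h1 h2 h3 h4
    exact ⟨h4, h2, h3, h1⟩
  filter_upwards [h, hsmall] with η hη ⟨hη0, hηr, hη1, hηC⟩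
  have hm0 : 0 < η ^ m := pow_pos hη0 m
  have hbd := fun t ht => (hη t ht).1
  choose! D hD using fun t ht => (hη t ht).2
  have hr'R : -r' ≤ r' := by linarith
  have hres : ∀ t ∈ Icc (-r') r', |η * D t - ((p + 1) * (t / η) ^ p * d η t + δ η * (t / η) ^ L)|
      ≤ |C| * (η * |δ η| + η ^ m) * (1 + |t / η| ^ p) := fun t ht =>
    ((hD t ht).2).trans (by gcongr; exact le_abs_self C)
  obtain ⟨h1, h2⟩ := hA r' η (δ η) _ |M| (d η) D hη0 hηr (fun t ht => (hD t ht).1) hres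
    ((hbd r' (right_mem_Icc.2 hr'R)).trans (le_abs_self M))
    ((hbd (-r') (left_mem_Icc.2 hr'R)).trans (le_abs_self M))
  -- Strictly inside `[-r', r']` the influence of the boundary values is at most `exp(-(r'^{p+1} -
  -- r^{p+1})/η^{p+1})`, smaller than any power of `η`. This is why the conclusion is restricted to
  -- `[-r, r]`.
  have hexp : ∀ t ∈ Icc (-r) r, Real.exp ((t / η) ^ (p + 1) - (r' / η) ^ (p + 1)) ≤ E * η ^ m := by
    intro t ht
    refine le_trans (Real.exp_le_exp.2 ?_) (hE η hη0 hη1)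
    have : t ^ (p + 1) ≤ r ^ (p + 1) := by
      rw [← hev.pow_abs]
      exact pow_le_pow_left₀ (abs_nonneg t) (abs_le.2 ht) _
    rw [div_pow, div_pow, ← sub_div, ← neg_div]
    gcongr
    linarith
  have hexp0 : Real.exp (-(r' / η) ^ (p + 1)) ≤ E * η ^ m := by
    simpa using hexp 0 ⟨by linarith, hr.le⟩
  have h3 : |M| * Real.exp (-(r' / η) ^ (p + 1)) ≤ |M| * E * η ^ m := by
    rw [mul_assoc]
    exact mul_le_mul_of_nonneg_left hexp0 (abs_nonneg M)
  have hδ : |δ η| ≤ 2 * A * G * η ^ m := by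
    have h4 : |δ η| ≤ A * (|C| * (η * |δ η| + η ^ m) + |M| * E * η ^ m) :=
      h1.trans (mul_le_mul_of_nonneg_left (by linarith) (by linarith))
    have h5 : A * |C| * η * |δ η| ≤ 1 / 2 * |δ η| :=
      mul_le_mul_of_nonneg_right hηC (abs_nonneg _)
    rw [hG]
    linarith
  have hfin : |C| * (η * |δ η| + η ^ m) + |M| * E * η ^ m
      ≤ (|C| * (2 * A * G) + G) * η ^ m := by
    have h4 : η * |δ η| ≤ 2 * A * G * η ^ m :=
      (mul_le_of_le_one_left (abs_nonneg _) hη1).trans hδ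
    have := mul_le_mul_of_nonneg_left h4 (abs_nonneg C)
    rw [hG] at this ⊢
    linarith
  refine ⟨h1.trans ?_, fun t ht => (h2 t ⟨by linarith [ht.1], by linarith [ht.2]⟩).trans ?_⟩
  · rw [mul_assoc]
    exact mul_le_mul_of_nonneg_left (by linarith) (by linarith)
  · have h4 := mul_le_mul_of_nonneg_left (hexp t ht) (abs_nonneg M)
    rw [mul_assoc A]
    exact mul_le_mul_of_nonneg_left (by linarith) (by linarith)

/-! ### Existence and uniqueness for the nonlinear boundary value problem -/

/-- Variation of constants from the left end; the number `a` is chosen so that the forcing has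
integral zero against `e^{-(t/η)^{p+1}}` over `[-r, r]`, which is the condition at the right end. -/
theorem exists_linear_bvp {p L : ℕ} (hLe : Even L) {r η : ℝ} (hr : 0 < r) (hη : 0 < η)
    {g : ℝ → ℝ} (hg : Continuous g) :
    ∃ (a : ℝ) (w : ℝ → ℝ),
      (∀ t, HasDerivAt w (((p + 1) * (t / η) ^ p * w t + a * (t / η) ^ L + g t) / η) t) ∧
      w r = 0 ∧ w (-r) = 0 := by
  set e : ℝ → ℝ := fun t => Real.exp (-(t / η) ^ (p + 1)) with he
  have hec : Continuous e := by fun_prop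
  have hZc : Continuous fun t => (t / η) ^ L * e t := by fun_prop
  have hgc : Continuous fun t => g t * e t := by fun_prop
  set Z := ∫ t in (-r)..r, (t / η) ^ L * e t with hZ
  have hZ0 : 0 < Z := by
    have h1 : 0 < ∫ y in (0 : ℝ)..r, (y / η) ^ L * e y :=
      intervalIntegral.intervalIntegral_pos_of_pos_on (hZc.intervalIntegrable _ _)
        (fun y hy => mul_pos (pow_pos (div_pos hy.1 hη) L) (Real.exp_pos _)) hr
    exact h1.trans_le (intervalIntegral.integral_mono_interval (by linarith) hr.le le_rfl
      (Eventually.of_forall fun y => mul_nonneg (hLe.pow_nonneg _) (Real.exp_pos _).le)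
      (hZc.intervalIntegrable _ _))
  set a := -(∫ t in (-r)..r, g t * e t) / Z with ha
  set f : ℝ → ℝ := fun t => (a * (t / η) ^ L + g t) / η * e t with hf
  have hfc : Continuous f := by fun_prop
  refine ⟨a, fun t => Real.exp ((t / η) ^ (p + 1)) * ∫ s in (-r)..t, f s, fun t => ?_, ?_, ?_⟩
  · have h1 : HasDerivAt (fun t => ∫ s in (-r)..t, f s) (f t) t :=
      intervalIntegral.integral_hasDerivAt_right (hfc.intervalIntegrable _ _)
        hfc.aestronglyMeasurable.stronglyMeasurableAtFilter hfc.continuousAt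
    have h2 : HasDerivAt (fun t : ℝ => (t / η) ^ (p + 1)) ((p + 1 : ℕ) * (t / η) ^ p * (1 / η)) t := by
      simpa using ((hasDerivAt_id t).div_const η).fun_pow (p + 1)
    refine (h2.exp.mul h1).congr_deriv ?_
    have h3 : Real.exp ((t / η) ^ (p + 1)) * f t = (a * (t / η) ^ L + g t) / η := by
      rw [hf]
      simp only [he]
      rw [mul_left_comm, ← Real.exp_add, add_neg_cancel, Real.exp_zero, mul_one]
    rw [h3]
    push_cast
    field_simp
    ring
  · have h1 : ∫ s in (-r)..r, f s = (a * Z + ∫ t in (-r)..r, g t * e t) / η := by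
      rw [hZ, ← intervalIntegral.integral_const_mul, ← intervalIntegral.integral_add
        ((hZc.const_mul a).intervalIntegrable _ _) (hgc.intervalIntegrable _ _),
        ← intervalIntegral.integral_div]
      refine intervalIntegral.integral_congr fun t _ => ?_
      simp only [hf]
      ring
    simp only [h1, ha, div_mul_cancel₀ _ hZ0.ne']
    simp
  · simp

/-- Banach's fixed point theorem in the ball of radius `M` of `ℝ × C([-r, r])`, for the map that
sends `(a, w)` to the solution of the linear problem with forcing `N t a w`. The condition `C (n₀ +
2 κ M) ≤ M` makes the ball invariant, and `C κ ≤ 1/4` gives the contraction factor `1/2`. -/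
theorem exists_bvp_solution {p L : ℕ} (hp : Odd p) (hLe : Even L) (hL : L < p) :
    ∃ C : ℝ, 1 ≤ C ∧ ∀ (r η M n₀ κ : ℝ) (N : ℝ → ℝ → ℝ → ℝ), 0 < η → η ≤ r → 0 ≤ M →
      ContinuousOn (fun z : ℝ × ℝ × ℝ => N z.1 z.2.1 z.2.2)
        (Icc (-r) r ×ˢ Icc (-M) M ×ˢ Icc (-M) M) →
      (∀ t ∈ Icc (-r) r, |N t 0 0| ≤ n₀ * (1 + |t / η| ^ p)) →
      (∀ t ∈ Icc (-r) r, ∀ a ∈ Icc (-M) M, ∀ a' ∈ Icc (-M) M, ∀ w ∈ Icc (-M) M, ∀ w' ∈ Icc (-M) M,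
        |N t a w - N t a' w'| ≤ κ * (|a - a'| + |w - w'|) * (1 + |t / η| ^ p)) →
      0 ≤ κ → C * (n₀ + 2 * κ * M) ≤ M → C * κ ≤ 1 / 4 →
      ∃ (a : ℝ) (w : ℝ → ℝ), |a| ≤ M ∧ (∀ t ∈ Icc (-r) r, |w t| ≤ M) ∧
        (∀ t ∈ Icc (-r) r, HasDerivWithinAt w
          (((p + 1) * (t / η) ^ p * w t + a * (t / η) ^ L + N t a (w t)) / η) (Icc (-r) r) t) ∧
        w r = 0 ∧ w (-r) = 0 := by
  obtain ⟨C, hC1, hC⟩ := apriori_estimate hp hLe hL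
  refine ⟨C, hC1, fun r η M n₀ κ N hη hηr hM hN hN0 hNl hκ hCM hCκ => ?_⟩
  have hr : 0 < r := hη.trans_le hηr
  have hrr : -r ≤ r := by linarith
  -- The forcing is extended to `ℝ` by projecting `t` onto the interval, since the linear problem is
  -- solved for continuous functions on `ℝ`.
  set pr : ℝ → Icc (-r) r := projIcc (-r) r hrr with hpr
  have hprc : Continuous pr := continuous_projIcc
  set g : ℝ × C(Icc (-r) r, ℝ) → ℝ → ℝ := fun x t => N (pr t) x.1 (x.2 (pr t)) with hg
  set s : Set (ℝ × C(Icc (-r) r, ℝ)) := Metric.closedBall 0 M with hs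
  have hs1 : ∀ x ∈ s, x.1 ∈ Icc (-M) M := fun x hx => by
    have h1 : ‖x‖ ≤ M := by simpa [hs] using hx
    exact abs_le.1 ((norm_fst_le x).trans h1)
  have hs2 : ∀ x ∈ s, ∀ t, x.2 t ∈ Icc (-M) M := fun x hx t => by
    have h1 : ‖x‖ ≤ M := by simpa [hs] using hx
    exact abs_le.1 ((x.2.norm_coe_le_norm t).trans ((norm_snd_le x).trans h1))
  have hgc : ∀ x ∈ s, Continuous (g x) := fun x hx =>
    hN.comp_continuous (f := fun t => ((pr t : ℝ), x.1, x.2 (pr t))) (by fun_prop) fun t =>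
      ⟨(pr t).2, hs1 x hx, hs2 x hx _⟩
  have hprt : ∀ t (ht : t ∈ Icc (-r) r), pr t = ⟨t, ht⟩ := fun t ht => projIcc_of_mem hrr ht
  choose! a w hw hwr hwr' using fun x (hx : x ∈ s) =>
    exists_linear_bvp (p := p) (L := L) hLe hr hη (hgc x hx)
  have hwc : ∀ x ∈ s, Continuous (w x) := fun x hx =>
    continuous_iff_continuousAt.2 fun t => (hw x hx t).continuousAt
  classical
  -- The value `0` outside the ball is never used, as the ball is invariant.
  set Φ : ℝ × C(Icc (-r) r, ℝ) → ℝ × C(Icc (-r) r, ℝ) := fun x =>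
     if hx : x ∈ s then (a x, ⟨fun t => w x t, (hwc x hx).comp continuous_subtype_val⟩) else 0
    with hΦ
  have hΦ1 : ∀ x ∈ s, (Φ x).1 = a x := fun x hx => by simp only [hΦ]; rw [dif_pos hx]
  have hΦ2 : ∀ x ∈ s, ∀ t, (Φ x).2 t = w x t := fun x hx t => by
    simp only [hΦ]; rw [dif_pos hx]; rfl
  have hmaps : MapsTo Φ s s := by
    intro x hx
    obtain ⟨h1, h2⟩ := hC r η (a x) (n₀ + 2 * κ * M) 0 (w x) _ hη hηr
      (fun t _ => (hw x hx t).hasDerivWithinAt) (fun t ht => by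
        have h3 := hNl t ht _ (hs1 x hx) 0 ⟨by linarith, hM⟩ _ (hs2 x hx ⟨t, ht⟩) 0 ⟨by linarith, hM⟩
        rw [sub_zero, sub_zero] at h3
        have h4 : |x.1| + |x.2 ⟨t, ht⟩| ≤ 2 * M := by
          have := abs_le.2 (hs1 x hx)
          have := abs_le.2 (hs2 x hx ⟨t, ht⟩)
          linarith
        have h5 : κ * (|x.1| + |x.2 ⟨t, ht⟩|) * (1 + |t / η| ^ p) ≤ κ * (2 * M) * (1 + |t / η| ^ p) := by
          gcongr
        have h6 := abs_add_le (N t x.1 (x.2 ⟨t, ht⟩) - N t 0 0) (N t 0 0)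
        rw [sub_add_cancel] at h6
        rw [mul_div_cancel₀ _ hη.ne', add_sub_cancel_left]
        simp only [hg, hprt t ht]
        have := hN0 t ht
        linarith) (by rw [hwr x hx, abs_zero]) (by rw [hwr' x hx, abs_zero])
    simp only [zero_mul, add_zero] at h1 h2
    rw [hs, mem_closedBall_zero_iff, norm_prod_le_iff, hΦ1 x hx, ContinuousMap.norm_le _ hM]
    refine ⟨h1.trans hCM, fun t => ?_⟩
    rw [hΦ2 x hx]
    exact (h2 t t.2).trans hCM
  have hcontr : ContractingWith (1 / 2) (hmaps.restrict Φ s s) := by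
    refine ⟨by rw [← NNReal.coe_lt_coe]; norm_num, LipschitzWith.of_dist_le_mul fun x y => ?_⟩
    obtain ⟨x, hx⟩ := x
    obtain ⟨y, hy⟩ := y
    rw [Subtype.dist_eq, Subtype.dist_eq, MapsTo.val_restrict_apply, MapsTo.val_restrict_apply]
    simp only
    obtain ⟨h1, h2⟩ := hC r η (a x - a y) (2 * κ * dist x y) 0 (fun t => w x t - w y t) _ hη hηr
      (fun t _ => ((hw x hx t).sub (hw y hy t)).hasDerivWithinAt) (fun t ht => by
        have h3 := hNl t ht _ (hs1 x hx) _ (hs1 y hy) _ (hs2 x hx ⟨t, ht⟩) _ (hs2 y hy ⟨t, ht⟩)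
        have h4 : |x.1 - y.1| + |x.2 ⟨t, ht⟩ - y.2 ⟨t, ht⟩| ≤ 2 * dist x y := by
          have h5 : |x.1 - y.1| ≤ dist x y := by
            rw [← Real.dist_eq]; exact le_max_left _ _
          have h6 : |x.2 ⟨t, ht⟩ - y.2 ⟨t, ht⟩| ≤ dist x y := by
            rw [← Real.dist_eq]
            exact (ContinuousMap.dist_apply_le_dist _).trans (le_max_right _ _)
          linarith
        have h5 : κ * (|x.1 - y.1| + |x.2 ⟨t, ht⟩ - y.2 ⟨t, ht⟩|) * (1 + |t / η| ^ p)
            ≤ κ * (2 * dist x y) * (1 + |t / η| ^ p) := by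
          gcongr
        rw [← sub_div, mul_div_cancel₀ _ hη.ne']
        simp only [hg, hprt t ht]
        refine le_trans (le_of_eq ?_) ((h3.trans h5).trans_eq ?_)
        · congr 1
          ring
        · ring) (by rw [hwr x hx, hwr y hy, sub_zero, abs_zero])
        (by rw [hwr' x hx, hwr' y hy, sub_zero, abs_zero])
    simp only [zero_mul, add_zero] at h1 h2
    have h3 : C * (2 * κ * dist x y) ≤ ((1 / 2 : NNReal) : ℝ) * dist x y := by
      have := mul_le_mul_of_nonneg_right hCκ (dist_nonneg (x := x) (y := y))
      push_cast
      linarith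
    rw [Prod.dist_eq, max_le_iff, ContinuousMap.dist_le (by positivity), hΦ1 x hx, hΦ1 y hy]
    refine ⟨h1.trans h3, fun t => ?_⟩
    rw [hΦ2 x hx, hΦ2 y hy]
    exact (h2 t t.2).trans h3
  obtain ⟨x, hx, hfix, -⟩ := ContractingWith.exists_fixedPoint' (f := Φ)
    (Metric.isClosed_closedBall.isComplete) hmaps hcontr (x := 0)
    (by simpa [hs] using hM) (edist_ne_top _ _)
  have hfx : Φ x = x := hfix
  have hax : a x = x.1 := by rw [← hΦ1 x hx, hfx]
  have hwx : ∀ t (ht : t ∈ Icc (-r) r), w x t = x.2 ⟨t, ht⟩ := fun t ht => by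
    rw [← hΦ2 x hx ⟨t, ht⟩, hfx]
  refine ⟨a x, w x, hax ▸ abs_le.2 (hs1 x hx), fun t ht => ?_, fun t ht => ?_, hwr x hx, hwr' x hx⟩
  · rw [hwx t ht]
    exact abs_le.2 (hs2 x hx _)
  · have := (hw x hx t).hasDerivWithinAt (s := Icc (-r) r)
    simp only [hg, hprt t ht] at this
    rwa [← hwx t ht, ← hax] at this

/-- Apply the a priori estimate to the difference. If `m` is the maximum of `|w - w'|`, then `|a -
a'|` and `m` are each at most a quarter of `|a - a'| + m`, so both vanish. -/
theorem bvp_solution_unique {p L : ℕ} (hp : Odd p) (hLe : Even L) (hL : L < p) :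
    ∃ C : ℝ, 1 ≤ C ∧ ∀ (r η κ a a' : ℝ) (w w' h : ℝ → ℝ) , 0 < η → η ≤ r →
      (∀ t ∈ Icc (-r) r, |h t| ≤ κ * (|a - a'| + |w t - w' t|) * (1 + |t / η| ^ p)) →
      (∀ t ∈ Icc (-r) r, HasDerivWithinAt (fun t => w t - w' t)
          (((p + 1) * (t / η) ^ p * (w t - w' t) + (a - a') * (t / η) ^ L + h t) / η)
          (Icc (-r) r) t) →
      w r = w' r → w (-r) = w' (-r) → 0 ≤ κ → C * κ ≤ 1 / 4 →
      a = a' ∧ ∀ t ∈ Icc (-r) r, w t = w' t := by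
  obtain ⟨C, hC1, hC⟩ := apriori_estimate hp hLe hL
  refine ⟨C, hC1, fun r η κ a a' w w' h hη hηr hh hd h1 h2 hκ hCκ => ?_⟩
  have hrr : -r ≤ r := by linarith
  obtain ⟨t₀, ht₀, hmax⟩ := isCompact_Icc.exists_isMaxOn (nonempty_Icc.2 hrr)
    (ContinuousOn.abs fun t ht => (hd t ht).continuousWithinAt)
  set m := |w t₀ - w' t₀|
  have hm : ∀ t ∈ Icc (-r) r, |w t - w' t| ≤ m := fun t ht => hmax ht
  obtain ⟨h3, h4⟩ := hC r η (a - a') (κ * (|a - a'| + m)) 0 (fun t => w t - w' t) _ hη hηr hd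
    (fun t ht => by
      rw [mul_div_cancel₀ _ hη.ne', add_sub_cancel_left]
      refine (hh t ht).trans ?_
      have := hm t ht
      gcongr) (by rw [h1, sub_self, abs_zero]) (by rw [h2, sub_self, abs_zero])
  simp only [zero_mul, add_zero] at h3 h4
  have h5 := h4 t₀ ht₀
  have h6 : C * (κ * (|a - a'| + m)) ≤ 1 / 4 * (|a - a'| + m) := by
    rw [← mul_assoc]
    exact mul_le_mul_of_nonneg_right hCκ (by positivity)
  have h7 : m ≤ C * (κ * (|a - a'| + m)) := h5
  have h8 : 0 ≤ m := abs_nonneg _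
  have h9 := abs_nonneg (a - a')
  refine ⟨sub_eq_zero.1 (abs_eq_zero.1 (by linarith)), fun t ht => ?_⟩
  have h10 := hm t ht
  exact sub_eq_zero.1 (abs_eq_zero.1 (le_antisymm (by linarith) (abs_nonneg _)))

/-! ### Taylor expansions with parameters -/

section Taylor

variable {E : Type*} [NormedAddCommGroup E] [NormedSpace ℝ E] {D : Set E} {I : Set ℝ}

theorem hasDerivWithinAt_slice {f : E → ℝ → ℝ}
    (hf : ContDiffOn ℝ ∞ (fun z : E × ℝ => f z.1 z.2) (D ×ˢ I)) {y : E} (hy : y ∈ D) {s : ℝ}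
    (hs : s ∈ I) : HasDerivWithinAt (f y)
      (fderivWithin ℝ (fun z : E × ℝ => f z.1 z.2) (D ×ˢ I) (y, s) (0, 1)) I s := by
  have h1 : HasFDerivWithinAt (fun z : E × ℝ => f z.1 z.2) _ (D ×ˢ I) (y, s) :=
    ((hf.differentiableOn (by simp)) (y, s) ⟨hy, hs⟩).hasFDerivWithinAt
  have h2 : HasDerivWithinAt (fun s : ℝ => (y, s)) ((0 : E), (1 : ℝ)) I s :=
    (hasDerivWithinAt_const s I y).prodMk (hasDerivWithinAt_id s I)
  exact h1.comp_hasDerivWithinAt s h2 fun s hs => ⟨hy, hs⟩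

theorem contDiffOn_derivWithin_slice (hD : UniqueDiffOn ℝ D) (hI : UniqueDiffOn ℝ I)
    {f : E → ℝ → ℝ} (hf : ContDiffOn ℝ ∞ (fun z : E × ℝ => f z.1 z.2) (D ×ˢ I)) :
    ContDiffOn ℝ ∞ (fun z : E × ℝ => derivWithin (f z.1) I z.2) (D ×ˢ I) := by
  have h1 : ContDiffOn ℝ ∞ (fderivWithin ℝ (fun z : E × ℝ => f z.1 z.2) (D ×ˢ I)) (D ×ˢ I) :=
    hf.fderivWithin (hD.prod hI) (by simp)
  refine (h1.clm_apply (contDiffOn_const (c := ((0 : E), (1 : ℝ))))).congr fun z hz => ?_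
  exact (hasDerivWithinAt_slice hf hz.1 hz.2).derivWithin (hI _ hz.2)

theorem contDiffOn_iteratedDerivWithin_slice (hD : UniqueDiffOn ℝ D) (hI : UniqueDiffOn ℝ I)
    (h0 : (0 : ℝ) ∈ I) (j : ℕ) {f : E → ℝ → ℝ}
    (hf : ContDiffOn ℝ ∞ (fun z : E × ℝ => f z.1 z.2) (D ×ˢ I)) :
    ContDiffOn ℝ ∞ (fun y => iteratedDerivWithin j (f y) I 0) D := by
  induction j generalizing f with
  | zero =>
    simp only [iteratedDerivWithin_zero]
    exact hf.comp (f := fun y : E => (y, (0 : ℝ))) (contDiff_prodMk_left (0 : ℝ)).contDiffOn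
      fun y hy => ⟨hy, h0⟩
  | succ j ih =>
    simp only [iteratedDerivWithin_succ']
    exact ih (f := fun y => derivWithin (f y) I) (contDiffOn_derivWithin_slice hD hI hf)

/-- Induction on the order: the Taylor remainder of `f y` has as its derivative the remainder of one
order less of `(f y)'`. The mean value inequality on the segment from `0` to `s` then adds a factor
`|s|`. Uniformity in `y` comes from compactness at order zero. -/
theorem taylor_slice_bound (hD : UniqueDiffOn ℝ D) (hI : UniqueDiffOn ℝ I) (hDc : IsCompact D)
    (hIc : IsCompact I) (hIo : I.OrdConnected) (h0 : (0 : ℝ) ∈ I) (J : ℕ) {f : E → ℝ → ℝ}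
    (hf : ContDiffOn ℝ ∞ (fun z : E × ℝ => f z.1 z.2) (D ×ˢ I)) :
    ∃ C : ℝ, 0 ≤ C ∧ ∀ y ∈ D, ∀ s ∈ I,
      |f y s - ∑ j ∈ Finset.range J, iteratedDerivWithin j (f y) I 0 / j.factorial * s ^ j|
        ≤ C * |s| ^ J := by
  induction J generalizing f with
  | zero =>
    obtain ⟨C, hC⟩ := (hDc.prod hIc).exists_bound_of_continuousOn hf.continuousOn
    refine ⟨|C|, abs_nonneg C, fun y hy s hs => ?_⟩
    simpa using (hC (y, s) ⟨hy, hs⟩).trans (le_abs_self C)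
  | succ J ih =>
    obtain ⟨C, hC0, hC⟩ := ih (f := fun y => derivWithin (f y) I)
      (contDiffOn_derivWithin_slice hD hI hf)
    refine ⟨C, hC0, fun y hy s hs => ?_⟩
    set h : ℝ → ℝ := fun s => f y s
      - ∑ j ∈ Finset.range (J + 1), iteratedDerivWithin j (f y) I 0 / j.factorial * s ^ j with hh
    have hsub : uIcc 0 s ⊆ I := hIo.uIcc_subset h0 hs
    have hderiv : ∀ x ∈ uIcc 0 s, HasDerivWithinAt h (derivWithin (f y) I x
        - ∑ j ∈ Finset.range J, iteratedDerivWithin j (derivWithin (f y) I) I 0 / j.factorial * x ^ j)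
        (uIcc 0 s) x := by
      intro x hx
      have h1 := (hasDerivWithinAt_slice hf hy (hsub hx)).differentiableWithinAt.hasDerivWithinAt
      have h2 : HasDerivAt (fun s : ℝ => ∑ j ∈ Finset.range (J + 1),
          iteratedDerivWithin j (f y) I 0 / j.factorial * s ^ j)
          (∑ j ∈ Finset.range (J + 1),
            iteratedDerivWithin j (f y) I 0 / j.factorial * (j * x ^ (j - 1))) x :=
        HasDerivAt.fun_sum fun j _ => (hasDerivAt_pow j x).const_mul _
      refine (h1.sub h2.hasDerivWithinAt).mono hsub |>.congr_deriv ?_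
      rw [Finset.sum_range_succ']
      simp only [Nat.cast_zero, zero_mul, mul_zero, add_zero, Nat.add_sub_cancel]
      congr 1
      refine Finset.sum_congr rfl fun j _ => ?_
      rw [iteratedDerivWithin_succ', Nat.factorial_succ]
      push_cast
      field_simp
    have hbound : ∀ x ∈ uIcc 0 s, ‖derivWithin (f y) I x
        - ∑ j ∈ Finset.range J, iteratedDerivWithin j (derivWithin (f y) I) I 0 / j.factorial * x ^ j‖
        ≤ C * |s| ^ J := by
      intro x hx
      refine (hC y hy x (hsub hx)).trans ?_
      have : |x| ≤ |s| := by simpa using abs_sub_left_of_mem_uIcc hx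
      gcongr
    have := (convex_uIcc 0 s).norm_image_sub_le_of_norm_hasDerivWithin_le hderiv hbound
      left_mem_uIcc right_mem_uIcc
    have h00 : h 0 = 0 := by
      simp only [hh]
      rw [Finset.sum_range_succ']
      simp
    rw [h00, sub_zero, sub_zero] at this
    rw [pow_succ, ← mul_assoc]
    exact this

end Taylor

/-! ### Division of smooth functions -/

/-- The integrals `∫ σ^k f^{(k+1)}(σ t) dσ` form a family closed under differentiation in `t`, so
smoothness follows by an induction that treats all `k` simultaneously. -/
theorem contDiff_mean_deriv {f : ℝ → ℝ} (hf : ContDiff ℝ ∞ f) :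
    ContDiff ℝ ∞ fun t => ∫ σ in (0 : ℝ)..1, deriv f (σ * t) := by
  set F : ℕ → ℝ → ℝ → ℝ := fun k t σ => σ ^ k * iteratedDeriv (k + 1) f (σ * t) with hF
  have hc : ∀ k, Continuous (iteratedDeriv k f) := fun k =>
    hf.continuous_iteratedDeriv k (by exact_mod_cast le_top)
  have hd : ∀ k x, HasDerivAt (iteratedDeriv k f) (iteratedDeriv (k + 1) f x) x := fun k x => by
    rw [iteratedDeriv_succ]
    exact (hf.differentiable_iteratedDeriv k (by exact_mod_cast WithTop.coe_lt_top k) x).hasDerivAt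
  have hFc : ∀ k, Continuous fun z : ℝ × ℝ => F k z.1 z.2 := fun k => by
    have := hc (k + 1)
    fun_prop
  have hderiv : ∀ k t, HasDerivAt (fun t => ∫ σ in (0 : ℝ)..1, F k t σ)
      (∫ σ in (0 : ℝ)..1, F (k + 1) t σ) t := by
    intro k t
    obtain ⟨C, hC⟩ := ((isCompact_closedBall t 1).prod (isCompact_Icc (a := (0 : ℝ)) (b := 1))).exists_bound_of_continuousOn
      (hFc (k + 1)).continuousOn
    refine (intervalIntegral.hasDerivAt_integral_of_dominated_loc_of_deriv_le
      (F := F k) (F' := F (k + 1)) (x₀ := t) (bound := fun _ => C) (s := Metric.closedBall t 1)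
      (Metric.closedBall_mem_nhds t one_pos) ?_ ?_ ?_ ?_ ?_ ?_).2
    · exact Eventually.of_forall fun x =>
        ((hFc k).comp (Continuous.prodMk_right x)).aestronglyMeasurable
    · exact ((hFc k).comp (Continuous.prodMk_right t)).intervalIntegrable _ _
    · exact ((hFc (k + 1)).comp (Continuous.prodMk_right t)).aestronglyMeasurable
    · refine Eventually.of_forall fun σ hσ x hx => hC (x, σ) ⟨hx, ?_⟩
      rw [uIoc_of_le zero_le_one] at hσ
      exact Ioc_subset_Icc_self hσ
    · exact intervalIntegrable_const
    · refine Eventually.of_forall fun σ _ x _ => ?_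
      have h1 : HasDerivAt (fun x => σ * x) σ x := by simpa using (hasDerivAt_id x).const_mul σ
      refine (((hd (k + 1) (σ * x)).comp x h1).const_mul (σ ^ k)).congr_deriv ?_
      simp only [hF]
      ring
  have hn : ∀ n : ℕ, ∀ k, ContDiff ℝ n fun t => ∫ σ in (0 : ℝ)..1, F k t σ := by
    intro n
    induction n with
    | zero =>
      intro k
      exact contDiff_zero.2 (continuous_iff_continuousAt.2 fun t => (hderiv k t).continuousAt)
    | succ n ih =>
      intro k
      push_cast
      rw [contDiff_succ_iff_deriv]
      refine ⟨fun t => (hderiv k t).differentiableAt, by simp, ?_⟩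
      rw [show deriv (fun t => ∫ σ in (0 : ℝ)..1, F k t σ) = _ from funext fun t => (hderiv k t).deriv]
      exact ih (k + 1)
  have := contDiff_infty.2 fun n => hn n 0
  simpa [hF, iteratedDeriv_one] using this

theorem exists_eq_add_mul_of_contDiff {f : ℝ → ℝ} (hf : ContDiff ℝ ∞ f) :
    ∃ g : ℝ → ℝ, ContDiff ℝ ∞ g ∧ ∀ t, f t = f 0 + t * g t := by
  refine ⟨_, contDiff_mean_deriv hf, fun t => ?_⟩
  have hd : ∀ x, HasDerivAt f (deriv f x) x := fun x =>
    (hf.differentiable (by simp) x).hasDerivAt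
  have hc : Continuous (deriv f) := hf.continuous_deriv (by simp)
  have h1 : ∀ σ ∈ uIcc (0 : ℝ) 1, HasDerivAt (fun σ => f (σ * t)) (t * deriv f (σ * t)) σ := by
    intro σ _
    have h1 : HasDerivAt (fun σ => σ * t) t σ := by simpa using (hasDerivAt_id σ).mul_const t
    exact ((hd (σ * t)).comp σ h1).congr_deriv (mul_comm _ _)
  have h2 := intervalIntegral.integral_eq_sub_of_hasDerivAt h1
    (Continuous.intervalIntegrable (by fun_prop) _ _)
  rw [intervalIntegral.integral_const_mul, one_mul, zero_mul] at h2
  linarith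

theorem exists_eq_add_mul {a : ℝ} (ha : 0 < a) {f : ℝ → ℝ} (hf : ContDiffOn ℝ ∞ f (Icc (-a) a)) :
    ∃ g : ℝ → ℝ, ContDiffOn ℝ ∞ g (Icc (-a) a) ∧ ∀ t, f t = f 0 + t * g t := by
  -- A cut-off makes `f` smooth on all of `ℝ` without changing it near `0`, where alone the integral
  -- formula for the quotient is needed. Elsewhere the quotient `(f t - f 0)/t` is visibly smooth on
  -- the closed interval.
  let χ : ContDiffBump (0 : ℝ) := ⟨a / 4, a / 2, by linarith, by linarith⟩
  have hχf : ContDiff ℝ ∞ fun t => χ t * f t := by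
    rw [contDiff_iff_contDiffAt]
    intro t
    rcases lt_or_ge |t| a with h | h
    · exact χ.contDiff.contDiffAt.mul (hf.contDiffAt (Icc_mem_nhds (abs_lt.1 h).1 (abs_lt.1 h).2))
    · refine contDiffAt_const (c := (0 : ℝ)) |>.congr_of_eventuallyEq ?_
      have h1 : ∀ᶠ x in 𝓝 t, a / 2 < |x| :=
        continuous_abs.continuousAt.eventually_const_lt (by linarith)
      filter_upwards [h1] with x hx
      rw [χ.zero_of_le_dist (by simpa [Real.dist_eq] using hx.le), zero_mul]
  obtain ⟨g₀, hg₀, hfg₀⟩ := exists_eq_add_mul_of_contDiff hχf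
  have hχ1 : ∀ t, |t| ≤ a / 4 → χ t = 1 := fun t ht =>
    χ.one_of_mem_closedBall (by simpa [Real.dist_eq] using ht)
  refine ⟨fun t => if t = 0 then g₀ 0 else (f t - f 0) / t, fun t ht => ?_, fun t => ?_⟩
  · by_cases h0 : t = 0
    · subst h0
      refine (hg₀.contDiffAt (x := 0)).contDiffWithinAt.congr_of_eventuallyEq ?_ (if_pos rfl)
      have h1 : ∀ᶠ x in 𝓝 (0 : ℝ), |x| < a / 4 :=
        continuous_abs.continuousAt.eventually_lt_const (by simpa using ha)
      filter_upwards [nhdsWithin_le_nhds h1] with x hx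
      by_cases hx0 : x = 0
      · rw [if_pos hx0, hx0]
      · have h2 := hfg₀ x
        rw [hχ1 x hx.le, hχ1 0 (by rw [abs_zero]; linarith), one_mul, one_mul] at h2
        rw [if_neg hx0, h2]
        field_simp
        ring
    · have h1 : ContDiffWithinAt ℝ ∞ (fun t => (f t - f 0) / t) (Icc (-a) a) t :=
        ((hf t ht).sub contDiffWithinAt_const).div contDiffWithinAt_id h0
      refine h1.congr_of_eventuallyEq ?_ (if_neg h0)
      filter_upwards [nhdsWithin_le_nhds (isOpen_ne.mem_nhds h0)] with x hx
      exact if_neg hx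
  · by_cases h0 : t = 0
    · simp [h0]
    · simp only [if_neg h0]
      field_simp
      ring

/-- Divide by `t` one factor at a time. The bound passes to the quotient for `t ≠ 0`, and to `t = 0`
by continuity. -/
theorem exists_eq_pow_mul {a : ℝ} (ha : 0 < a) (v : ℕ) {f : ℝ → ℝ}
    (hf : ContDiffOn ℝ ∞ f (Icc (-a) a)) {C : ℝ} (hC : ∀ t ∈ Icc (-a) a, |f t| ≤ C * |t| ^ v) :
    ∃ g : ℝ → ℝ, ContDiffOn ℝ ∞ g (Icc (-a) a) ∧ ∀ t ∈ Icc (-a) a, f t = t ^ v * g t := by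
  induction v generalizing f C with
  | zero => exact ⟨f, hf, fun t _ => by simp⟩
  | succ v ih =>
    obtain ⟨g, hg, hfg⟩ := exists_eq_add_mul ha hf
    have hmem0 : (0 : ℝ) ∈ Icc (-a) a := ⟨by linarith, ha.le⟩
    have hf0 : f 0 = 0 := by
      have := hC 0 hmem0
      simpa using this
    have hg1 : ∀ t ∈ Icc (-a) a, t ≠ 0 → |g t| ≤ C * |t| ^ v := by
      intro t ht h0
      have h1 := hC t ht
      rw [hfg, hf0, zero_add, abs_mul, pow_succ] at h1
      have h2 : 0 < |t| := abs_pos.2 h0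
      refine le_of_mul_le_mul_left ?_ h2
      linarith
    have hg2 : |g 0| ≤ C * |0| ^ v := by
      have hcg : Tendsto (fun t => |g t|) (𝓝[>] 0) (𝓝 |g 0|) := by
        have h1 : ContinuousAt g 0 :=
          (hg.continuousOn 0 hmem0).continuousAt (Icc_mem_nhds (by linarith) ha)
        exact h1.abs.tendsto.mono_left nhdsWithin_le_nhds
      have hcr : Tendsto (fun t : ℝ => C * |t| ^ v) (𝓝[>] 0) (𝓝 (C * |0| ^ v)) := by
        have h1 : Continuous fun t : ℝ => C * |t| ^ v := by fun_prop
        exact h1.continuousAt.tendsto.mono_left nhdsWithin_le_nhds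
      refine le_of_tendsto_of_tendsto hcg hcr ?_
      filter_upwards [Ioc_mem_nhdsGT ha] with t ht
      exact hg1 t ⟨by linarith [ht.1], ht.2⟩ ht.1.ne'
    obtain ⟨h, hh, hgh⟩ := ih hg (C := C) fun t ht => by
      by_cases h0 : t = 0
      · rw [h0]; exact hg2
      · exact hg1 t ht h0
    refine ⟨h, hh, fun t ht => ?_⟩
    rw [hfg, hf0, zero_add, hgh t ht, pow_succ']
    ring

/-! ### Estimates for the right-hand side of the equation -/

theorem uniqueDiffOn_symm_Icc {a : ℝ} (ha : 0 < a) : UniqueDiffOn ℝ (Icc (-a) a) :=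
  uniqueDiffOn_Icc (by linarith)

theorem taylor_bound {a : ℝ} (ha : 0 < a) {f : ℝ → ℝ} (hf : ContDiffOn ℝ ∞ f (Icc (-a) a)) (J : ℕ) :
    ∃ C : ℝ, 0 ≤ C ∧ ∀ s ∈ Icc (-a) a,
      |f s - ∑ j ∈ Finset.range J, iteratedDerivWithin j f (Icc (-a) a) 0 / j.factorial * s ^ j|
        ≤ C * |s| ^ J := by
  obtain ⟨C, hC0, hC⟩ := taylor_slice_bound (D := (univ : Set PUnit.{1})) (f := fun _ => f)
    uniqueDiffOn_univ (uniqueDiffOn_symm_Icc ha) isCompact_univ isCompact_Icc ordConnected_Icc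
    ⟨by linarith, ha.le⟩ J (hf.comp contDiff_snd.contDiffOn fun z hz => hz.2)
  exact ⟨C, hC0, fun s hs => hC ⟨⟩ trivial s hs⟩

theorem mem_symm_Icc {x M : ℝ} : x ∈ Icc (-M) M ↔ |x| ≤ M := abs_le.symm

theorem abs_pow_scaled_le {p v : ℕ} (hv : v ≤ p) {η : ℝ} (hη : 0 < η) (t : ℝ) :
    |t| ^ v ≤ η ^ v * (1 + |t / η| ^ p) := by
  have h := abs_pow_le_one_add hv (t / η)
  have h2 : |t| ^ v = η ^ v * |t / η| ^ v := by
    rw [abs_div, abs_of_pos hη, div_pow, mul_div_cancel₀ _ (pow_pos hη v).ne']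
  rw [h2]
  exact mul_le_mul_of_nonneg_left h (pow_nonneg hη.le v)

namespace Equation

variable {p L : ℕ} {t₀ : ℝ} (E : Equation p L t₀)

theorem contDiff_S {t : ℝ} (ht : t ∈ Icc (-t₀) t₀) : ContDiff ℝ ∞ (E.S t) := by
  rw [← contDiffOn_univ]
  exact E.S_smooth.comp (f := fun a : ℝ => (t, a)) (contDiff_prodMk_right t).contDiffOn
    fun a _ => ⟨ht, trivial⟩

theorem iteratedDerivWithin_S {t : ℝ} (ht : t ∈ Icc (-t₀) t₀) {B : ℝ} (hB : 0 < B) (j : ℕ) :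
    iteratedDerivWithin j (E.S t) (Icc (-B) B) 0 = iteratedDeriv j (E.S t) 0 :=
  iteratedDerivWithin_eq_iteratedDeriv (uniqueDiffOn_symm_Icc hB)
    ((E.contDiff_S ht).of_le (by exact_mod_cast le_top)).contDiffAt ⟨by linarith, hB.le⟩

theorem contDiffOn_S_coeff (ht₀ : 0 < t₀) (j : ℕ) :
    ContDiffOn ℝ ∞ (fun t => iteratedDeriv j (E.S t) 0) (Icc (-t₀) t₀) :=
  (contDiffOn_iteratedDerivWithin_slice (uniqueDiffOn_symm_Icc ht₀) (uniqueDiffOn_symm_Icc one_pos)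
    ⟨by linarith, zero_le_one⟩ j (E.S_smooth.mono (prod_mono_right (subset_univ _)))).congr
    fun _ ht => (E.iteratedDerivWithin_S ht one_pos j).symm

/-- The valuation hypothesis says that the coefficient of `α^j` vanishes at `t = 0` to the order `p
+ 2 - (p-L+1) j`. The subtraction is truncated, so for large `j` this is mere boundedness. -/
theorem S_coeff_bound (ht₀ : 0 < t₀) (j : ℕ) : ∃ C : ℝ, 0 ≤ C ∧ ∀ t ∈ Icc (-t₀) t₀,
    |iteratedDeriv j (E.S t) 0| ≤ C * |t| ^ (p + 2 - (p - L + 1) * j) := by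
  have hs := E.contDiffOn_S_coeff ht₀ j
  obtain ⟨C, hC0, hC⟩ := taylor_bound ht₀ hs (p + 2 - (p - L + 1) * j)
  refine ⟨C, hC0, fun t ht => ?_⟩
  have h := hC t ht
  rw [Finset.sum_eq_zero, sub_zero] at h
  · exact h
  · intro i hi
    rw [Finset.mem_range] at hi
    rw [iteratedDerivWithin_eq_iteratedDeriv (uniqueDiffOn_symm_Icc ht₀) _ ⟨by linarith, ht₀.le⟩]
    · have := E.S_valuation i j (by omega)
      rw [this, zero_div, zero_mul]
    · exact (hs.contDiffAt (Icc_mem_nhds (by linarith) ht₀)).of_le (by exact_mod_cast le_top)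

theorem S_taylor (ht₀ : 0 < t₀) {B : ℝ} (hB : 0 < B) (J : ℕ) : ∃ C : ℝ, 0 ≤ C ∧
    ∀ t ∈ Icc (-t₀) t₀, ∀ a ∈ Icc (-B) B,
      |E.S t a - ∑ j ∈ Finset.range J, iteratedDeriv j (E.S t) 0 / j.factorial * a ^ j|
        ≤ C * |a| ^ J := by
  obtain ⟨C, hC0, hC⟩ := taylor_slice_bound (uniqueDiffOn_symm_Icc ht₀) (uniqueDiffOn_symm_Icc hB)
    isCompact_Icc isCompact_Icc ordConnected_Icc ⟨by linarith, hB.le⟩ J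
    (E.S_smooth.mono (prod_mono_right (subset_univ (Icc (-B) B))))
  refine ⟨C, hC0, fun t ht a ha => ?_⟩
  have := hC t ht a ha
  simp only [E.iteratedDerivWithin_S ht hB] at this
  exact this

/-- With `q = p-L+1`, expand the `α`-derivative of `S` at `α = 0`. For `|x| ≤ η^q M`, the term of
degree `j`, multiplied by the factor `η^q` from the chain rule, is of size `η^{q(j+1)}
|t|^{p+2-q(j+1)}`. With `t = η T` this is at most a constant times `η^{p+2} (1 + |T|^p)`, the
exponent of `T` being at most `p` because `q ≥ 2`. -/
theorem S_lipschitz (ht₀ : 0 < t₀) (hL : L < p) {M : ℝ} (hM : 0 ≤ M) : ∃ C : ℝ, 0 ≤ C ∧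
    ∀ η : ℝ, 0 < η → η ≤ 1 → ∀ t ∈ Icc (-t₀) t₀, ∀ a ∈ Icc (-M) M, ∀ a' ∈ Icc (-M) M,
      |E.S t (η ^ (p - L + 1) * a) - E.S t (η ^ (p - L + 1) * a')|
        ≤ C * η ^ (p + 2) * (1 + |t / η| ^ p) * |a - a'| := by
  set B := M + 1 with hB
  have hB0 : 0 < B := by linarith
  set I := Icc (-B) B with hI
  obtain ⟨C, hC0, hC⟩ := taylor_slice_bound (f := fun t => derivWithin (E.S t) I)
    (uniqueDiffOn_symm_Icc ht₀) (uniqueDiffOn_symm_Icc hB0)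
    isCompact_Icc isCompact_Icc ordConnected_Icc ⟨by linarith, hB0.le⟩ (p + 1)
    (contDiffOn_derivWithin_slice (uniqueDiffOn_symm_Icc ht₀) (uniqueDiffOn_symm_Icc hB0)
      (E.S_smooth.mono (prod_mono_right (subset_univ I))))
  choose c hc0 hc using fun j => E.S_coeff_bound ht₀ j
  refine ⟨C * M ^ (p + 1) + ∑ j ∈ Finset.range (p + 1), c (j + 1) * M ^ j, add_nonneg (by positivity)
    (Finset.sum_nonneg fun j _ => mul_nonneg (hc0 _) (by positivity)), ?_⟩
  intro η hη hη1 t ht a ha a' ha'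
  set q := p - L + 1 with hq
  set b := η ^ q * M with hb
  have hηq : 0 < η ^ q := pow_pos hη q
  have hηq1 : η ^ q ≤ 1 := pow_le_one₀ hη.le hη1
  have hsub : Icc (-b) b ⊆ I := by
    have : b ≤ M := mul_le_of_le_one_left hM hηq1
    exact Icc_subset_Icc (by linarith) (by linarith)
  have hmem : ∀ a ∈ Icc (-M) M, η ^ q * a ∈ Icc (-b) b := by
    intro a ha
    rw [mem_symm_Icc] at ha ⊢
    rw [abs_mul, abs_of_pos hηq]
    exact mul_le_mul_of_nonneg_left ha hηq.le
  have hderiv : ∀ x ∈ Icc (-b) b, HasDerivWithinAt (E.S t) (derivWithin (E.S t) I x) (Icc (-b) b) x :=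
    fun x hx => ((hasDerivWithinAt_slice (E.S_smooth.mono (prod_mono_right (subset_univ I))) ht
      (hsub hx)).differentiableWithinAt.hasDerivWithinAt).mono hsub
  set Y := 1 + |t / η| ^ p with hY
  have hY1 : 1 ≤ Y := le_add_of_nonneg_right (by positivity)
  have hbound : ∀ x ∈ Icc (-b) b, η ^ q * ‖derivWithin (E.S t) I x‖
      ≤ (C * M ^ (p + 1) + ∑ j ∈ Finset.range (p + 1), c (j + 1) * M ^ j) * η ^ (p + 2) * Y := by
    intro x hx
    have hxb : |x| ≤ b := abs_le.2 hx
    have h1 := hC t ht x (hsub hx)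
    rw [← hI] at h1
    simp only [← iteratedDerivWithin_succ'] at h1
    simp only [hI, E.iteratedDerivWithin_S ht hB0] at h1
    rw [← hI] at h1
    -- The expansion stops at order `p+1`: since `|x| ≤ η M`, the remainder has `p+1` factors `η`,
    -- and `η^q ≤ η` provides the last one.
    have h2 : η ^ q * (C * |x| ^ (p + 1)) ≤ C * M ^ (p + 1) * η ^ (p + 2) * Y := by
      have h3 : |x| ^ (p + 1) ≤ M ^ (p + 1) * η ^ (p + 1) := by
        refine (pow_le_pow_left₀ (abs_nonneg x) hxb _).trans ?_
        rw [hb, mul_pow, mul_comm]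
        gcongr
        exact pow_le_of_le_one hη.le hη1 (by omega)
      have h4 : η ^ q ≤ η := pow_le_of_le_one hη.le hη1 (by omega)
      calc η ^ q * (C * |x| ^ (p + 1)) ≤ η * (C * (M ^ (p + 1) * η ^ (p + 1))) := by gcongr
        _ = C * M ^ (p + 1) * η ^ (p + 2) * 1 := by ring
        _ ≤ _ := by gcongr
    have h5 : ∀ j ∈ Finset.range (p + 1),
        η ^ q * |iteratedDeriv (j + 1) (E.S t) 0 / j.factorial * x ^ j|
          ≤ c (j + 1) * M ^ j * (η ^ (p + 2) * Y) := by
      intro j _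
      rw [abs_mul, abs_div, Nat.abs_cast, abs_pow]
      have h6 : |iteratedDeriv (j + 1) (E.S t) 0| / j.factorial
          ≤ c (j + 1) * (η ^ (p + 2 - q * (j + 1)) * Y) := by
        refine (div_le_self (abs_nonneg _) (by exact_mod_cast Nat.one_le_iff_ne_zero.2 (Nat.factorial_ne_zero j))).trans ?_
        refine (hc (j + 1) t ht).trans (mul_le_mul_of_nonneg_left ?_ (hc0 _))
        refine abs_pow_scaled_le ?_ hη t
        have : q * (j + 1) ≥ q * 1 := Nat.mul_le_mul_left q (by omega)
        omega
      have h7 : |x| ^ j ≤ η ^ (q * j) * M ^ j := by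
        rw [pow_mul, ← mul_pow]
        exact pow_le_pow_left₀ (abs_nonneg x) hxb j
      have h8 : η ^ q * (η ^ (p + 2 - q * (j + 1)) * η ^ (q * j)) ≤ η ^ (p + 2) := by
        rw [← pow_add, ← pow_add]
        refine pow_le_pow_of_le_one hη.le hη1 ?_
        have : q * (j + 1) = q * j + q := by ring
        omega
      calc η ^ q * (|iteratedDeriv (j + 1) (E.S t) 0| / j.factorial * |x| ^ j)
          ≤ η ^ q * (c (j + 1) * (η ^ (p + 2 - q * (j + 1)) * Y) * (η ^ (q * j) * M ^ j)) := by
            have := hc0 (j + 1)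
            gcongr
        _ = c (j + 1) * M ^ j * (η ^ q * (η ^ (p + 2 - q * (j + 1)) * η ^ (q * j)) * Y) := by ring
        _ ≤ c (j + 1) * M ^ j * (η ^ (p + 2) * Y) := by
            have := hc0 (j + 1)
            gcongr
    have h9 : η ^ q * |∑ j ∈ Finset.range (p + 1), iteratedDeriv (j + 1) (E.S t) 0 / j.factorial * x ^ j|
        ≤ (∑ j ∈ Finset.range (p + 1), c (j + 1) * M ^ j) * (η ^ (p + 2) * Y) := by
      rw [Finset.sum_mul]
      refine le_trans (mul_le_mul_of_nonneg_left (Finset.abs_sum_le_sum_abs _ _) hηq.le) ?_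
      rw [Finset.mul_sum]
      exact Finset.sum_le_sum h5
    have h10 := abs_add_le (derivWithin (E.S t) I x - ∑ j ∈ Finset.range (p + 1),
      iteratedDeriv (j + 1) (E.S t) 0 / j.factorial * x ^ j)
      (∑ j ∈ Finset.range (p + 1), iteratedDeriv (j + 1) (E.S t) 0 / j.factorial * x ^ j)
    rw [sub_add_cancel] at h10
    rw [Real.norm_eq_abs]
    have h11 := mul_le_mul_of_nonneg_left h10 hηq.le
    have h12 := mul_le_mul_of_nonneg_left h1 hηq.le
    linarith
  have hmv := (convex_Icc (-b) b).norm_image_sub_le_of_norm_hasDerivWithin_le hderiv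
    (fun x hx => (le_div_iff₀' hηq).2 (hbound x hx)) (hmem a' ha') (hmem a ha)
  rw [← mul_sub, norm_mul, Real.norm_eq_abs, Real.norm_eq_abs, Real.norm_eq_abs, abs_of_pos hηq,
    ← mul_assoc, div_mul_cancel₀ _ hηq.ne'] at hmv
  exact hmv

theorem P_bounds {B δ : ℝ} (hδ : δ < E.η₀) : ∃ C : ℝ, 0 ≤ C ∧
    ∀ t ∈ Icc (-t₀) t₀, ∀ x ∈ Icc (-B) B, ∀ a ∈ Icc (-B) B, ∀ η ∈ Icc 0 δ, |E.P t x a η| ≤ C ∧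
      ∀ x' ∈ Icc (-B) B, ∀ a' ∈ Icc (-B) B,
        |E.P t x a η - E.P t x' a' η| ≤ C * (|x - x'| + |a - a'|) := by
  set D : Set (ℝ × ℝ × ℝ × ℝ) := Icc (-t₀) t₀ ×ˢ Icc (-B) B ×ˢ Icc (-B) B ×ˢ Icc 0 δ with hD
  have hDc : IsCompact D := isCompact_Icc.prod (isCompact_Icc.prod (isCompact_Icc.prod isCompact_Icc))
  have hDv : Convex ℝ D := (convex_Icc _ _).prod ((convex_Icc _ _).prod ((convex_Icc _ _).prod (convex_Icc _ _)))
  have hP : ContDiffOn ℝ ∞ (fun x : ℝ × ℝ × ℝ × ℝ => E.P x.1 x.2.1 x.2.2.1 x.2.2.2) D :=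
    E.P_smooth.mono (prod_mono_right (prod_mono (subset_univ _) (prod_mono (subset_univ _)
      fun η hη => ⟨hη.1, hη.2.trans_lt hδ⟩)))
  obtain ⟨C₁, hC₁⟩ := hDc.exists_bound_of_continuousOn hP.continuousOn
  obtain ⟨K, hK⟩ := hP.exists_lipschitzOnWith (by simp) hDv hDc
  refine ⟨max |C₁| K, (abs_nonneg _).trans (le_max_left _ _), fun t ht x hx a ha η hη =>
    ⟨(hC₁ (t, x, a, η) ⟨ht, hx, ha, hη⟩).trans ((le_abs_self _).trans (le_max_left _ _)),
    fun x' hx' a' ha' => ?_⟩⟩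
  have h := hK.dist_le_mul (t, x, a, η) ⟨ht, hx, ha, hη⟩ (t, x', a', η) ⟨ht, hx', ha', hη⟩
  rw [Real.dist_eq] at h
  refine h.trans (mul_le_mul (le_max_right _ _) ?_ dist_nonneg ((abs_nonneg _).trans (le_max_left _ _)))
  simp only [Prod.dist_eq, dist_self, Real.dist_eq]
  have h1 := abs_nonneg (x - x')
  have h2 := abs_nonneg (a - a')
  simp only [max_le_iff]
  refine ⟨by linarith, by linarith, by linarith, by linarith⟩

/-- The part of the right-hand side of the rescaled equation that is a perturbation:
`η^{-(p+1)} S(t, η^{p-L+1} α) + P(t, η x, η^{p-L+1} β, η)`. -/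
def rhs (η β x α t : ℝ) : ℝ :=
  E.S t (η ^ (p - L + 1) * α) / η ^ (p + 1) + E.P t (η * x) (η ^ (p - L + 1) * β) η

/-- Division by `η^{p+1}` and the substitution `t = η (t/η)` bring the problem to the normal form of
the a priori estimates. -/
theorem solvesAux_iff (hL : L < p) {η β α : ℝ} {v w : ℝ → ℝ} (hη : 0 < η) :
    E.SolvesAux η β v α w ↔ (∀ t ∈ Icc (-t₀) t₀, HasDerivWithinAt w
      (((p + 1) * (t / η) ^ p * w t + α * (t / η) ^ L + E.rhs η β (v t) α t) / η)
      (Icc (-t₀) t₀) t) ∧ w (-t₀) = 0 ∧ w t₀ = 0 := by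
  have hη2 : η ^ (p + 2) ≠ 0 := (pow_pos hη _).ne'
  have key : ∀ t, η ^ (p + 2) *
      (((p + 1) * (t / η) ^ p * w t + α * (t / η) ^ L + E.rhs η β (v t) α t) / η)
      = (p + 1) * η * t ^ p * w t + η ^ (p - L + 1) * α * t ^ L + E.S t (η ^ (p - L + 1) * α)
        + η ^ (p + 1) * E.P t (η * v t) (η ^ (p - L + 1) * β) η := by
    intro t
    have h1 : η ^ (p + 1) = η ^ (p - L + 1) * η ^ L := by rw [← pow_add]; congr 1; omega
    have h2 : η ^ (p + 2) = η ^ (p + 1) * η := pow_succ _ _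
    have h3 : η ^ (p + 1) * (t / η) ^ p = η * t ^ p := by
      rw [div_pow, pow_succ]; field_simp
    have h4 : η ^ (p + 1) * (t / η) ^ L = η ^ (p - L + 1) * t ^ L := by
      rw [h1, div_pow]; field_simp
    have h5 : η ^ (p + 1) * (E.S t (η ^ (p - L + 1) * α) / η ^ (p + 1))
        = E.S t (η ^ (p - L + 1) * α) := mul_div_cancel₀ _ (pow_pos hη _).ne'
    rw [h2, mul_assoc, mul_div_cancel₀ _ hη.ne', rhs]
    linear_combination ((p + 1) * w t) * h3 + α * h4 + h5
  unfold SolvesAux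
  refine and_congr_left fun _ => forall₂_congr fun t _ => ⟨fun h => ?_, fun h => ?_⟩
  · have h1 := h.const_mul (η ^ (p + 2))⁻¹
    refine (h1.congr_deriv ?_).congr_of_eventuallyEq (Eventually.of_forall fun s => ?_) ?_
    · rw [← key, inv_mul_cancel_left₀ hη2]
    · simp only [inv_mul_cancel_left₀ hη2]
    · simp only [inv_mul_cancel_left₀ hη2]
  · exact (h.const_mul (η ^ (p + 2))).congr_deriv (key t)

theorem eventually_small {δ : ℝ} (hδ : 0 < δ) : ∀ᶠ η in 𝓝[>] (0 : ℝ), 0 < η ∧ η ≤ δ :=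
  mem_of_superset (Ioc_mem_nhdsGT hδ) fun _ hx => hx

/-- The factor `η` in the Lipschitz constant drives contraction, uniqueness and gain of a power
alike. It comes from the valuation of `S` for `α`, and from the arguments `η x` and `η^{p-L+1} β` of
`P` for the rest. At `α = 0` the term `S` disappears, which leaves a bound without weight. -/
theorem rhs_bounds (ht₀ : 0 < t₀) (hL : L < p) {M : ℝ} (hM : 0 ≤ M) : ∃ C : ℝ, 0 ≤ C ∧
    ∀ᶠ η in 𝓝[>] (0 : ℝ), ∀ t ∈ Icc (-t₀) t₀, ∀ β ∈ Icc (-M) M, ∀ x ∈ Icc (-M) M,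
      |E.rhs η β x 0 t| ≤ C ∧ ∀ α ∈ Icc (-M) M, ∀ β' ∈ Icc (-M) M, ∀ x' ∈ Icc (-M) M,
      ∀ α' ∈ Icc (-M) M, |E.rhs η β x α t - E.rhs η β' x' α' t|
        ≤ C * η * (|α - α'| + |β - β'| + |x - x'|) * (1 + |t / η| ^ p) := by
  obtain ⟨C₁, hC₁0, hC₁⟩ := E.S_lipschitz ht₀ hL hM
  obtain ⟨C₂, hC₂0, hC₂⟩ := E.P_bounds (B := M) (δ := E.η₀ / 2) (by linarith [E.η₀_pos])
  refine ⟨C₁ + C₂, by positivity, ?_⟩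
  filter_upwards [eventually_small one_pos, eventually_small (half_pos E.η₀_pos)]
    with η ⟨hη, hη1⟩ ⟨_, hηδ⟩ t ht β hβ x hx
  have hqle : η ^ (p - L + 1) ≤ η := pow_le_of_le_one hη.le hη1 (by omega)
  have hq0 : 0 < η ^ (p - L + 1) := pow_pos hη _
  have hm1 : ∀ x ∈ Icc (-M) M, η * x ∈ Icc (-M) M := by
    intro x hx
    rw [mem_symm_Icc] at hx ⊢
    rw [abs_mul, abs_of_pos hη]
    exact (mul_le_of_le_one_left (abs_nonneg x) hη1).trans hx
  have hm2 : ∀ x ∈ Icc (-M) M, η ^ (p - L + 1) * x ∈ Icc (-M) M := by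
    intro x hx
    rw [mem_symm_Icc] at hx ⊢
    rw [abs_mul, abs_of_pos hq0]
    exact (mul_le_of_le_one_left (abs_nonneg x) (hqle.trans hη1)).trans hx
  have hP := hC₂ t ht _ (hm1 x hx) _ (hm2 β hβ) η ⟨hη.le, hηδ⟩
  refine ⟨?_, fun α hα β' hβ' x' hx' α' hα' => ?_⟩
  · rw [rhs, mul_zero, E.S_zero t ht, zero_div, zero_add]
    exact hP.1.trans (by linarith)
  · have h1 := hC₁ η hη hη1 t ht α hα α' hα'
    have h2 := hP.2 _ (hm1 x' hx') _ (hm2 β' hβ')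
    set Y := 1 + |t / η| ^ p
    have hY1 : 1 ≤ Y := le_add_of_nonneg_right (by positivity)
    have h3 : |E.S t (η ^ (p - L + 1) * α) / η ^ (p + 1) - E.S t (η ^ (p - L + 1) * α') / η ^ (p + 1)|
        ≤ C₁ * η * |α - α'| * Y := by
      rw [← sub_div, abs_div, abs_of_pos (pow_pos hη _), div_le_iff₀ (pow_pos hη _)]
      refine h1.trans_eq ?_
      ring
    have h4 : |E.P t (η * x) (η ^ (p - L + 1) * β) η - E.P t (η * x') (η ^ (p - L + 1) * β') η|
        ≤ C₂ * η * (|β - β'| + |x - x'|) * Y := by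
      rw [← mul_sub, ← mul_sub, abs_mul, abs_mul, abs_of_pos hη, abs_of_pos hq0] at h2
      calc _ ≤ C₂ * (η * |x - x'| + η ^ (p - L + 1) * |β - β'|) := h2
        _ ≤ C₂ * (η * |x - x'| + η * |β - β'|) := by gcongr
        _ = C₂ * η * (|β - β'| + |x - x'|) * 1 := by ring
        _ ≤ _ := by gcongr
    have h5 : E.rhs η β x α t - E.rhs η β' x' α' t
        = (E.S t (η ^ (p - L + 1) * α) / η ^ (p + 1) - E.S t (η ^ (p - L + 1) * α') / η ^ (p + 1))
          + (E.P t (η * x) (η ^ (p - L + 1) * β) η - E.P t (η * x') (η ^ (p - L + 1) * β') η) := by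
      unfold rhs; ring
    rw [h5]
    refine (abs_add_le _ _).trans ((add_le_add h3 h4).trans ?_)
    have h6 : 0 ≤ C₁ * η * (|β - β'| + |x - x'|) * Y := by positivity
    have h7 : 0 ≤ C₂ * η * |α - α'| * Y := by positivity
    linarith

end Equation

/-! ### Bounded families of solutions -/

/-- A family `(α_η, u_η)` is bounded, uniformly for small `η > 0`. -/
def BoundedFamily (t₀ : ℝ) (α : ℝ → ℝ) (u : ℝ → ℝ → ℝ) : Prop :=
  ∃ M : ℝ, ∀ᶠ η in 𝓝[>] 0, |α η| ≤ M ∧ ∀ t ∈ Icc (-t₀) t₀, |u η t| ≤ M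

/-- The families `(α_η, u_η)` and `(α'_η, u'_η)` differ by `O(η^m)`, uniformly on the compact
subsets of `(-t₀, t₀)`. -/
def Close (t₀ : ℝ) (m : ℕ) (α : ℝ → ℝ) (u : ℝ → ℝ → ℝ) (α' : ℝ → ℝ) (u' : ℝ → ℝ → ℝ) : Prop :=
  (∃ C : ℝ, ∀ᶠ η in 𝓝[>] 0, |α η - α' η| ≤ C * η ^ m) ∧
  ∀ r : ℝ, 0 < r → r < t₀ →
    ∃ C : ℝ, ∀ᶠ η in 𝓝[>] 0, ∀ t ∈ Icc (-r) r, |u η t - u' η t| ≤ C * η ^ m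

section Close

variable {t₀ : ℝ} {m : ℕ} {α α' α'' : ℝ → ℝ} {u u' u'' : ℝ → ℝ → ℝ}

theorem Close.symm (h : Close t₀ m α u α' u') : Close t₀ m α' u' α u := by
  refine ⟨?_, fun r hr hrt => ?_⟩
  · obtain ⟨C, hC⟩ := h.1
    exact ⟨C, hC.mono fun η h => by rwa [abs_sub_comm]⟩
  · obtain ⟨C, hC⟩ := h.2 r hr hrt
    exact ⟨C, hC.mono fun η h t ht => by rw [abs_sub_comm]; exact h t ht⟩

theorem Close.trans (h : Close t₀ m α u α' u') (h' : Close t₀ m α' u' α'' u'') :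
    Close t₀ m α u α'' u'' := by
  refine ⟨?_, fun r hr hrt => ?_⟩
  · obtain ⟨C, hC⟩ := h.1
    obtain ⟨C', hC'⟩ := h'.1
    refine ⟨C + C', ?_⟩
    filter_upwards [hC, hC'] with η h1 h2
    have := abs_sub_le (α η) (α' η) (α'' η)
    linarith
  · obtain ⟨C, hC⟩ := h.2 r hr hrt
    obtain ⟨C', hC'⟩ := h'.2 r hr hrt
    refine ⟨C + C', ?_⟩
    filter_upwards [hC, hC'] with η h1 h2 t ht
    have := abs_sub_le (u η t) (u' η t) (u'' η t)
    have := h1 t ht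
    have := h2 t ht
    linarith

theorem Close.mono {n : ℕ} (hnm : n ≤ m) (h : Close t₀ m α u α' u') : Close t₀ n α u α' u' := by
  have key : ∀ η C x : ℝ, 0 < η → η ≤ 1 → x ≤ C * η ^ m → x ≤ |C| * η ^ n := by
    intro η C x hη hη1 hx
    refine hx.trans (mul_le_mul (le_abs_self C) (pow_le_pow_of_le_one hη.le hη1 hnm)
      (pow_nonneg hη.le m) (abs_nonneg C))
  refine ⟨?_, fun r hr hrt => ?_⟩
  · obtain ⟨C, hC⟩ := h.1
    refine ⟨|C|, ?_⟩
    filter_upwards [hC, Equation.eventually_small one_pos] with η h ⟨h1, h2⟩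
    exact key η C _ h1 h2 h
  · obtain ⟨C, hC⟩ := h.2 r hr hrt
    refine ⟨|C|, ?_⟩
    filter_upwards [hC, Equation.eventually_small one_pos] with η h ⟨h1, h2⟩ t ht
    exact key η C _ h1 h2 (h t ht)

theorem BoundedFamily.close_zero (h : BoundedFamily t₀ α u) (h' : BoundedFamily t₀ α' u') :
    Close t₀ 0 α u α' u' := by
  obtain ⟨M, hM⟩ := h
  obtain ⟨M', hM'⟩ := h'
  refine ⟨⟨M + M', ?_⟩, fun r hr hrt => ⟨M + M', ?_⟩⟩
  · filter_upwards [hM, hM'] with η h1 h2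
    have := abs_sub (α η) (α' η)
    rw [pow_zero, mul_one]
    linarith [h1.1, h2.1]
  · filter_upwards [hM, hM'] with η h1 h2 t ht
    have := abs_sub (u η t) (u' η t)
    have ht' : t ∈ Icc (-t₀) t₀ := ⟨by linarith [ht.1], by linarith [ht.2]⟩
    rw [pow_zero, mul_one]
    linarith [h1.2 t ht', h2.2 t ht']

theorem BoundedFamily.exists_nonneg (h : BoundedFamily t₀ α u) :
    ∃ M : ℝ, 0 ≤ M ∧ ∀ᶠ η in 𝓝[>] 0, |α η| ≤ M ∧ ∀ t ∈ Icc (-t₀) t₀, |u η t| ≤ M := by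
  obtain ⟨M, hM⟩ := h
  exact ⟨|M|, abs_nonneg M, hM.mono fun η h =>
    ⟨h.1.trans (le_abs_self M), fun t ht => (h.2 t ht).trans (le_abs_self M)⟩⟩

end Close

theorem eventually_mul_le {c ε : ℝ} (hε : 0 < ε) : ∀ᶠ η in 𝓝[>] (0 : ℝ), c * η ≤ ε := by
  have : Tendsto (fun η : ℝ => c * η) (𝓝[>] 0) (𝓝 (c * 0)) :=
    (tendsto_id.const_mul _).mono_left nhdsWithin_le_nhds
  rw [mul_zero] at this
  exact this.eventually_le_const hε

section Families

variable {p L : ℕ} (hp : Odd p) (hLe : Even L) (hL : L < p) {t₀ : ℝ} (ht₀ : 0 < t₀)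
include hp hLe hL ht₀

theorem exists_bounded_family {N : ℝ → ℝ → ℝ → ℝ → ℝ}
    (h0 : ∃ C : ℝ, ∀ᶠ η in 𝓝[>] (0 : ℝ), ∀ t ∈ Icc (-t₀) t₀, |N η t 0 0| ≤ C)
    (h1 : ∀ M : ℝ, 0 ≤ M → ∃ C : ℝ, 0 ≤ C ∧ ∀ᶠ η in 𝓝[>] (0 : ℝ), ∀ t ∈ Icc (-t₀) t₀,
      ∀ a ∈ Icc (-M) M, ∀ a' ∈ Icc (-M) M, ∀ w ∈ Icc (-M) M, ∀ w' ∈ Icc (-M) M,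
        |N η t a w - N η t a' w'| ≤ C * η * (|a - a'| + |w - w'|) * (1 + |t / η| ^ p))
    (h2 : ∀ᶠ η in 𝓝[>] (0 : ℝ), ContinuousOn (fun z : ℝ × ℝ × ℝ => N η z.1 z.2.1 z.2.2)
      (Icc (-t₀) t₀ ×ˢ univ)) :
    ∃ (α : ℝ → ℝ) (w : ℝ → ℝ → ℝ), BoundedFamily t₀ α w ∧ ∀ᶠ η in 𝓝[>] (0 : ℝ),
      (∀ t ∈ Icc (-t₀) t₀, HasDerivWithinAt (w η)
        (((p + 1) * (t / η) ^ p * w η t + α η * (t / η) ^ L + N η t (α η) (w η t)) / η)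
        (Icc (-t₀) t₀) t) ∧ w η (-t₀) = 0 ∧ w η t₀ = 0 := by
  obtain ⟨A, hA1, hA⟩ := exists_bvp_solution hp hLe hL
  obtain ⟨C₀, hC₀⟩ := h0
  -- The radius is fixed first, from the size of the forcing at zero. The Lipschitz constant `C η`
  -- on that ball is then made small by the choice of `η`, and the margin `1` pays for the term `2 C
  -- η M`.
  set M := A * |C₀| + 1 with hM
  have hM0 : 0 ≤ M := by positivity
  obtain ⟨C, hC, hCl⟩ := h1 M hM0
  have hev : ∀ᶠ η in 𝓝[>] (0 : ℝ), ∃ (a : ℝ) (w : ℝ → ℝ), (|a| ≤ M ∧ ∀ t ∈ Icc (-t₀) t₀, |w t| ≤ M) ∧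
      (∀ t ∈ Icc (-t₀) t₀, HasDerivWithinAt w
        (((p + 1) * (t / η) ^ p * w t + a * (t / η) ^ L + N η t a (w t)) / η)
        (Icc (-t₀) t₀) t) ∧ w (-t₀) = 0 ∧ w t₀ = 0 := by
    filter_upwards [hC₀, hCl, h2, Equation.eventually_small ht₀,
      eventually_mul_le (c := A * (2 * C * M)) one_pos,
      eventually_mul_le (c := A * C) (ε := 1 / 4) (by norm_num)] with η h3 h4 h5 ⟨h6, h7⟩ h8 h9
    obtain ⟨a, w, ha, hw, hd, hw1, hw2⟩ := hA t₀ η M |C₀| (C * η) (N η) h6 h7 hM0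
      (h5.mono (prod_mono_right (subset_univ _)))
      (fun t ht => ((h3 t ht).trans (le_abs_self _)).trans
        (le_mul_of_one_le_right (abs_nonneg _) (le_add_of_nonneg_right (by positivity))))
      h4 (by positivity) (by rw [hM] at h8 ⊢; linarith) (by linarith)
    exact ⟨a, w, ⟨ha, hw⟩, hd, hw2, hw1⟩
  choose! α w hαw using fun η (h : ∃ (a : ℝ) (w : ℝ → ℝ), (|a| ≤ M ∧ ∀ t ∈ Icc (-t₀) t₀, |w t| ≤ M) ∧
      (∀ t ∈ Icc (-t₀) t₀, HasDerivWithinAt w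
        (((p + 1) * (t / η) ^ p * w t + a * (t / η) ^ L + N η t a (w t)) / η)
        (Icc (-t₀) t₀) t) ∧ w (-t₀) = 0 ∧ w t₀ = 0) => h
  exact ⟨α, w, ⟨M, hev.mono fun η h => (hαw η h).1⟩, hev.mono fun η h => (hαw η h).2⟩

theorem sameFamily_of_forcing {α α' : ℝ → ℝ} {w w' f f' : ℝ → ℝ → ℝ} {C : ℝ} (hC : 0 ≤ C)
    (hw : ∀ᶠ η in 𝓝[>] (0 : ℝ), (∀ t ∈ Icc (-t₀) t₀, HasDerivWithinAt (w η)
        (((p + 1) * (t / η) ^ p * w η t + α η * (t / η) ^ L + f η t) / η)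
        (Icc (-t₀) t₀) t) ∧ w η (-t₀) = 0 ∧ w η t₀ = 0)
    (hw' : ∀ᶠ η in 𝓝[>] (0 : ℝ), (∀ t ∈ Icc (-t₀) t₀, HasDerivWithinAt (w' η)
        (((p + 1) * (t / η) ^ p * w' η t + α' η * (t / η) ^ L + f' η t) / η)
        (Icc (-t₀) t₀) t) ∧ w' η (-t₀) = 0 ∧ w' η t₀ = 0)
    (hf : ∀ᶠ η in 𝓝[>] (0 : ℝ), ∀ t ∈ Icc (-t₀) t₀, |f η t - f' η t|
      ≤ C * η * (|α η - α' η| + |w η t - w' η t|) * (1 + |t / η| ^ p)) :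
    SameFamily t₀ α w α' w' := by
  obtain ⟨A, hA1, hA⟩ := bvp_solution_unique hp hLe hL
  filter_upwards [hw, hw', hf, Equation.eventually_small ht₀,
    eventually_mul_le (c := A * C) (ε := 1 / 4) (by norm_num)] with η h1 h2 h3 ⟨h4, h5⟩ h6
  refine hA t₀ η (C * η) (α η) (α' η) (w η) (w' η) (fun t => f η t - f' η t) h4 h5 h3
    (fun t ht => ((h1.1 t ht).sub (h2.1 t ht)).congr_deriv (by ring)) (by rw [h1.2.2, h2.2.2])
    (by rw [h1.2.1, h2.2.1]) (by positivity) (by linarith)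

/-- Comparison of a bounded family of solutions with a bounded family of approximate solutions. -/
theorem close_of_residual {α α' : ℝ → ℝ} {w d f : ℝ → ℝ → ℝ} (m : ℕ)
    (hwb : BoundedFamily t₀ α w) (hdb : BoundedFamily t₀ α' d)
    (hw : ∀ᶠ η in 𝓝[>] (0 : ℝ), ∀ t ∈ Icc (-t₀) t₀, HasDerivWithinAt (w η)
        (((p + 1) * (t / η) ^ p * w η t + α η * (t / η) ^ L + f η t) / η) (Icc (-t₀) t₀) t)
    (hd : ∀ r : ℝ, 0 < r → r < t₀ → ∃ C : ℝ, ∀ᶠ η in 𝓝[>] (0 : ℝ), ∀ t ∈ Icc (-r) r,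
      ∃ D, HasDerivWithinAt (d η) D (Icc (-t₀) t₀) t ∧
        |η * D - ((p + 1) * (t / η) ^ p * d η t + α' η * (t / η) ^ L + f η t)|
          ≤ C * (η * |α η - α' η| + η ^ m) * (1 + |t / η| ^ p)) :
    Close t₀ m α w α' d := by
  obtain ⟨M, hM⟩ := hwb
  obtain ⟨M', hM'⟩ := hdb
  have key : ∀ r : ℝ, 0 < r → r < t₀ → ∃ C', ∀ᶠ η in 𝓝[>] (0 : ℝ), |α η - α' η| ≤ C' * η ^ m ∧
      ∀ t ∈ Icc (-r) r, |w η t - d η t| ≤ C' * η ^ m := by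
    intro r hr hrt
    -- The approximate family need not satisfy the boundary conditions and its residual is
    -- controlled only in the interior. An intermediate interval leaves room for its boundary values
    -- to decay.
    obtain ⟨C, hC⟩ := hd ((r + t₀) / 2) (by linarith) (by linarith)
    refine family_estimate hp hLe hL hr (by linarith : r < (r + t₀) / 2) m (M := M + M') (C := C)
      (δ := fun η => α η - α' η) (d := fun η t => w η t - d η t) ?_
    filter_upwards [hw, hM, hM', hC, Equation.eventually_small one_pos] with η h1 h2 h3 h4 ⟨h5, _⟩ t ht
    have hsub : Icc (-((r + t₀) / 2)) ((r + t₀) / 2) ⊆ Icc (-t₀) t₀ :=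
      Icc_subset_Icc (by linarith) (by linarith)
    have ht' := hsub ht
    refine ⟨(abs_sub _ _).trans (add_le_add (h2.2 t ht') (h3.2 t ht')), ?_⟩
    obtain ⟨D, hD, hD2⟩ := h4 t ht
    refine ⟨_, ((h1 t ht').sub hD).mono hsub, ?_⟩
    rw [mul_sub, mul_div_cancel₀ _ h5.ne', ← abs_neg]
    refine (le_of_eq ?_).trans hD2
    congr 1
    ring
  refine ⟨?_, fun r hr hrt => ?_⟩
  · obtain ⟨C, hC⟩ := key (t₀ / 2) (by linarith) (by linarith)
    exact ⟨C, hC.mono fun η h => h.1⟩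
  · obtain ⟨C, hC⟩ := key r hr hrt
    exact ⟨C, hC.mono fun η h => h.2⟩

end Families

/-! ### Images under `Ξ_η` and canard solutions: existence, uniqueness, comparison -/

namespace Equation

variable {p L : ℕ} (hp : Odd p) (hLe : Even L) (hL : L < p) {t₀ : ℝ} (ht₀ : 0 < t₀)
  (E : Equation p L t₀)

theorem rhs_continuousOn {η : ℝ} (hη : 0 < η) (hη0 : η < E.η₀) :
    ContinuousOn (fun z : ℝ × ℝ × ℝ × ℝ => E.rhs η z.1 z.2.1 z.2.2.1 z.2.2.2)
      (univ ×ˢ univ ×ˢ univ ×ˢ Icc (-t₀) t₀) := by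
  unfold rhs
  refine ContinuousOn.add (ContinuousOn.div_const ?_ _) ?_
  · exact E.S_smooth.continuousOn.comp
      (f := fun z : ℝ × ℝ × ℝ × ℝ => (z.2.2.2, η ^ (p - L + 1) * z.2.2.1)) (by fun_prop)
      fun z hz => ⟨hz.2.2.2, trivial⟩
  · exact E.P_smooth.continuousOn.comp
      (f := fun z : ℝ × ℝ × ℝ × ℝ => (z.2.2.2, η * z.2.1, η ^ (p - L + 1) * z.1, η)) (by fun_prop)
      fun z hz => ⟨hz.2.2.2, trivial, trivial, hη.le, hη0⟩

include hp hLe hL ht₀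

theorem exists_xiImage {β : ℝ → ℝ} {v : ℝ → ℝ → ℝ} (hb : BoundedFamily t₀ β v)
    (hc : ∀ᶠ η in 𝓝[>] (0 : ℝ), ContinuousOn (v η) (Icc (-t₀) t₀)) :
    ∃ (α : ℝ → ℝ) (w : ℝ → ℝ → ℝ), E.IsXiImage β v α w := by
  obtain ⟨B, hB0, hB⟩ := hb.exists_nonneg
  have key := exists_bounded_family hp hLe hL ht₀
    (N := fun η t a _ => E.rhs η (β η) (v η t) a t) ?_ ?_ ?_
  · obtain ⟨α, w, hαw, hs⟩ := key
    refine ⟨α, w, hαw, ?_⟩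
    filter_upwards [hs, eventually_small one_pos] with η h1 ⟨h2, _⟩
    exact (E.solvesAux_iff hL h2).2 h1
  · obtain ⟨C, _, hC⟩ := E.rhs_bounds ht₀ hL hB0
    refine ⟨C, ?_⟩
    filter_upwards [hC, hB] with η h1 h2 t ht
    exact (h1 t ht _ (mem_symm_Icc.2 h2.1) _ (mem_symm_Icc.2 (h2.2 t ht))).1
  · intro M hM
    obtain ⟨C, hC0, hC⟩ := E.rhs_bounds ht₀ hL (le_max_of_le_left hM : 0 ≤ max M B)
    refine ⟨C, hC0, ?_⟩
    have hsub : Icc (-M) M ⊆ Icc (-max M B) (max M B) :=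
      Icc_subset_Icc (neg_le_neg (le_max_left _ _)) (le_max_left _ _)
    filter_upwards [hC, hB, eventually_small one_pos] with η h1 h2 ⟨h3, _⟩ t ht a ha a' ha' w hw w' hw'
    have hβ := mem_symm_Icc.2 (h2.1.trans (le_max_right M B))
    have hv := mem_symm_Icc.2 ((h2.2 t ht).trans (le_max_right M B))
    refine ((h1 t ht _ hβ _ hv).2 a (hsub ha) _ hβ _ hv a' (hsub ha')).trans ?_
    rw [sub_self, sub_self, abs_zero, add_zero, add_zero]
    have := abs_nonneg (w - w')
    gcongr
    linarith
  · filter_upwards [hc, eventually_small (half_pos E.η₀_pos)] with η h1 ⟨h2, h3⟩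
    refine (E.rhs_continuousOn h2 (by linarith [E.η₀_pos])).comp
      (f := fun z : ℝ × ℝ × ℝ => (β η, v η z.1, z.2.1, z.1)) ?_
      fun z hz => ⟨trivial, trivial, trivial, hz.1⟩
    have : ContinuousOn (fun z : ℝ × ℝ × ℝ => v η z.1) (Icc (-t₀) t₀ ×ˢ univ) :=
      h1.comp continuousOn_fst fun z hz => hz.1
    exact continuousOn_const.prodMk (this.prodMk (by fun_prop))

theorem xiImage_sameFamily {β : ℝ → ℝ} {v : ℝ → ℝ → ℝ} (hb : BoundedFamily t₀ β v)
    {α α' : ℝ → ℝ} {w w' : ℝ → ℝ → ℝ} (h : E.IsXiImage β v α w) (h' : E.IsXiImage β v α' w') :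
    SameFamily t₀ α w α' w' := by
  obtain ⟨B, hB0, hB⟩ := hb.exists_nonneg
  obtain ⟨M, hM0, hM⟩ := BoundedFamily.exists_nonneg h.1
  obtain ⟨M', hM'0, hM'⟩ := BoundedFamily.exists_nonneg h'.1
  obtain ⟨C, hC0, hC⟩ := E.rhs_bounds ht₀ hL (by positivity : 0 ≤ B + M + M')
  refine sameFamily_of_forcing hp hLe hL ht₀ hC0
    (f := fun η t => E.rhs η (β η) (v η t) (α η) t) (f' := fun η t => E.rhs η (β η) (v η t) (α' η) t)
    ?_ ?_ ?_
  · filter_upwards [h.2, eventually_small one_pos] with η h1 ⟨h2, _⟩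
    exact (E.solvesAux_iff hL h2).1 h1
  · filter_upwards [h'.2, eventually_small one_pos] with η h1 ⟨h2, _⟩
    exact (E.solvesAux_iff hL h2).1 h1
  · filter_upwards [hC, hB, hM, hM', eventually_small one_pos] with η h1 h2 h3 h4 ⟨h5, _⟩ t ht
    have hβ : β η ∈ Icc (-(B + M + M')) (B + M + M') := mem_symm_Icc.2 (by linarith [h2.1])
    have hv : v η t ∈ Icc (-(B + M + M')) (B + M + M') := mem_symm_Icc.2 (by linarith [h2.2 t ht])
    refine ((h1 t ht _ hβ _ hv).2 _ (mem_symm_Icc.2 (by linarith [h3.1])) _ hβ _ hv _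
      (mem_symm_Icc.2 (by linarith [h4.1]))).trans ?_
    rw [sub_self, sub_self, abs_zero, add_zero, add_zero]
    have := abs_nonneg (w η t - w' η t)
    gcongr
    linarith

theorem exists_canardSolution : ∃ (α : ℝ → ℝ) (u : ℝ → ℝ → ℝ), E.IsCanardSolution α u := by
  have key := exists_bounded_family hp hLe hL ht₀
    -- For the canard solution the parameter enters twice, through `S` and through `P`; hence the
    -- factor `2` in the Lipschitz constant.
    (N := fun η t a w => E.rhs η a w a t) ?_ ?_ ?_
  · obtain ⟨α, w, hαw, hs⟩ := key
    refine ⟨α, w, hαw, ?_⟩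
    filter_upwards [hs, eventually_small one_pos] with η h1 ⟨h2, _⟩
    exact (E.solvesAux_iff hL h2).2 h1
  · obtain ⟨C, _, hC⟩ := E.rhs_bounds ht₀ hL le_rfl
    exact ⟨C, hC.mono fun η h t ht => (h t ht 0 (by simp) 0 (by simp)).1⟩
  · intro M hM
    obtain ⟨C, hC0, hC⟩ := E.rhs_bounds ht₀ hL hM
    refine ⟨2 * C, by positivity, ?_⟩
    filter_upwards [hC, eventually_small one_pos] with η h1 ⟨h3, _⟩ t ht a ha a' ha' w hw w' hw'
    refine ((h1 t ht a ha w hw).2 a ha a' ha' w' hw' a' ha').trans ?_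
    have h4 : C * η * (|a - a'| + |a - a'| + |w - w'|) ≤ 2 * C * η * (|a - a'| + |w - w'|) := by
      have : 0 ≤ C * η * |w - w'| := by positivity
      linarith
    gcongr
  · filter_upwards [eventually_small (half_pos E.η₀_pos)] with η ⟨h2, h3⟩
    exact (E.rhs_continuousOn h2 (by linarith [E.η₀_pos])).comp
      (f := fun z : ℝ × ℝ × ℝ => (z.2.1, z.2.2, z.2.1, z.1)) (by fun_prop)
      fun z hz => ⟨trivial, trivial, trivial, hz.1⟩

theorem canardSolution_sameFamily {α α' : ℝ → ℝ} {w w' : ℝ → ℝ → ℝ} (h : E.IsCanardSolution α w)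
    (h' : E.IsCanardSolution α' w') : SameFamily t₀ α w α' w' := by
  obtain ⟨M, hM0, hM⟩ := BoundedFamily.exists_nonneg h.1
  obtain ⟨M', hM'0, hM'⟩ := BoundedFamily.exists_nonneg h'.1
  obtain ⟨C, hC0, hC⟩ := E.rhs_bounds ht₀ hL (by positivity : 0 ≤ M + M')
  refine sameFamily_of_forcing hp hLe hL ht₀ (C := 2 * C) (by positivity)
    (f := fun η t => E.rhs η (α η) (w η t) (α η) t)
    (f' := fun η t => E.rhs η (α' η) (w' η t) (α' η) t) ?_ ?_ ?_
  · filter_upwards [h.2, eventually_small one_pos] with η h1 ⟨h2, _⟩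
    exact (E.solvesAux_iff hL h2).1 h1
  · filter_upwards [h'.2, eventually_small one_pos] with η h1 ⟨h2, _⟩
    exact (E.solvesAux_iff hL h2).1 h1
  · filter_upwards [hC, hM, hM', eventually_small one_pos] with η h1 h3 h4 ⟨h5, _⟩ t ht
    have ha : α η ∈ Icc (-(M + M')) (M + M') := mem_symm_Icc.2 (by linarith [h3.1])
    have ha' : α' η ∈ Icc (-(M + M')) (M + M') := mem_symm_Icc.2 (by linarith [h4.1])
    have hw : w η t ∈ Icc (-(M + M')) (M + M') := mem_symm_Icc.2 (by linarith [h3.2 t ht])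
    have hw' : w' η t ∈ Icc (-(M + M')) (M + M') := mem_symm_Icc.2 (by linarith [h4.2 t ht])
    refine ((h1 t ht _ ha _ hw).2 _ ha _ ha' _ hw' _ ha').trans ?_
    have h6 : C * η * (|α η - α' η| + |α η - α' η| + |w η t - w' η t|)
        ≤ 2 * C * η * (|α η - α' η| + |w η t - w' η t|) := by
      have : 0 ≤ C * η * |w η t - w' η t| := by positivity
      linarith
    gcongr

/-- Two different equations are admitted so that the same comparison serves both for the gain of a
power and for the dependence on Taylor coefficients. The term `η |α - α'|` is allowed since it can
be absorbed. -/
theorem xiImage_close (E' : Equation p L t₀) (m : ℕ) {β β' α α' : ℝ → ℝ} {v v' w w' : ℝ → ℝ → ℝ}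
    (h : E.IsXiImage β v α w) (h' : E'.IsXiImage β' v' α' w')
    (hf : ∀ r : ℝ, 0 < r → r < t₀ → ∃ C : ℝ, ∀ᶠ η in 𝓝[>] (0 : ℝ), ∀ t ∈ Icc (-r) r,
      |E.rhs η (β η) (v η t) (α η) t - E'.rhs η (β' η) (v' η t) (α' η) t|
        ≤ C * (η * |α η - α' η| + η ^ m) * (1 + |t / η| ^ p)) :
    Close t₀ m α w α' w' := by
  refine close_of_residual hp hLe hL ht₀ m (f := fun η t => E.rhs η (β η) (v η t) (α η) t) h.1 h'.1
    ?_ fun r hr hrt => ?_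
  · filter_upwards [h.2, eventually_small one_pos] with η h1 ⟨h2, _⟩
    exact ((E.solvesAux_iff hL h2).1 h1).1
  · obtain ⟨C, hC⟩ := hf r hr hrt
    refine ⟨C, ?_⟩
    filter_upwards [h'.2, eventually_small one_pos, hC] with η h1 ⟨h2, _⟩ h3 t ht
    refine ⟨_, ((E'.solvesAux_iff hL h2).1 h1).1 t ⟨by linarith [ht.1], by linarith [ht.2]⟩, ?_⟩
    rw [mul_div_cancel₀ _ h2.ne', ← abs_neg]
    refine (le_of_eq ?_).trans (h3 t ht)
    congr 1
    ring

/-- The operator `Ξ_η` gains a power of `η`. -/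
theorem xiImage_close_succ {m : ℕ} {β β' α α' : ℝ → ℝ} {v v' w w' : ℝ → ℝ → ℝ}
    (hb : BoundedFamily t₀ β v) (hb' : BoundedFamily t₀ β' v') (hc : Close t₀ m β v β' v')
    (h : E.IsXiImage β v α w) (h' : E.IsXiImage β' v' α' w') : Close t₀ (m + 1) α w α' w' := by
  obtain ⟨B, hB0, hB⟩ := hb.exists_nonneg
  obtain ⟨B', hB'0, hB'⟩ := hb'.exists_nonneg
  obtain ⟨M, hM0, hM⟩ := BoundedFamily.exists_nonneg h.1
  obtain ⟨M', hM'0, hM'⟩ := BoundedFamily.exists_nonneg h'.1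
  obtain ⟨C, hC0, hC⟩ := E.rhs_bounds ht₀ hL (by positivity : 0 ≤ B + B' + M + M')
  refine E.xiImage_close hp hLe hL ht₀ E (m + 1) h h' fun r hr hrt => ?_
  obtain ⟨D, hD⟩ := hc.1
  obtain ⟨D', hD'⟩ := hc.2 r hr hrt
  refine ⟨C * (1 + |D| + |D'|), ?_⟩
  filter_upwards [hC, hB, hB', hM, hM', hD, hD', eventually_small one_pos]
    with η h1 h2 h3 h4 h5 h6 h7 ⟨h8, _⟩ t ht
  have ht' : t ∈ Icc (-t₀) t₀ := ⟨by linarith [ht.1], by linarith [ht.2]⟩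
  refine ((h1 t ht' _ (mem_symm_Icc.2 (by linarith [h2.1])) _
    (mem_symm_Icc.2 (by linarith [h2.2 t ht']))).2 _ (mem_symm_Icc.2 (by linarith [h4.1])) _
    (mem_symm_Icc.2 (by linarith [h3.1])) _ (mem_symm_Icc.2 (by linarith [h3.2 t ht'])) _
    (mem_symm_Icc.2 (by linarith [h5.1]))).trans ?_
  have hm0 : 0 ≤ η ^ m := by positivity
  have h9 : |β η - β' η| ≤ |D| * η ^ m :=
    h6.trans (mul_le_mul_of_nonneg_right (le_abs_self D) hm0)
  have h10 : |v η t - v' η t| ≤ |D'| * η ^ m :=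
    (h7 t ht).trans (mul_le_mul_of_nonneg_right (le_abs_self D') hm0)
  have h11 : η * (|α η - α' η| + |β η - β' η| + |v η t - v' η t|)
      ≤ (1 + |D| + |D'|) * (η * |α η - α' η| + η ^ (m + 1)) := by
    have h12 : 0 ≤ (|D| + |D'|) * (η * |α η - α' η|) := by positivity
    have h13 := mul_le_mul_of_nonneg_left h9 h8.le
    have h14 := mul_le_mul_of_nonneg_left h10 h8.le
    have h15 : 0 ≤ η ^ (m + 1) := by positivity
    rw [pow_succ] at h15 ⊢
    linarith
  rw [mul_assoc C η, mul_assoc C (1 + |D| + |D'|)]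
  gcongr

end Equation

namespace Equation

variable {p L : ℕ} {t₀ : ℝ}

/-! ### Equations with the same Taylor coefficients -/

theorem S_sub_le (ht₀ : 0 < t₀) {E E' : Equation p L t₀} {N : ℕ} (h : E.SameTaylor N E') {B : ℝ}
    (hB : 0 < B) : ∃ C : ℝ, 0 ≤ C ∧ ∀ t ∈ Icc (-t₀) t₀, ∀ a ∈ Icc (-B) B,
      |E.S t a - E'.S t a| ≤ C * |a| ^ (N + 1) := by
  obtain ⟨C, hC0, hC⟩ := E.S_taylor ht₀ hB (N + 1)
  obtain ⟨C', hC'0, hC'⟩ := E'.S_taylor ht₀ hB (N + 1)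
  refine ⟨C + C', by positivity, fun t ht a ha => ?_⟩
  have h1 := hC t ht a ha
  have h2 := hC' t ht a ha
  have h3 : ∑ j ∈ Finset.range (N + 1), iteratedDeriv j (E'.S t) 0 / j.factorial * a ^ j
      = ∑ j ∈ Finset.range (N + 1), iteratedDeriv j (E.S t) 0 / j.factorial * a ^ j := by
    refine Finset.sum_congr rfl fun j hj => ?_
    rw [show iteratedDeriv j (E.S t) 0 = iteratedDeriv j (E'.S t) 0 from
      (h t ht).1 j (Nat.lt_succ_iff.1 (Finset.mem_range.1 hj))]
  rw [h3] at h2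
  rw [abs_le] at h1 h2 ⊢
  constructor <;> linarith

theorem contDiffOn_P_slice (E : Equation p L t₀) (x : ℝ) {B δ : ℝ} (hδ : δ < E.η₀) :
    ContDiffOn ℝ ∞ (fun z : (ℝ × ℝ) × ℝ => E.P z.1.1 x z.2 z.1.2)
      ((Icc (-t₀) t₀ ×ˢ Icc 0 δ) ×ˢ Icc (-B) B) := by
  refine E.P_smooth.comp (f := fun z : (ℝ × ℝ) × ℝ => (z.1.1, x, z.2, z.1.2)) ?_
    fun z hz => ⟨hz.1.1, trivial, trivial, hz.1.2.1, hz.1.2.2.trans_lt hδ⟩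
  exact ContDiff.contDiffOn (by fun_prop)

theorem iteratedDerivWithin_P (E : Equation p L t₀) (x : ℝ) {B : ℝ} (hB : 0 < B) {t η : ℝ}
    (ht : t ∈ Icc (-t₀) t₀) (hη : η ∈ Ico 0 E.η₀) (i : ℕ) :
    iteratedDerivWithin i (fun a => E.P t x a η) (Icc (-B) B) 0
      = iteratedDeriv i (fun a => E.P t x a η) 0 := by
  have h1 : ContDiff ℝ ∞ fun a => E.P t x a η := by
    rw [← contDiffOn_univ]
    exact E.P_smooth.comp (f := fun a : ℝ => (t, x, a, η)) (ContDiff.contDiffOn (by fun_prop))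
      fun a _ => ⟨ht, trivial, trivial, hη⟩
  exact iteratedDerivWithin_eq_iteratedDeriv (uniqueDiffOn_symm_Icc hB)
    (h1.of_le (by exact_mod_cast le_top)).contDiffAt ⟨by linarith, hB.le⟩

theorem iteratedDerivWithin_Icc_eq_Ici {δ : ℝ} (hδ : 0 < δ) (f : ℝ → ℝ) (j : ℕ) :
    iteratedDerivWithin j f (Icc 0 δ) 0 = iteratedDerivWithin j f (Ici 0) 0 := by
  have h : (Icc 0 δ : Set ℝ) =ᶠ[𝓝 0] Ici 0 := by
    filter_upwards [Iio_mem_nhds hδ] with x hx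
    exact propext ⟨fun h => h.1, fun h => ⟨h, le_of_lt hx⟩⟩
  simp only [iteratedDerivWithin, iteratedFDerivWithin_congr_set h j]

/-- The expansion is iterated: first in `a`, with `(t, η)` as a parameter, then each coefficient in
`η`, with `t` as a parameter. It is needed at individual values of `x` only. -/
theorem P_taylor (ht₀ : 0 < t₀) (E : Equation p L t₀) (x : ℝ) {B δ : ℝ} (hB : 0 < B) (hδ0 : 0 < δ)
    (hδ : δ < E.η₀) (N : ℕ) : ∃ C : ℝ, 0 ≤ C ∧ ∀ t ∈ Icc (-t₀) t₀, ∀ a ∈ Icc (-B) B, ∀ η ∈ Icc 0 δ,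
      |E.P t x a η - ∑ i ∈ Finset.range N, (∑ j ∈ Finset.range N,
        iteratedDerivWithin j (fun η => iteratedDeriv i (fun a => E.P t x a η) 0) (Ici 0) 0
          / j.factorial * η ^ j) / i.factorial * a ^ i| ≤ C * (|a| ^ N + η ^ N) := by
  have hud : UniqueDiffOn ℝ (Icc (-t₀) t₀ ×ˢ Icc 0 δ) :=
    (uniqueDiffOn_symm_Icc ht₀).prod (uniqueDiffOn_Icc hδ0)
  have hcd := E.contDiffOn_P_slice x (B := B) hδ
  obtain ⟨C, hC0, hC⟩ := taylor_slice_bound (f := fun (y : ℝ × ℝ) a => E.P y.1 x a y.2) hud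
    (uniqueDiffOn_symm_Icc hB) (isCompact_Icc.prod isCompact_Icc) isCompact_Icc ordConnected_Icc
    ⟨by linarith, hB.le⟩ N hcd
  have hIco : ∀ η ∈ Icc 0 δ, η ∈ Ico 0 E.η₀ := fun η hη => ⟨hη.1, hη.2.trans_lt hδ⟩
  choose D hD0 hD using fun i => taylor_slice_bound (J := N)
    (f := fun (t η : ℝ) => iteratedDeriv i (fun a => E.P t x a η) 0) (uniqueDiffOn_symm_Icc ht₀)
    (uniqueDiffOn_Icc hδ0) isCompact_Icc isCompact_Icc ordConnected_Icc (left_mem_Icc.2 hδ0.le)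
    ((contDiffOn_iteratedDerivWithin_slice (f := fun (y : ℝ × ℝ) a => E.P y.1 x a y.2) hud
      (uniqueDiffOn_symm_Icc hB) ⟨by linarith, hB.le⟩ i hcd).congr fun z hz =>
        (E.iteratedDerivWithin_P x hB hz.1 (hIco _ hz.2) i).symm)
  refine ⟨C + ∑ i ∈ Finset.range N, D i * B ^ i, add_nonneg hC0
    (Finset.sum_nonneg fun i _ => mul_nonneg (hD0 i) (by positivity)), fun t ht a ha η hη => ?_⟩
  have h1 := hC (t, η) ⟨ht, hη⟩ a ha
  simp only [E.iteratedDerivWithin_P x hB ht (hIco η hη)] at h1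
  have h2 : |∑ i ∈ Finset.range N, iteratedDeriv i (fun a => E.P t x a η) 0 / i.factorial * a ^ i
      - ∑ i ∈ Finset.range N, (∑ j ∈ Finset.range N,
        iteratedDerivWithin j (fun η => iteratedDeriv i (fun a => E.P t x a η) 0) (Ici 0) 0
          / j.factorial * η ^ j) / i.factorial * a ^ i|
      ≤ (∑ i ∈ Finset.range N, D i * B ^ i) * η ^ N := by
    rw [← Finset.sum_sub_distrib, Finset.sum_mul]
    refine (Finset.abs_sum_le_sum_abs _ _).trans (Finset.sum_le_sum fun i _ => ?_)
    have h3 := hD i t ht η hη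
    simp only [iteratedDerivWithin_Icc_eq_Ici hδ0, abs_of_nonneg hη.1] at h3
    rw [← sub_mul, ← sub_div, abs_mul, abs_div, abs_pow, Nat.abs_cast]
    have h4 : |a| ^ i ≤ B ^ i := pow_le_pow_left₀ (abs_nonneg a) (abs_le.2 ha) i
    have hfac : (1 : ℝ) ≤ (i.factorial : ℝ) := by
      exact_mod_cast Nat.one_le_iff_ne_zero.2 (Nat.factorial_ne_zero i)
    have h5 := (div_le_self (abs_nonneg (iteratedDeriv i (fun a => E.P t x a η) 0
      - ∑ j ∈ Finset.range N,
        iteratedDerivWithin j (fun η => iteratedDeriv i (fun a => E.P t x a η) 0) (Ici 0) 0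
          / j.factorial * η ^ j)) hfac).trans h3
    calc _ ≤ D i * η ^ N * B ^ i := mul_le_mul h5 h4 (by positivity)
            (mul_nonneg (hD0 i) (pow_nonneg hη.1 N))
      _ = D i * B ^ i * η ^ N := by ring
  have h6 := abs_sub_le (E.P t x a η)
    (∑ i ∈ Finset.range N, iteratedDeriv i (fun a => E.P t x a η) 0 / i.factorial * a ^ i)
    (∑ i ∈ Finset.range N, (∑ j ∈ Finset.range N,
        iteratedDerivWithin j (fun η => iteratedDeriv i (fun a => E.P t x a η) 0) (Ici 0) 0
          / j.factorial * η ^ j) / i.factorial * a ^ i)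
  have h7 : 0 ≤ (∑ i ∈ Finset.range N, D i * B ^ i) * |a| ^ N :=
    mul_nonneg (Finset.sum_nonneg fun i _ => mul_nonneg (hD0 i) (by positivity)) (by positivity)
  have h8 : 0 ≤ C * η ^ N := mul_nonneg hC0 (pow_nonneg hη.1 N)
  linarith

theorem P_sub_le (ht₀ : 0 < t₀) {E E' : Equation p L t₀} {N : ℕ} (h : E.SameTaylor N E') (x : ℝ)
    {B δ : ℝ} (hB : 0 < B) (hδ0 : 0 < δ) (hδ : δ < E.η₀) (hδ' : δ < E'.η₀) :
    ∃ C : ℝ, 0 ≤ C ∧ ∀ t ∈ Icc (-t₀) t₀, ∀ a ∈ Icc (-B) B, ∀ η ∈ Icc 0 δ,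
      |E.P t x a η - E'.P t x a η| ≤ C * (|a| ^ (N + 1) + η ^ (N + 1)) := by
  obtain ⟨C, hC0, hC⟩ := P_taylor ht₀ E x hB hδ0 hδ (N + 1)
  obtain ⟨C', hC'0, hC'⟩ := P_taylor ht₀ E' x hB hδ0 hδ' (N + 1)
  refine ⟨C + C', by positivity, fun t ht a ha η hη => ?_⟩
  have h1 := hC t ht a ha η hη
  have h2 := hC' t ht a ha η hη
  have h3 : ∑ i ∈ Finset.range (N + 1), (∑ j ∈ Finset.range (N + 1),
        iteratedDerivWithin j (fun η => iteratedDeriv i (fun a => E'.P t x a η) 0) (Ici 0) 0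
          / j.factorial * η ^ j) / i.factorial * a ^ i
      = ∑ i ∈ Finset.range (N + 1), (∑ j ∈ Finset.range (N + 1),
        iteratedDerivWithin j (fun η => iteratedDeriv i (fun a => E.P t x a η) 0) (Ici 0) 0
          / j.factorial * η ^ j) / i.factorial * a ^ i := by
    refine Finset.sum_congr rfl fun i hi => ?_
    congr 2
    refine Finset.sum_congr rfl fun j hj => ?_
    rw [(h t ht).2 x i (Nat.lt_succ_iff.1 (Finset.mem_range.1 hi)) j
      (Nat.lt_succ_iff.1 (Finset.mem_range.1 hj))]
  rw [h3] at h2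
  rw [abs_le] at h1 h2 ⊢
  constructor <;> linarith

/-- An affine function is known from its values at `0` and `1`, so estimates at these two values of
`x` suffice. -/
theorem IsLinear.eq {E : Equation p L t₀} (h : E.IsLinear) {t a η : ℝ} (ht : t ∈ Icc (-t₀) t₀)
    (hη : η ∈ Ico 0 E.η₀) (x : ℝ) :
    E.P t x a η = E.P t 0 a η + x * (E.P t 1 a η - E.P t 0 a η) := by
  obtain ⟨A, B, hAB⟩ := h t ht a η hη
  rw [hAB x, hAB 0, hAB 1]
  ring

theorem rhs_sub_le (ht₀ : 0 < t₀) {E E' : Equation p L t₀} (hE : E.IsLinear) (hE' : E'.IsLinear)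
    {K : ℕ} (h : E.SameTaylor (K + p + 1) E') {M : ℝ} (hM : 0 ≤ M) :
    ∃ C : ℝ, 0 ≤ C ∧ ∀ᶠ η in 𝓝[>] (0 : ℝ), ∀ t ∈ Icc (-t₀) t₀, ∀ β ∈ Icc (-M) M, ∀ x ∈ Icc (-M) M,
      ∀ α ∈ Icc (-M) M, |E.rhs η β x α t - E'.rhs η β x α t| ≤ C * η ^ (K + 1) := by
  -- The error in `S` is of order `η^{N+1} = η^{K+p+2}`; division by `η^{p+1}` leaves exactly
  -- `η^{K+1}`.
  set N := K + p + 1 with hN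
  set B := M + 1 with hBdef
  have hB : 0 < B := by linarith
  set δ := min E.η₀ E'.η₀ / 2 with hδdef
  have hmin : 0 < min E.η₀ E'.η₀ := lt_min E.η₀_pos E'.η₀_pos
  have hδ0 : 0 < δ := half_pos hmin
  have hδ : δ < E.η₀ := (half_lt_self hmin).trans_le (min_le_left _ _)
  have hδ' : δ < E'.η₀ := (half_lt_self hmin).trans_le (min_le_right _ _)
  obtain ⟨C₁, hC₁0, hC₁⟩ := S_sub_le ht₀ h hB
  obtain ⟨C₂, hC₂0, hC₂⟩ := P_sub_le ht₀ h 0 hB hδ0 hδ hδ'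
  obtain ⟨C₃, hC₃0, hC₃⟩ := P_sub_le ht₀ h 1 hB hδ0 hδ hδ'
  set G := M ^ (N + 1) + 1 with hG
  have hG0 : 0 ≤ G := by positivity
  refine ⟨C₁ * M ^ (N + 1) + ((1 + M) * (C₂ * G) + M * (C₃ * G)), by positivity, ?_⟩
  filter_upwards [eventually_small one_pos, eventually_small hδ0] with η ⟨hη, hη1⟩ ⟨_, hηδ⟩ t ht β hβ x hx α hα
  have hqle : η ^ (p - L + 1) ≤ η := pow_le_of_le_one hη.le hη1 (by omega)
  have hq0 : 0 < η ^ (p - L + 1) := pow_pos hη _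
  have hsc : ∀ y ∈ Icc (-M) M, η ^ (p - L + 1) * y ∈ Icc (-B) B ∧
      |η ^ (p - L + 1) * y| ^ (N + 1) ≤ M ^ (N + 1) * η ^ (N + 1) := by
    intro y hy
    rw [mem_symm_Icc] at hy ⊢
    have h1 : |η ^ (p - L + 1) * y| ≤ η * M := by
      rw [abs_mul, abs_of_pos hq0]
      exact mul_le_mul hqle hy (abs_nonneg y) hη.le
    refine ⟨h1.trans ((mul_le_of_le_one_left hM hη1).trans (by linarith)), ?_⟩
    rw [mul_comm (M ^ (N + 1)), ← mul_pow]
    exact pow_le_pow_left₀ (abs_nonneg _) h1 _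
  have hηI : η ∈ Icc 0 δ := ⟨hη.le, hηδ⟩
  have hηK : η ^ (N + 1) ≤ η ^ (K + 1) := pow_le_pow_of_le_one hη.le hη1 (by omega)
  have hS : |E.S t (η ^ (p - L + 1) * α) / η ^ (p + 1) - E'.S t (η ^ (p - L + 1) * α) / η ^ (p + 1)|
      ≤ C₁ * M ^ (N + 1) * η ^ (K + 1) := by
    rw [← sub_div, abs_div, abs_of_pos (pow_pos hη _), div_le_iff₀ (pow_pos hη _)]
    refine (hC₁ t ht _ (hsc α hα).1).trans ?_
    refine (mul_le_mul_of_nonneg_left (hsc α hα).2 hC₁0).trans_eq ?_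
    rw [hN]
    ring
  have hP : ∀ C y, 0 ≤ C → |y| ≤ C * (|η ^ (p - L + 1) * β| ^ (N + 1) + η ^ (N + 1)) →
      |y| ≤ C * G * η ^ (K + 1) := by
    intro C y hC hy
    refine hy.trans ?_
    rw [mul_assoc]
    refine mul_le_mul_of_nonneg_left ?_ hC
    have := (hsc β hβ).2
    calc _ ≤ M ^ (N + 1) * η ^ (N + 1) + η ^ (N + 1) := by linarith
      _ = G * η ^ (N + 1) := by rw [hG]; ring
      _ ≤ _ := mul_le_mul_of_nonneg_left hηK hG0
  have hP0 := hP C₂ _ hC₂0 (hC₂ t ht _ (hsc β hβ).1 η hηI)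
  have hP1 := hP C₃ _ hC₃0 (hC₃ t ht _ (hsc β hβ).1 η hηI)
  set b := η ^ (p - L + 1) * β
  have hx' : |η * x| ≤ M := by
    rw [abs_mul, abs_of_pos hη]
    exact (mul_le_of_le_one_left (abs_nonneg x) hη1).trans (abs_le.2 hx)
  have hdiff : E.rhs η β x α t - E'.rhs η β x α t
      = (E.S t (η ^ (p - L + 1) * α) / η ^ (p + 1) - E'.S t (η ^ (p - L + 1) * α) / η ^ (p + 1))
        + ((1 - η * x) * (E.P t 0 b η - E'.P t 0 b η) + (η * x) * (E.P t 1 b η - E'.P t 1 b η)) := by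
    unfold rhs
    rw [hE.eq ht ⟨hη.le, hηδ.trans_lt hδ⟩ (η * x), hE'.eq ht ⟨hη.le, hηδ.trans_lt hδ'⟩ (η * x)]
    ring
  rw [hdiff]
  have h1 : |(1 - η * x) * (E.P t 0 b η - E'.P t 0 b η)| ≤ (1 + M) * (C₂ * G * η ^ (K + 1)) := by
    rw [abs_mul]
    refine mul_le_mul ?_ hP0 (abs_nonneg _) (by positivity)
    exact (abs_sub _ _).trans (by rw [abs_one]; linarith)
  have h2 : |(η * x) * (E.P t 1 b η - E'.P t 1 b η)| ≤ M * (C₃ * G * η ^ (K + 1)) := by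
    rw [abs_mul]
    exact mul_le_mul hx' hP1 (abs_nonneg _) hM
  refine (abs_add_le _ _).trans ((add_le_add hS ((abs_add_le _ _).trans (add_le_add h1 h2))).trans_eq ?_)
  ring

theorem xiImage_close_of_sameTaylor (hp : Odd p) (hLe : Even L) (hL : L < p) (ht₀ : 0 < t₀)
    {E E' : Equation p L t₀} (hE : E.IsLinear) (hE' : E'.IsLinear) {K : ℕ}
    (hS : E.SameTaylor (K + p + 1) E') {β α α' : ℝ → ℝ} {v w w' : ℝ → ℝ → ℝ}
    (hb : BoundedFamily t₀ β v) (h : E.IsXiImage β v α w) (h' : E'.IsXiImage β v α' w') :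
    Close t₀ (K + 1) α w α' w' := by
  obtain ⟨B, hB0, hB⟩ := hb.exists_nonneg
  obtain ⟨M, hM0, hM⟩ := BoundedFamily.exists_nonneg h.1
  obtain ⟨M', hM'0, hM'⟩ := BoundedFamily.exists_nonneg h'.1
  obtain ⟨C, hC0, hC⟩ := E.rhs_bounds ht₀ hL (by positivity : 0 ≤ B + M + M')
  obtain ⟨D, hD0, hD⟩ := rhs_sub_le ht₀ hE hE' hS (by positivity : 0 ≤ B + M + M')
  refine E.xiImage_close hp hLe hL ht₀ E' (K + 1) h h' fun r hr hrt => ⟨C + D, ?_⟩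
  filter_upwards [hC, hD, hB, hM, hM', eventually_small one_pos] with η h1 h2 h3 h4 h5 ⟨h6, _⟩ t ht
  have ht' : t ∈ Icc (-t₀) t₀ := ⟨by linarith [ht.1], by linarith [ht.2]⟩
  have hβ : β η ∈ Icc (-(B + M + M')) (B + M + M') := mem_symm_Icc.2 (by linarith [h3.1])
  have hv : v η t ∈ Icc (-(B + M + M')) (B + M + M') := mem_symm_Icc.2 (by linarith [h3.2 t ht'])
  have hα : α η ∈ Icc (-(B + M + M')) (B + M + M') := mem_symm_Icc.2 (by linarith [h4.1])
  have hα' : α' η ∈ Icc (-(B + M + M')) (B + M + M') := mem_symm_Icc.2 (by linarith [h5.1])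
  have h7 := (h1 t ht' _ hβ _ hv).2 _ hα _ hβ _ hv _ hα'
  rw [sub_self, sub_self, abs_zero, add_zero, add_zero] at h7
  have h8 := h2 t ht' _ hβ _ hv _ hα'
  set Y := 1 + |t / η| ^ p with hY
  have hY1 : 1 ≤ Y := le_add_of_nonneg_right (by positivity)
  have h9 : D * η ^ (K + 1) ≤ D * η ^ (K + 1) * Y := le_mul_of_one_le_right (by positivity) hY1
  have h10 : 0 ≤ C * η ^ (K + 1) * Y := by positivity
  have h11 : 0 ≤ D * (η * |α η - α' η|) * Y := by positivity
  refine (abs_sub_le _ (E.rhs η (β η) (v η t) (α' η) t) _).trans ((add_le_add h7 (h8.trans h9)).trans ?_)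
  linarith

end Equation

section

/-! ### Uniqueness of the formal expansions -/

/-- Division by `η^n` isolates the first coefficient that may be nonzero. The `g j` may depend on
`η`; only their common bound `M` enters. -/
theorem lowest_coeff_bound {K m n : ℕ} (hn : n < K + 1) (hnm : n < m) {g : Fin (K + 1) → ℝ}
    (h0 : ∀ j : Fin (K + 1), (j : ℕ) < n → g j = 0) {M C η : ℝ} (hM : ∀ j, |g j| ≤ M)
    (hη : 0 < η) (hη1 : η ≤ 1) (h : |∑ j, g j * η ^ (j : ℕ)| ≤ C * η ^ m) :
    |g ⟨n, hn⟩| ≤ (|C| + (K + 1) * M) * η := by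
  have hM0 : 0 ≤ M := (abs_nonneg _).trans (hM ⟨n, hn⟩)
  have h1 : |∑ j ∈ Finset.univ.erase (⟨n, hn⟩ : Fin (K + 1)), g j * η ^ (j : ℕ)|
      ≤ (K + 1) * M * η ^ (n + 1) := by
    refine (Finset.abs_sum_le_sum_abs _ _).trans ?_
    refine (Finset.sum_le_card_nsmul _ _ (M * η ^ (n + 1)) fun j hj => ?_).trans ?_
    · rcases lt_trichotomy (j : ℕ) n with h2 | h2 | h2
      · rw [h0 j h2, zero_mul, abs_zero]
        positivity
      · exact absurd (Fin.ext h2) (Finset.ne_of_mem_erase hj)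
      · rw [abs_mul, abs_of_pos (pow_pos hη _)]
        exact mul_le_mul (hM j) (pow_le_pow_of_le_one hη.le hη1 h2) (by positivity) hM0
    · rw [nsmul_eq_mul, ← mul_assoc]
      gcongr
      have := (Finset.card_erase_le (s := Finset.univ) (a := (⟨n, hn⟩ : Fin (K + 1)))).trans_eq
        (Finset.card_fin _)
      exact_mod_cast this
  have h2 := Finset.add_sum_erase Finset.univ (fun j : Fin (K + 1) => g j * η ^ (j : ℕ))
    (Finset.mem_univ ⟨n, hn⟩)
  have h3 : C * η ^ m ≤ |C| * η ^ (n + 1) :=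
    mul_le_mul (le_abs_self C) (pow_le_pow_of_le_one hη.le hη1 hnm) (by positivity) (abs_nonneg C)
  have h4 : |g ⟨n, hn⟩| * η ^ n ≤ (|C| + (K + 1) * M) * η * η ^ n := by
    have h5 : |g ⟨n, hn⟩| * η ^ n = |g ⟨n, hn⟩ * η ^ n| := by
      rw [abs_mul, abs_of_pos (pow_pos hη n)]
    rw [h5, eq_sub_of_add_eq h2]
    refine (abs_sub _ _).trans ((add_le_add (h.trans h3) h1).trans_eq ?_)
    ring
  exact le_of_mul_le_mul_right h4 (pow_pos hη n)

variable {p L : ℕ} {r : ℝ}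

theorem SmoothFun.exists_bound (f : SmoothFun r) : ∃ C, 0 ≤ C ∧ ∀ t, |f.toFun t| ≤ C := by
  obtain ⟨C, hC⟩ := isCompact_Icc.exists_bound_of_continuousOn f.smooth.continuousOn
  refine ⟨|C|, abs_nonneg C, fun t => ?_⟩
  by_cases ht : t ∈ Icc (-r) r
  · exact (hC t ht).trans (le_abs_self C)
  · rw [f.zero_outside t ht, abs_zero]
    exact abs_nonneg C

section

variable (hp : Odd p) (hLe : Even L) (hL : L < p)
include hp hLe hL

theorem FormalTerm.fn_bound {n : ℕ} (c : FormalTerm p L r n) :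
    ∃ C, 0 ≤ C ∧ ∀ η t, |c.fn η t| ≤ C := by
  obtain ⟨C, hC0, hC⟩ := c.u.exists_bound
  have hψ : ∀ (i : Fin (n + 1)) (k : {k : Fin p // (k : ℕ) ≠ L}),
      ∃ B, ∀ T, |psiBar p L i k.1 T| ≤ B := fun i k => by
    obtain ⟨B, hB⟩ := psiBar_bound hp hLe hL k.1.2 i
    exact ⟨B, fun T => (hB T).1⟩
  choose B hB using hψ
  refine ⟨C + ∑ i, ∑ k, |c.b i k| * |B i k|, add_nonneg hC0 (Finset.sum_nonneg fun i _ =>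
    Finset.sum_nonneg fun k _ => by positivity), fun η t => ?_⟩
  refine (abs_add_le _ _).trans (add_le_add (hC t) ?_)
  refine (Finset.abs_sum_le_sum_abs _ _).trans (Finset.sum_le_sum fun i _ => ?_)
  refine (Finset.abs_sum_le_sum_abs _ _).trans (Finset.sum_le_sum fun k _ => ?_)
  rw [abs_mul]
  exact mul_le_mul_of_nonneg_left ((hB i k _).trans (le_abs_self _)) (abs_nonneg _)

theorem FormalTerm.tendsto_fn {n : ℕ} (c : FormalTerm p L r n) {t : ℝ} (ht : t ≠ 0) :
    Tendsto (fun η => c.fn η t) (𝓝[>] 0) (𝓝 (c.u.toFun t)) := by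
  have h : Tendsto (fun η : ℝ => ∑ i, ∑ k, c.b i k * psiBar p L (i : ℕ) (k.1 : ℕ) (t / η)) (𝓝[>] 0)
      (𝓝 (∑ _i : Fin (n + 1), ∑ _k : {k : Fin p // (k : ℕ) ≠ L}, (0 : ℝ))) := by
    refine tendsto_finsetSum _ fun i _ => tendsto_finsetSum _ fun k _ => ?_
    have := (tendsto_psiBar hp hLe hL k.1.2 i ht).const_mul (c.b i k)
    rwa [mul_zero] at this
  simp only [Finset.sum_const_zero] at h
  have := h.const_add (c.u.toFun t)
  rwa [add_zero] at this

theorem FormalSum.coeff_eq_of_fn (hr : 0 < r) {K m : ℕ} {c c' : FormalSum p L r K}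
    (h : ∀ s, 0 < s → s < r → ∃ C, ∀ᶠ η in 𝓝[>] (0 : ℝ), ∀ t ∈ Icc (-s) s,
      |c.fn η t - c'.fn η t| ≤ C * η ^ m) (n : ℕ) (hn : n < K + 1) (hnm : n < m) :
    (c ⟨n, hn⟩).u = (c' ⟨n, hn⟩).u ∧ (c ⟨n, hn⟩).b = (c' ⟨n, hn⟩).b := by
  induction n using Nat.strong_induction_on with
  | _ n ih =>
  choose B hB0 hB using fun j => (c j).fn_bound hp hLe hL
  choose B' hB'0 hB' using fun j => (c' j).fn_bound hp hLe hL
  set M := ∑ j, (B j + B' j) with hMdef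
  have hM : ∀ η t j, |(c j).fn η t - (c' j).fn η t| ≤ M := fun η t j =>
    (abs_sub _ _).trans ((add_le_add (hB j η t) (hB' j η t)).trans
      (Finset.single_le_sum (f := fun j => B j + B' j) (fun j _ => add_nonneg (hB0 j) (hB'0 j))
        (Finset.mem_univ j)))
  have key : ∀ s, 0 < s → s < r → ∃ C, ∀ᶠ η in 𝓝[>] (0 : ℝ), ∀ t ∈ Icc (-s) s,
      |(c ⟨n, hn⟩).fn η t - (c' ⟨n, hn⟩).fn η t| ≤ C * η := by
    intro s hs hsr
    obtain ⟨C, hC⟩ := h s hs hsr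
    refine ⟨|C| + (K + 1) * M, ?_⟩
    filter_upwards [hC, Equation.eventually_small one_pos] with η h1 ⟨h2, h3⟩ t ht
    refine lowest_coeff_bound (g := fun j => (c j).fn η t - (c' j).fn η t) hn hnm ?_
      (hM η t) h2 h3 ?_
    · intro j hj
      obtain ⟨h4, h5⟩ := ih j hj j.2 (hj.trans hnm)
      simp only [Fin.eta] at h4 h5
      simp only [FormalTerm.fn, h4, h5, sub_self]
    · have := h1 t ht
      simp only [FormalSum.fn, ← Finset.sum_sub_distrib, ← sub_mul] at this
      exact this
  have hlim : ∀ C, Tendsto (fun η : ℝ => C * η) (𝓝[>] 0) (𝓝 0) := fun C => by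
    have : Tendsto (fun η : ℝ => C * η) (𝓝[>] 0) (𝓝 (C * 0)) :=
      (tendsto_id.const_mul _).mono_left nhdsWithin_le_nhds
    rwa [mul_zero] at this
  -- At fixed `t ≠ 0` the functions `ψ̄_{i,k}(t/η)` tend to zero, and the limit sees only `u_n`. The
  -- excluded point `0` and the end points are recovered by continuity.
  have hu0 : ∀ t ∈ Ioo (-r) r \ {0}, (c ⟨n, hn⟩).u.toFun t = (c' ⟨n, hn⟩).u.toFun t := by
    intro t ht
    have htr : |t| < r := abs_lt.2 ht.1
    have ht0 : 0 < |t| := abs_pos.2 ht.2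
    obtain ⟨C, hC⟩ := key |t| ht0 htr
    have h1 := ((c ⟨n, hn⟩).tendsto_fn hp hLe hL ht.2).sub ((c' ⟨n, hn⟩).tendsto_fn hp hLe hL ht.2)
    have h2 : |(c ⟨n, hn⟩).u.toFun t - (c' ⟨n, hn⟩).u.toFun t| ≤ 0 :=
      le_of_tendsto_of_tendsto h1.abs (hlim C) (hC.mono fun η h => h t (mem_symm_Icc.2 le_rfl))
    exact sub_eq_zero.1 (abs_nonpos_iff.1 h2)
  have hu : (c ⟨n, hn⟩).u = (c' ⟨n, hn⟩).u := by
    refine SmoothFun.ext (funext fun t => ?_)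
    by_cases ht : t ∈ Icc (-r) r
    · have hcl : Icc (-r) r ⊆ closure (Ioo (-r) r \ {0}) := by
        have h1 : Dense ({0}ᶜ : Set ℝ) := dense_compl_singleton 0
        have h2 := h1.open_subset_closure_inter (isOpen_Ioo (a := -r) (b := r))
        rw [← closure_Ioo (by linarith : (-r) ≠ r)]
        rw [sdiff_eq]
        exact closure_minimal h2 isClosed_closure
      have := Set.EqOn.of_subset_closure hu0 (c ⟨n, hn⟩).u.smooth.continuousOn
        (c' ⟨n, hn⟩).u.smooth.continuousOn (sdiff_subset.trans Ioo_subset_Icc_self) hcl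
      exact this ht
    · rw [SmoothFun.zero_outside _ t ht, SmoothFun.zero_outside _ t ht]
  refine ⟨hu, ?_⟩
  -- With the smooth parts equal, evaluation at `t = η T` for fixed `T` leaves a combination of the
  -- `ψ̄_{i,k}(T)` that does not depend on `η` and is `O(η)`, hence zero.
  have hb := psiBar_linearIndependent hp hLe hL
    (fun i k => (c ⟨n, hn⟩).b i k - (c' ⟨n, hn⟩).b i k) fun T => ?_
  · funext i k
    exact sub_eq_zero.1 (congrFun (congrFun hb i) k)
  · obtain ⟨C, hC⟩ := key (r / 2) (by linarith) (by linarith)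
    set A := ∑ i, ∑ k : {k : Fin p // (k : ℕ) ≠ L},
      ((c ⟨n, hn⟩).b i k - (c' ⟨n, hn⟩).b i k) * psiBar p L i k.1 T with hA
    have h2 : |A| ≤ 0 := by
      refine le_of_tendsto_of_tendsto tendsto_const_nhds (hlim C) ?_
      filter_upwards [hC, Equation.eventually_small one_pos,
        eventually_mul_le (c := |T|) (half_pos hr)] with η h1 ⟨h3, _⟩ h4
      have h5 := h1 (η * T) (mem_symm_Icc.2 (by rw [abs_mul, abs_of_pos h3]; linarith))
      simp only [FormalTerm.fn, hu, add_sub_add_left_eq_sub, mul_div_cancel_left₀ T h3.ne',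
        ← Finset.sum_sub_distrib, ← sub_mul] at h5
      exact h5
    exact abs_nonpos_iff.1 h2

end

theorem FormalSum.coeff_eq_of_param {K m : ℕ} {c c' : FormalSum p L r K}
    (h : ∃ C, ∀ᶠ η in 𝓝[>] (0 : ℝ), |c.param η - c'.param η| ≤ C * η ^ m)
    (n : ℕ) (hn : n < K + 1) (hnm : n < m) : (c ⟨n, hn⟩).a = (c' ⟨n, hn⟩).a := by
  induction n using Nat.strong_induction_on with
  | _ n ih =>
  obtain ⟨C, hC⟩ := h
  set M := ∑ j, |(c j).a - (c' j).a|
  have h2 : |(c ⟨n, hn⟩).a - (c' ⟨n, hn⟩).a| ≤ 0 := by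
    have hlim : Tendsto (fun η : ℝ => (|C| + (K + 1) * M) * η) (𝓝[>] 0) (𝓝 0) := by
      have : Tendsto (fun η : ℝ => (|C| + (K + 1) * M) * η) (𝓝[>] 0) (𝓝 ((|C| + (K + 1) * M) * 0)) :=
        (tendsto_id.const_mul _).mono_left nhdsWithin_le_nhds
      rwa [mul_zero] at this
    refine le_of_tendsto_of_tendsto tendsto_const_nhds hlim ?_
    filter_upwards [hC, Equation.eventually_small one_pos] with η h1 ⟨h2, h3⟩
    refine lowest_coeff_bound (g := fun j => (c j).a - (c' j).a) hn hnm ?_ (fun j =>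
      Finset.single_le_sum (f := fun j => |(c j).a - (c' j).a|) (fun j _ => abs_nonneg _)
        (Finset.mem_univ j)) h2 h3 ?_
    · intro j hj
      exact sub_eq_zero.2 (ih j hj j.2 (hj.trans hnm))
    · simp only [FormalSum.param, ← Finset.sum_sub_distrib, ← sub_mul] at h1
      exact h1
  exact sub_eq_zero.1 (abs_nonpos_iff.1 h2)

theorem FormalSum.coeff_eq_of_close (hp : Odd p) (hLe : Even L) (hL : L < p) (hr : 0 < r) {K m : ℕ}
    {c c' : FormalSum p L r K} (h : Close r m c.param c.fn c'.param c'.fn)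
    (n : Fin (K + 1)) (hnm : (n : ℕ) < m) : c n = c' n :=
  have h1 := coeff_eq_of_fn hp hLe hL hr h.2 n n.2 hnm
  FormalTerm.ext (coeff_eq_of_param h.1 n n.2 hnm) h1.1 h1.2

end

/-! ### Linear combinations of formal sums -/

section Algebra

variable {p L : ℕ} {r : ℝ}

/-- The restriction to `[-r, r]` of a function that is smooth there. -/
def SmoothFun.of (f : ℝ → ℝ) (hf : ContDiffOn ℝ ∞ f (Icc (-r) r)) : SmoothFun r where
  toFun := (Icc (-r) r).indicator f
  smooth := hf.congr fun _ ht => indicator_of_mem ht _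
  zero_outside := fun _ ht => indicator_of_notMem ht _

theorem SmoothFun.of_apply {f : ℝ → ℝ} (hf : ContDiffOn ℝ ∞ f (Icc (-r) r)) {t : ℝ}
    (ht : t ∈ Icc (-r) r) : (SmoothFun.of f hf).toFun t = f t :=
  indicator_of_mem ht _

instance {n : ℕ} : Zero (FormalTerm p L r n) := ⟨⟨0, SmoothFun.of 0 contDiffOn_const, 0⟩⟩

theorem FormalTerm.zero_fn {n : ℕ} (η t : ℝ) : (0 : FormalTerm p L r n).fn η t = 0 := by
  have h : (0 : FormalTerm p L r n).u.toFun t = 0 := by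
    change (Icc (-r) r).indicator (0 : ℝ → ℝ) t = 0
    rw [indicator_zero']
    rfl
  have hb : ∀ i k, (0 : FormalTerm p L r n).b i k = 0 := fun _ _ => rfl
  simp [FormalTerm.fn, h, hb]

/-- The linear combination `c + x c'`. -/
def FormalSum.addSMul {K : ℕ} (c : FormalSum p L r K) (x : ℝ) (c' : FormalSum p L r K) :
    FormalSum p L r K := fun n =>
  { a := (c n).a + x * (c' n).a
    u :=
      { toFun := fun t => (c n).u.toFun t + x * (c' n).u.toFun t
        smooth := (c n).u.smooth.add (contDiffOn_const.mul (c' n).u.smooth)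
        zero_outside := fun t ht => by
          rw [(c n).u.zero_outside t ht, (c' n).u.zero_outside t ht, mul_zero, add_zero] }
    b := fun i k => (c n).b i k + x * (c' n).b i k }

theorem FormalSum.addSMul_param {K : ℕ} (c : FormalSum p L r K) (x : ℝ) (c' : FormalSum p L r K)
    (η : ℝ) : (c.addSMul x c').param η = c.param η + x * c'.param η := by
  simp only [FormalSum.param, FormalSum.addSMul, Finset.mul_sum, ← Finset.sum_add_distrib]
  exact Finset.sum_congr rfl fun n _ => by ring

theorem FormalSum.addSMul_fn {K : ℕ} (c : FormalSum p L r K) (x : ℝ) (c' : FormalSum p L r K)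
    (η t : ℝ) : (c.addSMul x c').fn η t = c.fn η t + x * c'.fn η t := by
  simp only [FormalSum.fn, Finset.mul_sum, ← Finset.sum_add_distrib]
  refine Finset.sum_congr rfl fun n _ => ?_
  have : (c.addSMul x c' n).fn η t = (c n).fn η t + x * (c' n).fn η t := by
    simp only [FormalTerm.fn, FormalSum.addSMul, add_mul, Finset.sum_add_distrib, mul_add,
      Finset.mul_sum, mul_assoc]
    ring
  rw [this]
  ring

/-- The formal sum with a single term. -/
def FormalSum.single {K : ℕ} (n : Fin (K + 1)) (c : FormalTerm p L r n) : FormalSum p L r K :=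
  Function.update (fun _ => 0) n c

theorem FormalSum.single_param {K : ℕ} (n : Fin (K + 1)) (c : FormalTerm p L r n) (η : ℝ) :
    (single n c).param η = c.a * η ^ (n : ℕ) := by
  unfold FormalSum.param
  rw [Finset.sum_eq_single n]
  · rw [single, Function.update_self]
  · intro m _ hm
    rw [single, Function.update_of_ne hm]
    exact zero_mul _
  · exact fun h => absurd (Finset.mem_univ n) h

theorem FormalSum.single_fn {K : ℕ} (n : Fin (K + 1)) (c : FormalTerm p L r n) (η t : ℝ) :
    (single n c).fn η t = c.fn η t * η ^ (n : ℕ) := by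
  unfold FormalSum.fn
  rw [Finset.sum_eq_single n]
  · rw [single, Function.update_self]
  · intro m _ hm
    rw [single, Function.update_of_ne hm, FormalTerm.zero_fn, zero_mul]
  · exact fun h => absurd (Finset.mem_univ n) h

theorem FormalSum.exists_polynomial {K : ℕ} (c : FormalSum p L r K) :
    ∃ A : Polynomial ℝ, ∀ η, c.param η = A.eval η := by
  refine ⟨∑ n, Polynomial.C (c n).a * Polynomial.X ^ (n : ℕ), fun η => ?_⟩
  simp [FormalSum.param, Polynomial.eval_finsetSum]

end Algebra

/-! ### Formal solutions -/

/-- The equation `η w' = (p+1) (t/η)^p w + a (t/η)^L + f` has a solution in the formal space of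
order `K`, up to `O(η^{K+1})`. -/
def FormallySolvable (p L : ℕ) (t₀ : ℝ) (K : ℕ) (f : ℝ → ℝ → ℝ) : Prop :=
  ∃ (d : FormalSum p L t₀ K) (C : ℝ), ∀ᶠ η in 𝓝[>] (0 : ℝ), ∀ t ∈ Icc (-t₀) t₀,
    ∃ D, HasDerivWithinAt (d.fn η) D (Icc (-t₀) t₀) t ∧
      |η * D - ((p + 1) * (t / η) ^ p * d.fn η t + d.param η * (t / η) ^ L + f η t)|
        ≤ C * η ^ (K + 1) * (1 + |t / η| ^ p)

namespace FormallySolvable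

variable {p L : ℕ} {t₀ : ℝ} {K : ℕ} {f g : ℝ → ℝ → ℝ}

theorem add_smul (hf : FormallySolvable p L t₀ K f) (x : ℝ) (hg : FormallySolvable p L t₀ K g) :
    FormallySolvable p L t₀ K fun η t => f η t + x * g η t := by
  obtain ⟨d, C, hd⟩ := hf
  obtain ⟨d', C', hd'⟩ := hg
  refine ⟨d.addSMul x d', C + |x| * C', ?_⟩
  filter_upwards [hd, hd'] with η h1 h2 t ht
  obtain ⟨D, hD, hDb⟩ := h1 t ht
  obtain ⟨D', hD', hDb'⟩ := h2 t ht
  refine ⟨D + x * D', ?_, ?_⟩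
  · rw [show (d.addSMul x d').fn η = fun s => d.fn η s + x * d'.fn η s from
      funext fun s => d.addSMul_fn x d' η s]
    exact hD.add (hD'.const_mul x)
  · rw [d.addSMul_fn, d.addSMul_param]
    have h3 := mul_le_mul_of_nonneg_left hDb' (abs_nonneg x)
    rw [← abs_mul] at h3
    have h4 := (abs_add_le _ _).trans (add_le_add hDb h3)
    refine (le_of_eq ?_).trans (h4.trans_eq (by ring))
    congr 1
    ring

theorem of_bound {C : ℝ} (h : ∀ᶠ η in 𝓝[>] (0 : ℝ), ∀ t ∈ Icc (-t₀) t₀,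
    |f η t| ≤ C * η ^ (K + 1) * (1 + |t / η| ^ p)) : FormallySolvable p L t₀ K f := by
  refine ⟨fun _ => 0, C, h.mono fun η h t ht => ⟨0, ?_, ?_⟩⟩
  · rw [show FormalSum.fn (fun _ => 0 : FormalSum p L t₀ K) η = fun _ => 0 from funext fun s => by
      simp [FormalSum.fn, FormalTerm.zero_fn]]
    exact hasDerivWithinAt_const _ _ _
  · have h1 : FormalSum.param (fun _ => 0 : FormalSum p L t₀ K) η = 0 :=
      Finset.sum_eq_zero fun n _ => zero_mul _
    have h2 : FormalSum.fn (fun _ => 0 : FormalSum p L t₀ K) η t = 0 := by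
      simp [FormalSum.fn, FormalTerm.zero_fn]
    rw [h1, h2, mul_zero, mul_zero, zero_mul, zero_add, zero_add, zero_sub, abs_neg]
    exact h t ht

theorem perturb (hf : FormallySolvable p L t₀ K f) {C : ℝ} (h : ∀ᶠ η in 𝓝[>] (0 : ℝ),
    ∀ t ∈ Icc (-t₀) t₀, |g η t - f η t| ≤ C * η ^ (K + 1) * (1 + |t / η| ^ p)) :
    FormallySolvable p L t₀ K g := by
  have := hf.add_smul 1 (of_bound h)
  simpa using this

theorem congr (hf : FormallySolvable p L t₀ K f) (h : ∀ᶠ η in 𝓝[>] (0 : ℝ),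
    ∀ t ∈ Icc (-t₀) t₀, g η t = f η t) : FormallySolvable p L t₀ K g :=
  hf.perturb (C := 0) (h.mono fun η h t ht => by rw [h t ht, sub_self]; simp)

theorem zero : FormallySolvable p L t₀ K fun _ _ => 0 :=
  of_bound (C := 0) (Eventually.of_forall fun η t _ => by simp)

theorem smul (x : ℝ) (hf : FormallySolvable p L t₀ K f) :
    FormallySolvable p L t₀ K fun η t => x * f η t := by
  simpa using zero.add_smul x hf

theorem add (hf : FormallySolvable p L t₀ K f) (hg : FormallySolvable p L t₀ K g) :
    FormallySolvable p L t₀ K fun η t => f η t + g η t := by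
  simpa using hf.add_smul 1 hg

theorem sum {ι : Type*} (s : Finset ι) {f : ι → ℝ → ℝ → ℝ}
    (h : ∀ i ∈ s, FormallySolvable p L t₀ K (f i)) :
    FormallySolvable p L t₀ K fun η t => ∑ i ∈ s, f i η t := by
  classical
  induction s using Finset.induction_on with
  | empty => simpa using zero
  | insert a s ha ih =>
    simp only [Finset.sum_insert ha]
    exact (h a (Finset.mem_insert_self a s)).add (ih fun i hi => h i (Finset.mem_insert_of_mem hi))

/-- A function of order `n > K` is negligible. -/
theorem of_order {n : ℕ} (hn : K < n) {C : ℝ} (h : ∀ᶠ η in 𝓝[>] (0 : ℝ), ∀ t ∈ Icc (-t₀) t₀,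
    |f η t| ≤ C * (1 + |t / η| ^ p)) : FormallySolvable p L t₀ K fun η t => η ^ n * f η t := by
  refine of_bound (C := |C|) ?_
  filter_upwards [h, Equation.eventually_small one_pos] with η h1 ⟨h2, h3⟩ t ht
  have hY : 0 ≤ 1 + |t / η| ^ p := by positivity
  rw [abs_mul, abs_of_pos (pow_pos h2 n)]
  refine (mul_le_mul (pow_le_pow_of_le_one h2.le h3 hn)
    ((h1 t ht).trans (mul_le_mul_of_nonneg_right (le_abs_self C) hY)) (abs_nonneg _)
    (by positivity)).trans_eq ?_
  rw [Nat.succ_eq_add_one]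
  ring

/-- Every formal term solves exactly some equation. -/
theorem of_term_fin (n : Fin (K + 1)) (c : FormalTerm p L t₀ n) {D : ℝ → ℝ → ℝ}
    (h : ∀ᶠ η in 𝓝[>] (0 : ℝ), ∀ t ∈ Icc (-t₀) t₀,
      HasDerivWithinAt (c.fn η) (D η t) (Icc (-t₀) t₀) t) :
    FormallySolvable p L t₀ K fun η t =>
      η ^ (n : ℕ) * (η * D η t - (p + 1) * (t / η) ^ p * c.fn η t - c.a * (t / η) ^ L) := by
  refine ⟨FormalSum.single n c, 0, h.mono fun η h t ht => ⟨D η t * η ^ (n : ℕ), ?_, ?_⟩⟩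
  · have h1 : (FormalSum.single n c).fn η = fun s => c.fn η s * η ^ (n : ℕ) :=
      funext fun s => FormalSum.single_fn n c η s
    rw [h1]
    exact (h t ht).mul_const _
  · rw [FormalSum.single_fn, FormalSum.single_param, zero_mul, zero_mul]
    refine le_of_eq (abs_eq_zero.2 ?_)
    ring

theorem of_term {n : ℕ} (hn : n ≤ K) (c : FormalTerm p L t₀ n) {D : ℝ → ℝ → ℝ}
    (h : ∀ᶠ η in 𝓝[>] (0 : ℝ), ∀ t ∈ Icc (-t₀) t₀,
      HasDerivWithinAt (c.fn η) (D η t) (Icc (-t₀) t₀) t) :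
    FormallySolvable p L t₀ K fun η t =>
      η ^ n * (η * D η t - (p + 1) * (t / η) ^ p * c.fn η t - c.a * (t / η) ^ L) :=
  of_term_fin ⟨n, Nat.lt_succ_iff.2 hn⟩ c h

theorem pow_L (n : ℕ) (hL : L < p) :
    FormallySolvable p L t₀ K fun η t => η ^ n * (t / η) ^ L := by
  rcases le_or_gt n K with hn | hn
  · have h := of_term (p := p) (L := L) (t₀ := t₀) hn
      -- The forcing `T^L` is cancelled by the parameter `a = -1`, with `w = 0`.
      ⟨-1, (0 : FormalTerm p L t₀ n).u, 0⟩ (D := fun _ _ => 0) ?_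
    · refine h.congr (Eventually.of_forall fun η t _ => ?_)
      rw [show FormalTerm.fn ⟨-1, (0 : FormalTerm p L t₀ n).u, 0⟩ η t = 0 from
        FormalTerm.zero_fn (n := n) η t]
      ring
    · refine Eventually.of_forall fun η t _ => ?_
      rw [show FormalTerm.fn ⟨-1, (0 : FormalTerm p L t₀ n).u, 0⟩ η = fun _ => 0 from
        funext fun s => FormalTerm.zero_fn (n := n) η s]
      exact hasDerivWithinAt_const _ _ _
  · refine of_order hn (C := 1) (Eventually.of_forall fun η t _ => ?_)
    rw [one_mul, abs_pow]
    exact abs_pow_le_one_add hL.le _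

/-- The equation solved by a smooth function of `t`. -/
theorem of_smooth (ht₀ : 0 < t₀) (n : ℕ) {u : ℝ → ℝ} (hu : ContDiffOn ℝ ∞ u (Icc (-t₀) t₀)) :
    FormallySolvable p L t₀ K fun η t =>
      η ^ n * (η * derivWithin u (Icc (-t₀) t₀) t - (p + 1) * (t / η) ^ p * u t) := by
  rcases le_or_gt n K with hn | hn
  · have hfn : ∀ η, ∀ t ∈ Icc (-t₀) t₀,
        FormalTerm.fn (p := p) (L := L) (n := n) ⟨0, SmoothFun.of u hu, 0⟩ η t = u t := by
      intro η t ht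
      simp [FormalTerm.fn, SmoothFun.of_apply hu ht]
    have h := of_term (p := p) (L := L) (t₀ := t₀) hn
      ⟨0, SmoothFun.of u hu, 0⟩ (D := fun _ t => derivWithin u (Icc (-t₀) t₀) t) ?_
    · refine h.congr (Eventually.of_forall fun η t ht => ?_)
      rw [hfn η t ht]
      ring
    · refine Eventually.of_forall fun η t ht => ?_
      exact ((hu.differentiableOn (by simp)) t ht).hasDerivWithinAt.congr (hfn η) (hfn η t ht)
  · obtain ⟨C, hC⟩ := isCompact_Icc.exists_bound_of_continuousOn hu.continuousOn
    obtain ⟨C', hC'⟩ := isCompact_Icc.exists_bound_of_continuousOn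
      (hu.continuousOn_derivWithin (uniqueDiffOn_symm_Icc ht₀) (by simp))
    refine of_order hn (C := |C'| + (p + 1) * |C|) ?_
    filter_upwards [Equation.eventually_small one_pos] with η ⟨h2, h3⟩ t ht
    have h4 := (hC t ht).trans (le_abs_self C)
    have h5 := (hC' t ht).trans (le_abs_self C')
    rw [Real.norm_eq_abs] at h4 h5
    refine (abs_sub _ _).trans ?_
    rw [abs_mul, abs_mul, abs_mul, abs_of_pos h2, abs_pow, abs_of_nonneg (by positivity : (0 : ℝ) ≤ p + 1)]
    set X := |t / η| ^ p
    have hX : 0 ≤ X := by positivity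
    have h6 : η * |derivWithin u (Icc (-t₀) t₀) t| ≤ 1 * |C'| :=
      mul_le_mul h3 h5 (abs_nonneg _) zero_le_one
    have h7 := mul_le_mul_of_nonneg_left h4 (by positivity : 0 ≤ (p + 1) * X)
    have h8 : 0 ≤ |C'| * X + (p + 1) * |C| := by positivity
    linarith

section Psi

variable {k : ℕ} (hk : k < p) (hkL : k ≠ L)
include hk hkL

/-- The equation solved by `ψ̄_{i,k}`. -/
theorem of_psiBar {i n : ℕ} (hi : i ≤ n) {D : ℝ → ℝ}
    (hD : ∀ T, HasDerivAt (psiBar p L i k) (D T) T)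
    (hDb : ∃ C, ∀ T, |D T - (p + 1) * T ^ p * psiBar p L i k T| ≤ C * (1 + |T| ^ p)) :
    FormallySolvable p L t₀ K fun η t =>
      η ^ n * (D (t / η) - (p + 1) * (t / η) ^ p * psiBar p L i k (t / η)) := by
  rcases le_or_gt n K with hn | hn
  · classical
    set c : FormalTerm p L t₀ n := ⟨0, (0 : FormalTerm p L t₀ n).u,
      Pi.single ⟨i, Nat.lt_succ_iff.2 hi⟩ (Pi.single ⟨⟨k, hk⟩, hkL⟩ 1)⟩ with hc
    have hfn : ∀ η t, c.fn η t = psiBar p L i k (t / η) := by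
      intro η t
      have h0 : c.u.toFun t = 0 := by
        change (Icc (-t₀) t₀).indicator (0 : ℝ → ℝ) t = 0
        rw [indicator_zero']
        rfl
      unfold FormalTerm.fn
      rw [h0, zero_add, Finset.sum_eq_single (⟨i, Nat.lt_succ_iff.2 hi⟩ : Fin (n + 1)),
        Finset.sum_eq_single (⟨⟨k, hk⟩, hkL⟩ : {k : Fin p // (k : ℕ) ≠ L})]
      · simp [hc]
      · intro b _ hb
        simp [hc, Pi.single_eq_of_ne hb]
      · exact fun h => absurd (Finset.mem_univ _) h
      · intro b _ hb
        refine Finset.sum_eq_zero fun k _ => ?_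
        simp [hc, Pi.single_eq_of_ne hb]
      · exact fun h => absurd (Finset.mem_univ _) h
    have h := of_term (p := p) (L := L) (t₀ := t₀) hn c (D := fun η t => D (t / η) / η) ?_
    · refine h.congr ?_
      filter_upwards [Equation.eventually_small one_pos] with η ⟨h2, h3⟩ t _
      rw [hfn, mul_div_cancel₀ _ h2.ne']
      simp [hc]
    · refine Eventually.of_forall fun η t _ => ?_
      rw [show c.fn η = fun s => psiBar p L i k (s / η) from funext (hfn η)]
      exact (((hD (t / η)).comp t ((hasDerivAt_id t).div_const η)).congr_deriv
        (by ring)).hasDerivWithinAt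
  · obtain ⟨C, hC⟩ := hDb
    exact of_order hn (Eventually.of_forall fun η t _ => hC (t / η))

end Psi

variable (hp : Odd p) (hLe : Even L) (hL : L < p)
include hp hLe hL

/-- The function `ψ_k` solves the equation with forcing `T^k - m_k T^L`, and the parameter takes
care of the multiple of `T^L`. -/
theorem pow (n : ℕ) {k : ℕ} (hk : k < p) :
    FormallySolvable p L t₀ K fun η t => η ^ n * (t / η) ^ k := by
  by_cases hkL : k = L
  · subst hkL
    exact pow_L n hL
  · have h1 := of_psiBar (t₀ := t₀) (K := K) hk hkL (Nat.zero_le n) (D := fun T =>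
      (p + 1) * T ^ p * psi p L k T + (T ^ k - momentRatio p L k * T ^ L)) ?_ ?_
    · have h2 := h1.add_smul (momentRatio p L k) (pow_L n hL)
      refine h2.congr (Eventually.of_forall fun η t _ => ?_)
      rw [psiBar_zero hp hLe hL hk]
      ring
    · intro T
      rw [show psiBar p L 0 k = psi p L k from funext (psiBar_zero hp hLe hL hk)]
      exact hasDerivAt_psi hp L k T
    · refine ⟨1 + |momentRatio p L k|, fun T => ?_⟩
      rw [psiBar_zero hp hLe hL hk, add_sub_cancel_left]
      refine (abs_sub _ _).trans ?_
      rw [abs_mul, abs_pow, abs_pow]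
      have h3 := abs_pow_le_one_add hk.le T
      have h4 := mul_le_mul_of_nonneg_left (abs_pow_le_one_add hL.le T)
        (abs_nonneg (momentRatio p L k))
      linarith

/-- The equation of `ψ̄_{i+1,k}` has forcing `(i+1) ψ̄_{i,k}` plus a polynomial of degree below `p`,
which is already solved. The condition `i < n` keeps the index `i+1` admissible in a term of order
`n`. -/
theorem psiBar (n : ℕ) {i k : ℕ} (hi : i < n) (hk : k < p) (hkL : k ≠ L) :
    FormallySolvable p L t₀ K fun η t => η ^ n * psiBar p L i k (t / η) := by
  have h1 := of_psiBar (t₀ := t₀) (K := K) hk hkL hi (D := fun T =>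
    (p + 1) * T ^ p * Canard.psiBar p L (i + 1) k T
      + ((i + 1 : ℕ) : ℝ) * Canard.psiBar p L (i + 1 - 1) k T
      - (p + 1) * ∑ l ∈ Finset.range p, psiCoeff p L k (i + 1 + (p - l)) * T ^ l)
    (hasDerivAt_psiBar hp hLe hL hk (i + 1)) ?_
  · have h2 := (h1.add_smul (p + 1) (sum (t₀ := t₀) (K := K) (Finset.range p)
      (f := fun l η t => psiCoeff p L k (i + 1 + (p - l)) * (η ^ n * (t / η) ^ l))
      fun l hl => (pow hp hLe hL n (Finset.mem_range.1 hl)).smul _)).smul ((i + 1 : ℝ)⁻¹)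
    refine h2.congr (Eventually.of_forall fun η t _ => ?_)
    have h3 : ∑ l ∈ Finset.range p, psiCoeff p L k (i + 1 + (p - l)) * (η ^ n * (t / η) ^ l)
        = η ^ n * ∑ l ∈ Finset.range p, psiCoeff p L k (i + 1 + (p - l)) * (t / η) ^ l := by
      rw [Finset.mul_sum]
      exact Finset.sum_congr rfl fun l _ => by ring
    have h4 : (i + 1 : ℝ) ≠ 0 := by positivity
    rw [h3, Nat.add_sub_cancel, Nat.cast_succ]
    field_simp
    ring
  · obtain ⟨B, hB⟩ := psiBar_bound hp hLe hL hk i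
    refine ⟨(i + 1) * |B| + (p + 1) * ∑ l ∈ Finset.range p, |psiCoeff p L k (i + 1 + (p - l))|,
      fun T => ?_⟩
    have h0 : ∀ x y z : ℝ, x + y - z - x = y - z := fun x y z => by ring
    rw [Nat.add_sub_cancel, Nat.cast_succ, h0, add_mul ((i + 1 : ℝ) * |B|)]
    refine (abs_sub _ _).trans (add_le_add ?_ ?_)
    · rw [abs_mul, abs_of_nonneg (by positivity : (0 : ℝ) ≤ i + 1)]
      have h5 : 0 ≤ |T| ^ p := by positivity
      have h6 := mul_le_mul_of_nonneg_left ((hB T).1.trans (le_abs_self B))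
        (by positivity : (0 : ℝ) ≤ i + 1)
      exact h6.trans (le_mul_of_one_le_right (by positivity) (by linarith))
    · rw [abs_mul, abs_of_nonneg (by positivity : (0 : ℝ) ≤ p + 1), mul_assoc]
      refine mul_le_mul_of_nonneg_left ?_ (by positivity)
      rw [Finset.sum_mul]
      refine (Finset.abs_sum_le_sum_abs _ _).trans (Finset.sum_le_sum fun l hl => ?_)
      rw [abs_mul, abs_pow]
      exact mul_le_mul_of_nonneg_left (abs_pow_le_one_add (Finset.mem_range.1 hl).le T)
        (abs_nonneg _)

variable (ht₀ : 0 < t₀)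
include ht₀

/-- Induction on `K + 1 - n`. If `v < p`, then `g(t) = g(0) + η T g₁(t)` leaves a monomial and a
term with both `n` and `v` increased. If `v = p`, the slow function `-g/(p+1)` cancels the term up
to `η` times its derivative, and one continues with `n + 1` and `v = 0`. -/
theorem pow_mul (n : ℕ) {v : ℕ} (hv : v ≤ p) {g : ℝ → ℝ} (hg : ContDiffOn ℝ ∞ g (Icc (-t₀) t₀)) :
    FormallySolvable p L t₀ K fun η t => η ^ n * (t / η) ^ v * g t := by
  induction h : K + 1 - n generalizing n v g with
  | zero =>
    obtain ⟨C, hC⟩ := isCompact_Icc.exists_bound_of_continuousOn hg.continuousOn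
    refine (of_order (by omega : K < n) (f := fun η t => (t / η) ^ v * g t) (C := |C|)
      (Eventually.of_forall fun η t ht => ?_)).congr (Eventually.of_forall fun η t _ => by ring)
    rw [abs_mul, abs_pow, mul_comm]
    exact mul_le_mul ((hC t ht).trans (le_abs_self C)) (abs_pow_le_one_add hv _) (by positivity)
      (abs_nonneg C)
  | succ j ih =>
    rcases hv.lt_or_eq with hv' | rfl
    · obtain ⟨g₁, hg₁, hgg⟩ := exists_eq_add_mul ht₀ hg
      have h1 := (ih (n + 1) (Nat.succ_le_iff.2 hv') hg₁ (by omega)).add_smul (g 0)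
        (pow hp hLe hL (t₀ := t₀) (K := K) n hv')
      refine h1.congr ?_
      filter_upwards [Equation.eventually_small one_pos] with η ⟨h2, _⟩ t _
      have h3 : t = η * (t / η) := (mul_div_cancel₀ t h2.ne').symm
      rw [hgg t, Nat.succ_eq_add_one]
      linear_combination η ^ n * (t / η) ^ v * g₁ t * h3
    · have hu : ContDiffOn ℝ ∞ (fun t => -(v + 1 : ℝ)⁻¹ * g t) (Icc (-t₀) t₀) :=
        contDiffOn_const.mul hg
      have h1 := of_smooth (p := v) (L := L) (K := K) ht₀ n hu
      have h2 := ih (n + 1) (Nat.zero_le v)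
        (hu.derivWithin (m := ∞) (uniqueDiffOn_symm_Icc ht₀) (by simp)) (by omega)
      refine (h1.add_smul (-1) h2).congr (Eventually.of_forall fun η t _ => ?_)
      field_simp
      ring

/-- In `g(t) = g(0) + η T g₁(t)` the product `T ψ̄_{i,k}` equals `ψ̄_{i+1,k} + r_{i+1}`. Thus `n`
and `i` increase together, which preserves `i < n`, and a smooth function of `t` is left over. -/
theorem mul_psiBar (n : ℕ) {i k : ℕ} (hi : i < n) (hk : k < p) (hkL : k ≠ L) {g : ℝ → ℝ}
    (hg : ContDiffOn ℝ ∞ g (Icc (-t₀) t₀)) :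
    FormallySolvable p L t₀ K fun η t => η ^ n * (g t * Canard.psiBar p L i k (t / η)) := by
  induction h : K + 1 - n generalizing n i g with
  | zero =>
    obtain ⟨C, hC⟩ := isCompact_Icc.exists_bound_of_continuousOn hg.continuousOn
    obtain ⟨B, hB⟩ := psiBar_bound hp hLe hL hk i
    refine of_order (by omega : K < n) (C := |C| * |B|) (Eventually.of_forall fun η t ht => ?_)
    rw [abs_mul]
    refine (mul_le_mul ((hC t ht).trans (le_abs_self C)) ((hB _).1.trans (le_abs_self B))
      (abs_nonneg _) (abs_nonneg C)).trans (le_mul_of_one_le_right (by positivity) ?_)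
    exact le_add_of_nonneg_right (by positivity)
  | succ j ih =>
    obtain ⟨g₁, hg₁, hgg⟩ := exists_eq_add_mul ht₀ hg
    have h1 := (ih (n + 1) (Nat.succ_lt_succ hi) hg₁ (by omega)).add_smul (g 0)
      (FormallySolvable.psiBar hp hLe hL (t₀ := t₀) (K := K) n hi hk hkL)
    have h2 := h1.add_smul (psiCoeff p L k (i + 1))
      (pow_mul hp hLe hL (K := K) ht₀ (n + 1) (Nat.zero_le p) hg₁)
    refine h2.congr ?_
    filter_upwards [Equation.eventually_small one_pos] with η ⟨h3, _⟩ t _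
    rw [hgg t, psiBar_succ hp hLe hL hk]
    field_simp
    ring

end FormallySolvable

/-! ### Formal solvability of the right-hand side of the equation -/

section

variable {p L : ℕ} {t₀ : ℝ}

theorem FormalSum.boundedFamily (hp : Odd p) (hLe : Even L) (hL : L < p) {K : ℕ}
    (c : FormalSum p L t₀ K) : BoundedFamily t₀ c.param c.fn := by
  choose B hB0 hB using fun n => (c n).fn_bound hp hLe hL
  refine ⟨∑ n, |(c n).a| + ∑ n, B n, ?_⟩
  filter_upwards [Equation.eventually_small one_pos] with η ⟨h1, h2⟩
  have h3 : 0 ≤ ∑ n, |(c n).a| := Finset.sum_nonneg fun n _ => abs_nonneg _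
  have h4 : 0 ≤ ∑ n, B n := Finset.sum_nonneg fun n _ => hB0 n
  have key : ∀ (g b : Fin (K + 1) → ℝ), (∀ n, |g n| ≤ b n) →
      |∑ n, g n * η ^ (n : ℕ)| ≤ ∑ n, b n := by
    intro g b hgb
    refine (Finset.abs_sum_le_sum_abs _ _).trans (Finset.sum_le_sum fun n _ => ?_)
    rw [abs_mul, abs_of_pos (pow_pos h1 _)]
    exact (mul_le_of_le_one_right (abs_nonneg _) (pow_le_one₀ h1.le h2)).trans (hgb n)
  exact ⟨(key _ _ fun n => le_rfl).trans (le_add_of_nonneg_right h4),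
    fun t _ => (key _ _ fun n => hB n η t).trans (le_add_of_nonneg_left h3)⟩

theorem FormalSum.continuousOn_fn (hp : Odd p) (hLe : Even L) (hL : L < p) {K : ℕ}
    (c : FormalSum p L t₀ K) (η : ℝ) : ContinuousOn (c.fn η) (Icc (-t₀) t₀) := by
  refine continuousOn_finsetSum _ fun n _ => ContinuousOn.mul ?_ continuousOn_const
  refine (c n).u.smooth.continuousOn.add (Continuous.continuousOn ?_)
  refine continuous_finsetSum _ fun i _ => continuous_finsetSum _ fun k _ => ?_
  exact ((continuous_psiBar hp hLe hL k.1.2 i).comp (continuous_id.div_const η)).const_mul _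

namespace FormallySolvable

variable {K : ℕ}

/-- A smooth factor is expanded in powers of `η`. -/
theorem smooth_mul (ht₀ : 0 < t₀) {δ : ℝ} (hδ : 0 < δ) {Ψ h : ℝ → ℝ → ℝ} {B : ℝ}
    (hΨ : ContDiffOn ℝ ∞ (fun z : ℝ × ℝ => Ψ z.1 z.2) (Icc (-t₀) t₀ ×ˢ Icc 0 δ))
    (hb : ∀ᶠ η in 𝓝[>] (0 : ℝ), ∀ t ∈ Icc (-t₀) t₀, |h η t| ≤ B)
    (hs : ∀ (n : ℕ) (φ : ℝ → ℝ), ContDiffOn ℝ ∞ φ (Icc (-t₀) t₀) →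
      FormallySolvable p L t₀ K fun η t => η ^ n * (φ t * h η t)) :
    FormallySolvable p L t₀ K fun η t => Ψ t η * h η t := by
  obtain ⟨C, hC0, hC⟩ := taylor_slice_bound (uniqueDiffOn_symm_Icc ht₀) (uniqueDiffOn_Icc hδ)
    isCompact_Icc isCompact_Icc ordConnected_Icc (left_mem_Icc.2 hδ.le) (K + 1) hΨ
  have h1 := sum (p := p) (L := L) (t₀ := t₀) (K := K) (Finset.range (K + 1))
    (f := fun j η t => (j.factorial : ℝ)⁻¹
      * (η ^ j * (iteratedDerivWithin j (Ψ t) (Icc 0 δ) 0 * h η t)))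
    fun j _ => (hs j _ (contDiffOn_iteratedDerivWithin_slice (uniqueDiffOn_symm_Icc ht₀)
      (uniqueDiffOn_Icc hδ) (left_mem_Icc.2 hδ.le) j hΨ)).smul _
  refine h1.perturb (C := C * |B|) ?_
  filter_upwards [hb, Equation.eventually_small hδ] with η h2 ⟨h3, h4⟩ t ht
  have h5 := hC t ht η ⟨h3.le, h4⟩
  rw [abs_of_pos h3] at h5
  have h6 : ∑ j ∈ Finset.range (K + 1), (j.factorial : ℝ)⁻¹
      * (η ^ j * (iteratedDerivWithin j (Ψ t) (Icc 0 δ) 0 * h η t))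
      = (∑ j ∈ Finset.range (K + 1), iteratedDerivWithin j (Ψ t) (Icc 0 δ) 0 / j.factorial * η ^ j)
        * h η t := by
    rw [Finset.sum_mul]
    exact Finset.sum_congr rfl fun j _ => by ring
  rw [h6, ← sub_mul, abs_mul]
  refine (mul_le_mul h5 ((h2 t ht).trans (le_abs_self B)) (abs_nonneg _) (by positivity)).trans ?_
  refine (le_of_eq (by ring)).trans (le_mul_of_one_le_right (by positivity : 0 ≤ C * |B| * η ^ (K + 1))
    (le_add_of_nonneg_right (by positivity)))

variable (hp : Odd p) (hLe : Even L) (hL : L < p) (ht₀ : 0 < t₀)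
include hp hLe hL ht₀

theorem pow_mul_polynomial (n : ℕ) {v : ℕ} (hv : v ≤ p) {g : ℝ → ℝ}
    (hg : ContDiffOn ℝ ∞ g (Icc (-t₀) t₀)) (A : Polynomial ℝ) :
    FormallySolvable p L t₀ K fun η t => η ^ n * A.eval η * ((t / η) ^ v * g t) := by
  refine (sum (Finset.range (A.natDegree + 1))
    (f := fun j η t => A.coeff j * (η ^ (n + j) * (t / η) ^ v * g t))
    fun j _ => (pow_mul hp hLe hL ht₀ (n + j) hv hg).smul _).congr
    (Eventually.of_forall fun η t _ => ?_)
  rw [Polynomial.eval_eq_sum_range, Finset.mul_sum, Finset.sum_mul]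
  exact Finset.sum_congr rfl fun j _ => by ring

/-- The coefficient of `α^j` in `S` is `t^v g(t)` with `v = p + 2 - q j`, so its contribution is
`η^{qj+v-(p+1)} T^v g(t)` times a polynomial in `η`. The exponent of `η` is at least `1`, and `v ≤
p` for `j ≥ 1`; the term `j = 0` vanishes. -/
theorem S_part (E : Equation p L t₀) (A : Polynomial ℝ) :
    FormallySolvable p L t₀ K fun η t => E.S t (η ^ (p - L + 1) * A.eval η) / η ^ (p + 1) := by
  set q := p - L + 1 with hq
  have hq2 : 2 ≤ q := by omega
  obtain ⟨M, hM⟩ := (isCompact_Icc (a := (0 : ℝ)) (b := 1)).exists_bound_of_continuousOn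
    A.continuous.continuousOn
  -- The Taylor remainder is `O(η^J)`, and `J - (p+1) = K + 1`.
  set J := K + p + 2 with hJ
  obtain ⟨C, hC0, hC⟩ := E.S_taylor ht₀ (by positivity : 0 < |M| + 1) J
  have hterm : ∀ j, FormallySolvable p L t₀ K fun η t =>
      iteratedDeriv j (E.S t) 0 / j.factorial * (η ^ q * A.eval η) ^ j / η ^ (p + 1) := by
    intro j
    rcases Nat.eq_zero_or_pos j with rfl | hj
    · refine zero.congr (Eventually.of_forall fun η t ht => ?_)
      simp [E.S_zero t ht]
    · obtain ⟨D, _, hD⟩ := E.S_coeff_bound ht₀ j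
      obtain ⟨g, hg, hfg⟩ := exists_eq_pow_mul ht₀ _ (E.contDiffOn_S_coeff ht₀ j) hD
      rw [← hq] at hfg
      set v := p + 2 - q * j with hv
      have hqj : q ≤ q * j := Nat.le_mul_of_pos_right q hj
      have h1 := (pow_mul_polynomial (K := K) hp hLe hL ht₀ (q * j + v - (p + 1))
        (by omega : v ≤ p) hg (A ^ j)).smul (j.factorial : ℝ)⁻¹
      refine h1.congr ?_
      filter_upwards [Equation.eventually_small one_pos] with η ⟨h2, _⟩ t ht
      have h3 : η ^ (q * j) * η ^ v = η ^ (q * j + v - (p + 1)) * η ^ (p + 1) := by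
        rw [← pow_add, ← pow_add]
        congr 1
        omega
      have h4 : t ^ v = η ^ v * (t / η) ^ v := by rw [div_pow, mul_div_cancel₀ _ (pow_pos h2 v).ne']
      rw [hfg t ht, Polynomial.eval_pow, mul_pow, ← _root_.pow_mul, div_eq_iff (pow_pos h2 _).ne', h4]
      linear_combination (t / η) ^ v * g t / j.factorial * A.eval η ^ j * h3
  refine (sum (Finset.range J) fun j _ => hterm j).perturb (C := C * |M| ^ J) ?_
  filter_upwards [Equation.eventually_small one_pos] with η ⟨h1, h2⟩ t ht
  have hA : |A.eval η| ≤ |M| := (hM η ⟨h1.le, h2⟩).trans (le_abs_self M)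
  have hηq : η ^ q ≤ η := pow_le_of_le_one h1.le h2 (by omega)
  have h3 : |η ^ q * A.eval η| ≤ η * |M| := by
    rw [abs_mul, abs_of_pos (pow_pos h1 _)]
    exact mul_le_mul hηq hA (abs_nonneg _) h1.le
  have h4 := hC t ht (η ^ q * A.eval η) (mem_symm_Icc.2 (h3.trans
    ((mul_le_of_le_one_left (abs_nonneg M) h2).trans (by linarith))))
  rw [← Finset.sum_div, ← sub_div, abs_div, abs_of_pos (pow_pos h1 (p + 1)),
    div_le_iff₀ (pow_pos h1 _)]
  refine h4.trans ((mul_le_mul_of_nonneg_left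
    (pow_le_pow_left₀ (abs_nonneg _) h3 J) hC0).trans ?_)
  have h5 : C * (η * |M|) ^ J = C * |M| ^ J * η ^ (K + 1) * η ^ (p + 1) := by
    rw [hJ]
    ring
  rw [h5]
  exact mul_le_mul_of_nonneg_right (le_mul_of_one_le_right (by positivity)
    (le_add_of_nonneg_right (by positivity))) (by positivity)

/-- The factor `η` that accompanies `u` in `P` raises the order of the `m`-th term to `n + 1 + m > m
≥ i`, which is the condition for solving with forcing `ψ̄_{i,k}`. -/
theorem mul_formalSum {N : ℕ} (c : FormalSum p L t₀ N) (n : ℕ) {φ : ℝ → ℝ}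
    (hφ : ContDiffOn ℝ ∞ φ (Icc (-t₀) t₀)) :
    FormallySolvable p L t₀ K fun η t => η ^ n * (φ t * (η * c.fn η t)) := by
  have hterm : ∀ m : Fin (N + 1), FormallySolvable p L t₀ K fun η t =>
      η ^ (n + 1 + m) * (t / η) ^ 0 * (φ t * (c m).u.toFun t)
        + ∑ i, ∑ k, (c m).b i k * (η ^ (n + 1 + m) * (φ t * Canard.psiBar p L i k.1 (t / η))) :=
    fun m => (pow_mul hp hLe hL ht₀ _ (Nat.zero_le p) (hφ.mul (c m).u.smooth)).add
      (sum _ fun i _ => sum _ fun k _ =>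
        (mul_psiBar hp hLe hL ht₀ _ (by omega) k.1.2 k.2 hφ).smul _)
  refine (sum Finset.univ fun m _ => hterm m).congr (Eventually.of_forall fun η t _ => ?_)
  rw [FormalSum.fn, Finset.mul_sum, Finset.mul_sum, Finset.mul_sum]
  refine Finset.sum_congr rfl fun m _ => ?_
  rw [FormalTerm.fn, add_mul, mul_add, mul_add, mul_add, Finset.sum_mul, Finset.mul_sum,
    Finset.mul_sum, Finset.mul_sum]
  congr 1
  · ring
  · refine Finset.sum_congr rfl fun i _ => ?_
    rw [Finset.sum_mul, Finset.mul_sum, Finset.mul_sum, Finset.mul_sum]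
    exact Finset.sum_congr rfl fun k _ => by ring

theorem rhs (E : Equation p L t₀) (hE : E.IsLinear) {N : ℕ} (c : FormalSum p L t₀ N)
    (A : Polynomial ℝ) :
    FormallySolvable p L t₀ K fun η t => E.rhs η (c.param η) (c.fn η t) (A.eval η) t := by
  obtain ⟨B, hB⟩ := c.exists_polynomial
  set δ := E.η₀ / 2 with hδ
  have hδ0 : 0 < δ := half_pos E.η₀_pos
  have hδ1 : δ < E.η₀ := half_lt_self E.η₀_pos
  have hsm : ∀ x, ContDiffOn ℝ ∞ (fun z : ℝ × ℝ => E.P z.1 x (z.2 ^ (p - L + 1) * B.eval z.2) z.2)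
      (Icc (-t₀) t₀ ×ˢ Icc 0 δ) := by
    intro x
    refine E.P_smooth.comp (f := fun z : ℝ × ℝ => (z.1, x, z.2 ^ (p - L + 1) * B.eval z.2, z.2)) ?_
      fun z hz => ⟨hz.1, trivial, trivial, hz.2.1, hz.2.2.trans_lt hδ1⟩
    have hBs : ContDiff ℝ ∞ fun z : ℝ × ℝ => B.eval z.2 := by
      have := (Polynomial.contDiff_aeval (𝕜 := ℝ) B ∞).comp (contDiff_snd (𝕜 := ℝ) (E := ℝ) (F := ℝ))
      simpa [Function.comp_def] using this
    exact ContDiff.contDiffOn (by fun_prop)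
  have h1 := smooth_mul (p := p) (L := L) (K := K) ht₀ hδ0 
    (Ψ := fun t η => E.P t 0 (η ^ (p - L + 1) * B.eval η) η) (h := fun _ _ => 1) (B := 1) (hsm 0)
    (Eventually.of_forall fun η t _ => by simp) fun n φ hφ =>
      (pow_mul hp hLe hL ht₀ n (Nat.zero_le p) hφ).congr (Eventually.of_forall fun η t _ => by ring)
  obtain ⟨M, hM0, hM⟩ := (c.boundedFamily hp hLe hL).exists_nonneg
  have h2 := smooth_mul (p := p) (L := L) (K := K) ht₀ hδ0 
    (Ψ := fun t η => E.P t 1 (η ^ (p - L + 1) * B.eval η) η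
      - E.P t 0 (η ^ (p - L + 1) * B.eval η) η) (h := fun η t => η * c.fn η t) (B := M)
    ((hsm 1).sub (hsm 0)) ?_ fun n φ hφ => mul_formalSum hp hLe hL ht₀ c n hφ
  · refine ((S_part hp hLe hL ht₀ E A).add (h1.add h2)).congr ?_
    filter_upwards [Equation.eventually_small hδ0] with η ⟨h3, h4⟩ t ht
    rw [Equation.rhs, hE.eq ht ⟨h3.le, h4.trans_lt hδ1⟩ (η * c.fn η t), hB η]
    ring
  · filter_upwards [hM, Equation.eventually_small one_pos] with η h3 ⟨h4, h5⟩ t ht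
    rw [abs_mul, abs_of_pos h4]
    exact (mul_le_of_le_one_left (abs_nonneg _) h5).trans (h3.2 t ht)

end FormallySolvable

/-- The image of a formal sum under `Ξ_η` has a formal expansion. -/
theorem Equation.exists_formal_xiImage (hp : Odd p) (hLe : Even L) (hL : L < p) (ht₀ : 0 < t₀)
    (E : Equation p L t₀) (hE : E.IsLinear) {K : ℕ} (c : FormalSum p L t₀ K) {α : ℝ → ℝ}
    {w : ℝ → ℝ → ℝ} (h : E.IsXiImage c.param c.fn α w) :
    ∃ d : FormalSum p L t₀ K, Close t₀ (K + 1) α w d.param d.fn := by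
  -- The unknown `α` occurs inside `S`, so it is found by successive approximation. If a formal sum
  -- `e` approximates `α` to `O(η^m)`, the formal problem with `e.param` in place of `α` has an
  -- error `O(η · η^m)`, and its solution is correct to `O(η^{m+1})`.
  have key : ∀ m ≤ K + 1, ∃ d : FormalSum p L t₀ K, Close t₀ m α w d.param d.fn := by
    intro m
    induction m with
    | zero =>
      intro _
      exact ⟨fun _ => 0, BoundedFamily.close_zero h.1 (FormalSum.boundedFamily hp hLe hL _)⟩
    | succ m ih =>
      intro hm
      obtain ⟨e, he⟩ := ih (by omega)
      obtain ⟨A, hA⟩ := e.exists_polynomial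
      obtain ⟨d, D, hd⟩ := FormallySolvable.rhs (K := K) hp hLe hL ht₀ E hE c A
      obtain ⟨M₁, hM₁0, hM₁⟩ := (c.boundedFamily hp hLe hL).exists_nonneg
      obtain ⟨M₂, hM₂0, hM₂⟩ := BoundedFamily.exists_nonneg h.1
      obtain ⟨M₃, hM₃0, hM₃⟩ := (e.boundedFamily hp hLe hL).exists_nonneg
      obtain ⟨C, hC0, hC⟩ := E.rhs_bounds ht₀ hL (by positivity : 0 ≤ M₁ + M₂ + M₃)
      obtain ⟨F, hF⟩ := he.1
      refine ⟨d, close_of_residual hp hLe hL ht₀ (m + 1)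
        (f := fun η t => E.rhs η (c.param η) (c.fn η t) (α η) t) h.1
        (d.boundedFamily hp hLe hL) ?_ fun r hr hrt => ⟨|D| + C * |F|, ?_⟩⟩
      · filter_upwards [h.2, eventually_small one_pos] with η h1 ⟨h2, _⟩
        exact ((E.solvesAux_iff hL h2).1 h1).1
      · filter_upwards [hd, hM₁, hM₂, hM₃, hC, hF, eventually_small one_pos]
          with η h1 h2 h3 h4 h5 h6 ⟨h7, h8⟩ t ht
        have ht' : t ∈ Icc (-t₀) t₀ := ⟨by linarith [ht.1], by linarith [ht.2]⟩
        obtain ⟨y, hy, hyb⟩ := h1 t ht'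
        refine ⟨y, hy, ?_⟩
        have hβ : c.param η ∈ Icc (-(M₁ + M₂ + M₃)) (M₁ + M₂ + M₃) :=
          mem_symm_Icc.2 (by linarith [h2.1])
        have hv : c.fn η t ∈ Icc (-(M₁ + M₂ + M₃)) (M₁ + M₂ + M₃) :=
          mem_symm_Icc.2 (by linarith [h2.2 t ht'])
        have h9 := (h5 t ht' _ hβ _ hv).2 (α η) (mem_symm_Icc.2 (by linarith [h3.1])) _ hβ _ hv
          (e.param η) (mem_symm_Icc.2 (by linarith [h4.1]))
        rw [sub_self, sub_self, abs_zero, add_zero, add_zero, hA] at h9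
        rw [hA] at h6
        set Y := 1 + |t / η| ^ p with hY
        have hY0 : 0 ≤ Y := by positivity
        have h10 : D * η ^ (K + 1) * Y ≤ |D| * η ^ (m + 1) * Y :=
          mul_le_mul_of_nonneg_right (mul_le_mul (le_abs_self D)
            (pow_le_pow_of_le_one h7.le h8 hm) (by positivity) (abs_nonneg D)) hY0
        have h11 : C * η * |α η - A.eval η| * Y ≤ C * |F| * η ^ (m + 1) * Y := by
          refine mul_le_mul_of_nonneg_right ?_ hY0
          refine (mul_le_mul_of_nonneg_left (h6.trans (mul_le_mul_of_nonneg_right (le_abs_self F)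
            (by positivity))) (by positivity : 0 ≤ C * η)).trans_eq ?_
          ring
        rw [abs_sub_comm] at h9
        have h12 := (abs_add_le _ _).trans (add_le_add (hyb.trans h10) (h9.trans h11))
        have h13 : 0 ≤ (|D| + C * |F|) * (η * |α η - d.param η|) * Y := by positivity
        refine (le_of_eq ?_).trans (h12.trans ?_)
        · congr 1
          ring
        · linarith
  exact key (K + 1) le_rfl

end

/-! ### The formal operators and the expansion of the canard solution -/

section

variable {p L : ℕ} {t₀ : ℝ}

theorem SameFamily.close {α α' : ℝ → ℝ} {u u' : ℝ → ℝ → ℝ} (h : SameFamily t₀ α u α' u') (m : ℕ) :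
    Close t₀ m α u α' u' := by
  refine ⟨⟨0, h.mono fun η h => ?_⟩, fun r hr hrt => ⟨0, h.mono fun η h t ht => ?_⟩⟩
  · rw [h.1, sub_self, abs_zero, zero_mul]
  · rw [h.2 t ⟨by linarith [ht.1], by linarith [ht.2]⟩, sub_self, abs_zero, zero_mul]

theorem FormalSum.close_proj (hp : Odd p) (hLe : Even L) (hL : L < p) {K : ℕ}
    (c : FormalSum p L t₀ (K + 1)) : Close t₀ (K + 1) c.param c.fn c.proj.param c.proj.fn := by
  obtain ⟨B, _, hB⟩ := (c (Fin.last (K + 1))).fn_bound hp hLe hL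
  refine ⟨⟨|(c (Fin.last (K + 1))).a|, ?_⟩, fun r hr hrt => ⟨B, ?_⟩⟩
  · filter_upwards [Equation.eventually_small one_pos] with η ⟨h1, _⟩
    have : c.param η - c.proj.param η = (c (Fin.last (K + 1))).a * η ^ (K + 1) := by
      rw [FormalSum.param, Fin.sum_univ_castSucc]
      exact add_sub_cancel_left _ _
    rw [this, abs_mul, abs_of_pos (pow_pos h1 _)]
  · filter_upwards [Equation.eventually_small one_pos] with η ⟨h1, _⟩ t _
    have : c.fn η t - c.proj.fn η t = (c (Fin.last (K + 1))).fn η t * η ^ (K + 1) := by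
      rw [FormalSum.fn, Fin.sum_univ_castSucc]
      exact add_sub_cancel_left _ _
    rw [this, abs_mul, abs_of_pos (pow_pos h1 _)]
    exact mul_le_mul_of_nonneg_right (hB η t) (pow_pos h1 _).le

theorem FormalSum.restrict_fn {K : ℕ} {r : ℝ} (h : r ≤ t₀) (c : FormalSum p L t₀ K) {η t : ℝ}
    (ht : t ∈ Icc (-r) r) : (c.restrict h).fn η t = c.fn η t := by
  refine Finset.sum_congr rfl fun n _ => ?_
  have : (c n).u.toFun t = ((c n).u.restrict h).toFun t := (indicator_of_mem ht _).symm
  rw [FormalTerm.fn, FormalTerm.fn, this]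
  rfl

namespace Equation

open Classical in
/-- The operator that `Ξ_η` induces on the formal sums of order `K`: the only formal sum that
represents the images under `Ξ_η`, up to `O(η^{K+1})`. -/
def formalXi (E : Equation p L t₀) (K : ℕ) (c : FormalSum p L t₀ K) : FormalSum p L t₀ K :=
  if h : ∃ d : FormalSum p L t₀ K, ∀ (α : ℝ → ℝ) (w : ℝ → ℝ → ℝ), E.IsXiImage c.param c.fn α w →
      Close t₀ (K + 1) α w d.param d.fn
  then h.choose else c

variable (hp : Odd p) (hLe : Even L) (hL : L < p) (ht₀ : 0 < t₀)
include hp hLe hL ht₀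

theorem xiDefinedAt (E : Equation p L t₀) {K : ℕ} (c : FormalSum p L t₀ K) :
    E.XiDefinedAt c.param c.fn :=
  ⟨E.exists_xiImage hp hLe hL ht₀ (c.boundedFamily hp hLe hL)
    (Eventually.of_forall (c.continuousOn_fn hp hLe hL)),
    fun _ _ _ _ h h' => E.xiImage_sameFamily hp hLe hL ht₀ (c.boundedFamily hp hLe hL) h h'⟩

theorem formalXi_close {E : Equation p L t₀} (hE : E.IsLinear) {K : ℕ} {c : FormalSum p L t₀ K}
    {α : ℝ → ℝ} {w : ℝ → ℝ → ℝ} (h : E.IsXiImage c.param c.fn α w) :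
    Close t₀ (K + 1) α w (E.formalXi K c).param (E.formalXi K c).fn := by
  have hex : ∃ d : FormalSum p L t₀ K, ∀ (α : ℝ → ℝ) (w : ℝ → ℝ → ℝ),
      E.IsXiImage c.param c.fn α w → Close t₀ (K + 1) α w d.param d.fn := by
    obtain ⟨d, hd⟩ := E.exists_formal_xiImage hp hLe hL ht₀ hE c h
    exact ⟨d, fun α' w' h' =>
      (((E.xiDefinedAt hp hLe hL ht₀ c).2 _ _ _ _ h' h).close (K + 1)).trans hd⟩
  have hdef : E.formalXi K c = hex.choose := by
    unfold formalXi
    exact dif_pos hex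
  rw [hdef]
  exact hex.choose_spec α w h

/-- Identities between formal sums are derived from analytic estimates by this uniqueness. -/
theorem eq_of_close {α : ℝ → ℝ} {w : ℝ → ℝ → ℝ} {K : ℕ} {d d' : FormalSum p L t₀ K}
    (h : Close t₀ (K + 1) α w d.param d.fn) (h' : Close t₀ (K + 1) α w d'.param d'.fn) : d = d' :=
  funext fun n => FormalSum.coeff_eq_of_close hp hLe hL ht₀ (h.symm.trans h') n n.2

theorem formalXi_congr {E E' : Equation p L t₀} (hE : E.IsLinear) (hE' : E'.IsLinear) {K : ℕ}
    (h : E.SameTaylor (K + p + 1) E') : E.formalXi K = E'.formalXi K := by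
  funext c
  obtain ⟨α, w, hαw⟩ := (E.xiDefinedAt hp hLe hL ht₀ c).1
  obtain ⟨α', w', hαw'⟩ := (E'.xiDefinedAt hp hLe hL ht₀ c).1
  exact eq_of_close hp hLe hL ht₀ (formalXi_close hp hLe hL ht₀ hE hαw)
    ((xiImage_close_of_sameTaylor hp hLe hL ht₀ hE hE' h (c.boundedFamily hp hLe hL) hαw hαw').trans
      (formalXi_close hp hLe hL ht₀ hE' hαw'))

/-- A formal sum and its truncation differ by `O(η^{K+1})`, and `Ξ_η` does not destroy this
closeness. Both sides therefore represent the same image to order `K`. -/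
theorem formalXi_compatible {E : Equation p L t₀} (hE : E.IsLinear) : Compatible E.formalXi := by
  intro K c
  obtain ⟨α, w, hαw⟩ := (E.xiDefinedAt hp hLe hL ht₀ c).1
  obtain ⟨α', w', hαw'⟩ := (E.xiDefinedAt hp hLe hL ht₀ c.proj).1
  have h1 := E.xiImage_close_succ hp hLe hL ht₀ (c.boundedFamily hp hLe hL)
    (c.proj.boundedFamily hp hLe hL) (c.close_proj hp hLe hL) hαw hαw'
  exact eq_of_close hp hLe hL ht₀ (((formalXi_close hp hLe hL ht₀ hE hαw).mono (Nat.le_succ _)).trans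
    (FormalSum.close_proj hp hLe hL _))
    ((h1.mono (Nat.le_succ _)).trans (formalXi_close hp hLe hL ht₀ hE hαw'))

theorem formalXi_formallyEquivalent {E : Equation p L t₀} (hE : E.IsLinear) {t₁ : ℝ} (h0 : 0 < t₁)
    (h1 : t₁ < t₀) : E.FormallyEquivalent t₁ E.formalXi := by
  intro K c
  refine ⟨E.xiDefinedAt hp hLe hL ht₀ c, fun α w h => ?_⟩
  obtain ⟨⟨C, hC⟩, h2⟩ := formalXi_close hp hLe hL ht₀ hE h
  obtain ⟨D, hD⟩ := h2 t₁ h0 h1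
  refine ⟨?_, fun ε hε => ?_⟩
  · have h3 : (fun η : ℝ => η ^ (K + 1)) =o[𝓝[>] 0] fun η => η ^ K :=
      (isLittleO_pow_pow (Nat.lt_succ_self K)).mono nhdsWithin_le_nhds
    refine IsBigO.trans_isLittleO (IsBigO.of_bound C ?_) h3
    filter_upwards [hC, eventually_small one_pos] with η h4 ⟨h5, _⟩
    rwa [Real.norm_eq_abs, Real.norm_eq_abs, abs_of_pos (pow_pos h5 _)]
  · filter_upwards [hD, eventually_mul_le (c := D) hε, eventually_small one_pos]
      with η h4 h5 ⟨h6, _⟩ t ht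
    refine (h4 t ht).trans ?_
    rw [pow_succ', ← mul_assoc]
    exact mul_le_mul_of_nonneg_right h5 (pow_pos h6 _).le

theorem iterate_formalXi_close {E : Equation p L t₀} (hE : E.IsLinear) {α : ℝ → ℝ}
    {u : ℝ → ℝ → ℝ} (h : E.IsCanardSolution α u) {K : ℕ} (x : FormalSum p L t₀ K) :
    Close t₀ (K + 1) α u ((E.formalXi K)^[K + 1] x).param ((E.formalXi K)^[K + 1] x).fn := by
  -- Any start is within `O(1)` of the canard solution, and each application gains one power of `η`.
  -- Hence `K + 1` iterations suffice, whatever the start.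
  have key : ∀ j ≤ K + 1, Close t₀ j α u ((E.formalXi K)^[j] x).param ((E.formalXi K)^[j] x).fn := by
    intro j
    induction j with
    | zero =>
      intro _
      exact BoundedFamily.close_zero h.1 (x.boundedFamily hp hLe hL)
    | succ j ih =>
      intro hj
      rw [Function.iterate_succ_apply']
      obtain ⟨α', w', hαw'⟩ := (E.xiDefinedAt hp hLe hL ht₀ ((E.formalXi K)^[j] x)).1
      exact (E.xiImage_close_succ hp hLe hL ht₀ h.1 (FormalSum.boundedFamily hp hLe hL _)
        (ih (by omega)) h hαw').trans ((formalXi_close hp hLe hL ht₀ hE hαw').mono hj)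
  exact key _ le_rfl

/-- The canard solution has a formal expansion, which the iteration of `Ξ_K` computes. -/
theorem exists_canard_expansion {E : Equation p L t₀} (hE : E.IsLinear) {α : ℝ → ℝ}
    {u : ℝ → ℝ → ℝ} (h : E.IsCanardSolution α u) : ∃ s : FormalSeries p L t₀, ∀ K,
      Close t₀ (K + 1) α u (s.trunc K).param (s.trunc K).fn ∧
      ∀ x : FormalSum p L t₀ K, (E.formalXi K)^[K + 1] x = s.trunc K := by
  set d : (K : ℕ) → FormalSum p L t₀ K := fun K => (E.formalXi K)^[K + 1] fun _ => 0 with hd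
  have hdc : ∀ K, Close t₀ (K + 1) α u (d K).param (d K).fn := fun K =>
    iterate_formalXi_close hp hLe hL ht₀ hE h _
  have hproj : ∀ K, (d (K + 1)).proj = d K := fun K => eq_of_close hp hLe hL ht₀
    (((hdc (K + 1)).mono (Nat.le_succ _)).trans ((d (K + 1)).close_proj hp hLe hL)) (hdc K)
  -- Compatibility of the truncations `d K` allows the series to be read off from their last terms.
  set s : FormalSeries p L t₀ := fun n => d n (Fin.last n) with hs
  have htrunc : ∀ K, s.trunc K = d K := by
    intro K
    induction K with
    | zero =>
      funext n
      obtain rfl : n = Fin.last 0 := Fin.ext (Nat.lt_one_iff.1 n.2)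
      rfl
    | succ K ih =>
      funext n
      induction n using Fin.lastCases with
      | last => rfl
      | cast n =>
        have h1 : s.trunc (K + 1) n.castSucc = s.trunc K n := rfl
        rw [h1, ih, ← hproj K]
        rfl
  refine ⟨s, fun K => ?_⟩
  rw [htrunc K]
  exact ⟨hdc K, fun x =>
    eq_of_close hp hLe hL ht₀ (iterate_formalXi_close hp hLe hL ht₀ hE h x) (hdc K)⟩

omit ht₀ in
theorem isAsymptoticExpansion_restrict {α : ℝ → ℝ} {u : ℝ → ℝ → ℝ} {s : FormalSeries p L t₀}
    (h : ∀ K, Close t₀ (K + 1) α u (s.trunc K).param (s.trunc K).fn) {t₁ : ℝ} (h0 : 0 < t₁)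
    (h1 : t₁ < t₀) :
    IsAsymptoticExpansion α u (fun n => (s n).restrict h1.le : FormalSeries p L t₁) := by
  set c : FormalSeries p L t₁ := fun n => (s n).restrict h1.le
  have hfn : ∀ K η, ∀ t ∈ Icc (-t₁) t₁, (c.trunc K).fn η t = (s.trunc K).fn η t :=
    fun K η t ht => (s.trunc K).restrict_fn h1.le ht
  have hc : IsSemiAsymptoticExpansion α u c := by
    intro K
    obtain ⟨⟨C, hC⟩, h2⟩ := h K
    obtain ⟨D, hD⟩ := h2 t₁ h0 h1
    refine ⟨IsBigO.of_bound C ?_, D, hD.mono fun η h3 t ht => ?_⟩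
    · filter_upwards [hC, eventually_small one_pos] with η h4 ⟨h5, _⟩
      rw [Real.norm_eq_abs, Real.norm_eq_abs, abs_of_pos (pow_pos h5 _)]
      exact h4
    · rw [hfn K η t ht]
      exact h3 t ht
  -- A uniform expansion on `[-t₁, t₁]` yields closeness on its compact subintervals, so the
  -- uniqueness of formal sums applies with `t₁` in place of `t₀`.
  have hclose : ∀ e : FormalSeries p L t₁, IsSemiAsymptoticExpansion α u e → ∀ K,
      Close t₁ (K + 1) α u (e.trunc K).param (e.trunc K).fn := by
    intro e he K
    obtain ⟨h2, D, hD⟩ := he K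
    obtain ⟨C, hC⟩ := h2.bound
    refine ⟨⟨C, ?_⟩, fun r hr hrt => ⟨D, hD.mono fun η h t ht =>
      h t ⟨by linarith [ht.1], by linarith [ht.2]⟩⟩⟩
    filter_upwards [hC, eventually_small one_pos] with η h4 ⟨h5, _⟩
    rwa [Real.norm_eq_abs, Real.norm_eq_abs, abs_of_pos (pow_pos h5 _)] at h4
  refine ⟨hc, fun c' hc' => funext fun n => ?_⟩
  exact congrFun (eq_of_close hp hLe hL h0 (hclose c' hc' n) (hclose c hc n)) (Fin.last n)

end Equation

end

end Canard

end

theorem theorem3 (p L : ℕ) (hp : Odd p) (hp3 : 3 ≤ p) (hL : Even L) (hLp : L < p)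
    (t₀ : ℝ) (ht₀ : 0 < t₀) :
    -- the functions `ψ̄_{i,k}` are meaningful
    (∀ i k : ℕ, k < p → k ≠ L → ∃ (q : Polynomial ℝ) (r : ℕ → ℝ),
      Canard.HasExpansionAtInfinity (fun T => T ^ i * Canard.psi p L k T) q r) ∧
    -- the formal process: operators on formal sums, determined by finitely many Taylor coefficients
    ∃ Ξ : Canard.Equation p L t₀ → (K : ℕ) →
        Canard.FormalSum p L t₀ K → Canard.FormalSum p L t₀ K,
      (∀ K : ℕ, ∃ N : ℕ, ∀ E E' : Canard.Equation p L t₀, E.IsLinear → E'.IsLinear →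
        E.SameTaylor N E' → Ξ E K = Ξ E' K) ∧
      ∀ E : Canard.Equation p L t₀, E.IsLinear →
        Canard.Compatible (Ξ E) ∧
        ∃ (α : ℝ → ℝ) (u : ℝ → ℝ → ℝ),
          -- the canard solution
          E.IsCanardSolution α u ∧
          (∀ (α' : ℝ → ℝ) (u' : ℝ → ℝ → ℝ), E.IsCanardSolution α' u' →
            Canard.SameFamily t₀ α u α' u') ∧
          ∀ (t₁ : ℝ) (_ : 0 < t₁) (ht₁ : t₁ < t₀),
            E.FormallyEquivalent t₁ (Ξ E) ∧
            -- its asymptotic expansion, and the computation of the latter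
            ∃ c : Canard.FormalSeries p L t₁,
              Canard.IsAsymptoticExpansion α u c ∧
              ∀ (K : ℕ) (x : Canard.FormalSum p L t₀ K),
                ((Ξ E K)^[K + 1] x).restrict ht₁.le = c.trunc K := by
  refine ⟨fun i k hk _ =>
      ⟨_, _, Canard.hasExpansionAtInfinity_pow_mul_psi hp hL hLp hk i⟩,
    Canard.Equation.formalXi, fun K => ⟨K + p + 1, fun E E' hE hE' h =>
      Canard.Equation.formalXi_congr hp hL hLp ht₀ hE hE' h⟩, fun E hE => ?_⟩
  obtain ⟨α, u, hαu⟩ := E.exists_canardSolution hp hL hLp ht₀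
  obtain ⟨s, hs⟩ := Canard.Equation.exists_canard_expansion hp hL hLp ht₀ hE hαu
  refine ⟨Canard.Equation.formalXi_compatible hp hL hLp ht₀ hE, α, u, hαu, fun α' u' h =>
    E.canardSolution_sameFamily hp hL hLp ht₀ hαu h, fun t₁ h0 h1 =>
      ⟨Canard.Equation.formalXi_formallyEquivalent hp hL hLp ht₀ hE h0 h1, _,
        Canard.Equation.isAsymptoticExpansion_restrict hp hL hLp (fun K => (hs K).1) h0 h1,
        fun K x => ?_⟩⟩
  rw [(hs K).2 x]
  rfl
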